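/- Let $\Gamma$ be a countably infinite (discrete) group with identity $\mathbf 1$, let $k\ge 1$ be an integer, identified with $\{0,\dots,k-1\}$, and let $S\subset\Gamma$ be finite. *Definitions.* A $k$-pattern is a map $p\colon F\to k$ with $F=\mathrm{dom}(p)\subset\Gamma$ finite; it occurs in a coloring $f\colon X\to k$ of a set with a $\Gamma$-action if there is $x\in X$ with $f(\gamma\cdot x)=p(\gamma)$ for all $\gamma\in F$. An $S$-labeled graph is a simple graph with a label $\lambda(x,y)\in S\cup S^{-1}$ for every ordered pair of adjacent vertices such that $\lambda(y,x)=\lambda(x,y)^{-1}$; homomorphisms of $S$-labeled graphs preserve adjacency and labels. The Cayley graph $G(\Gamma,S)$ has vertex set $\Gamma$, distinct $x,y$ being adjacent with $\lambda(x,y)=\sigma$ if $y=\sigma x$ with $\sigma\in S\cup S^{-1}$; $G(F,S)$ is its subgraph induced by $F$. A pattern $p\colon F\to k$ is $S$-connected if $G(F,S)$ is connected (in particular $F\neq\varnothing$), and it occurs in a coloring $f\colon V(G)\to k$ of an $S$-labeled graph $G$ if $f\circ\phi=p$ for some homomorphism $\phi\colon G(F,S)\to G$. A coloring is $\mathscr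 P$-avoiding if no $p\in\mathscr P$ occurs in it. $\mathrm{Free}(2^\Gamma)$ is the set of points with trivial stabilizer in $2^\Gamma$ under the action $(\gamma\cdot x)(\delta)=x(\delta\gamma)$. $\log^* n$ is the number of times the (binary) logarithm must be applied to $n$ before the result is at most $1$. For a finite set $D\subset\Gamma$ with $S\cup S^{-1}\cup\{\mathbf 1\}\subseteq D$, $H_{D,n}$ is the $S$-labeled graph whose vertices are the injections $D\to\{0,\dots,n-1\}$, with an edge labeled $\sigma\in S\cup S^{-1}$ from $q$ to $q'\ne q$ if and only if $q(\delta)=q'(\delta')$ whenever $\delta,\delta'\in D$ and $\delta=\delta'\sigma$. In the deterministic $\mathsf{LOCAL}$ model on an $n$-vertex $S$-labeled graph, the vertices carry distinct identifiers from $\{1,\dots,n\}$; every vertex initially knows $n$ and its identifier, and all vertices run the same algorithm. In each round all vertices synchronously send a message to their neighbors and update their states from the messages received and the labels of the edges along which they arrived; at the end every vertex outputs a color. Local computation and message size are unrestricted, and the output must be correct for every assignment of identifiers. **Theorem.** Let $\mathscr P$ be a finite set of $S$-connected $k$-patterns. The following are equivalent: 1. $\mathrm{Free}(2^\Gamma)$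 has a continuous $\mathscr P$-avoiding $k$-coloring. 2. Every free zero-dimensional Polish $\Gamma$-space has a continuous $\mathscr P$-avoiding $k$-coloring. 3. There is a deterministic $\mathsf{LOCAL}$ algorithm that, on every $n$-vertex $S$-labeled subgraph (not necessarily induced) of $G(\Gamma,S)$, outputs a $\mathscr P$-avoiding $k$-coloring in $O(\log^* n)$ rounds. Moreover, let $F_0\subseteq F_1\subseteq\cdots$ be finite subsets of $\Gamma$ with union $\Gamma$, each containing $S\cup S^{-1}\cup\{\mathbf 1\}$, and let $n_i$ be integers with $n_i\ge |F_i|^{2\log^* n_i}$ such that $D_i:=F_i^{\log^* n_i}$ contains $S\cup S^{-1}\cup\{\mathbf 1\}$ (which is automatic if $n_i\ge2$). Then (1)–(3) are also equivalent to each of: 4. Some graph $H_{D_i,n_i}$ has a $\mathscr P$-avoiding $k$-coloring. 5. All but finitely many of the graphs $H_{D_i,n_i}$ have a $\mathscr P$-avoiding $k$-coloring. -/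

import Mathlib

open scoped Pointwise

universe u

namespace ContinuousLocal

/-! ### Patterns and group actions -/

/-- A `k`-pattern: a partial map from `Γ` to `{0, …, k-1}` with finite domain. -/
structure Pattern (Γ : Type u) (k : ℕ) where
  dom : Set Γ
  finite_dom : dom.Finite
  val : dom → Fin k

/-- The pattern `p` occurs in the coloring `f` of a set `X` on which `Γ` acts. -/
def Pattern.OccursIn {Γ : Type u} [Group Γ] {k : ℕ} {X : Type*} [MulAction Γ X]
    (p : Pattern Γ k) (f : X → Fin k) : Prop :=
  ∃ x : X, ∀ γ : p.dom, f ((γ : Γ) • x) = p.val γ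

/-- `X` has a continuous `k`-coloring in which no pattern of `P` occurs. -/
def HasContinuousAvoidingColoring {Γ : Type u} [Group Γ] {k : ℕ} (P : Set (Pattern Γ k))
    (X : Type*) [TopologicalSpace X] [MulAction Γ X] : Prop :=
  ∃ f : X → Fin k, Continuous f ∧ ∀ p ∈ P, ¬ p.OccursIn f

/-- A topological space is zero-dimensional if its clopen sets form a base. -/
def IsZeroDimensional (X : Type*) [TopologicalSpace X] : Prop :=
  TopologicalSpace.IsTopologicalBasis {s : Set X | IsClopen s}

/-- An action is free if all point stabilizers are trivial. -/
def IsFreeAction (Γ : Type*) [Group Γ] (X : Type*) [MulAction Γ X] : Prop :=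
  ∀ x : X, MulAction.stabilizer Γ x = ⊥

/-- The Bernoulli shift `k^Γ`, with the product topology. -/
def Shift (Γ : Type u) (k : ℕ) : Type u := Γ → Fin k

instance (Γ : Type u) (k : ℕ) : TopologicalSpace (Shift Γ k) :=
  inferInstanceAs (TopologicalSpace (Γ → Fin k))

/-- The shift action `(γ • x) δ = x (δ * γ)`. -/
instance (Γ : Type u) [Group Γ] (k : ℕ) : MulAction Γ (Shift Γ k) where
  smul γ x := fun δ => x (δ * γ)
  one_smul x := funext fun δ => congrArg x (mul_one δ)
  mul_smul γ γ' x := funext fun δ => congrArg x (mul_assoc δ γ γ').symm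

/-- The free part of an action: the invariant set of points with trivial stabilizer. -/
def freePart (Γ : Type*) [Group Γ] (X : Type*) [MulAction Γ X] : SubMulAction Γ X where
  carrier := {x | MulAction.stabilizer Γ x = ⊥}
  smul_mem' γ x hx := by
    have hx' : MulAction.stabilizer Γ x = ⊥ := hx
    change MulAction.stabilizer Γ (γ • x) = ⊥
    rw [MulAction.stabilizer_smul_eq_stabilizer_map_conj, hx', Subgroup.map_bot]

/-! ### Labeled graphs -/

/-- An `S`-labeled graph on the vertex set `V`. The values of `label` at nonadjacent pairs
carry no information. -/
structure LabeledGraph {Γ : Type u} [Group Γ] (S : Set Γ) (V : Type*) where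
  graph : SimpleGraph V
  label : V → V → Γ
  label_mem : ∀ {x y}, graph.Adj x y → label x y ∈ S ∪ S⁻¹
  label_symm : ∀ {x y}, graph.Adj x y → label y x = (label x y)⁻¹

namespace LabeledGraph

variable {Γ : Type u} [Group Γ] {S : Set Γ} {V W : Type*}

/-- A (not necessarily induced) subgraph, with the inherited labels. -/
def ofSubgraph (G : LabeledGraph S V) (H : G.graph.Subgraph) : LabeledGraph S H.verts where
  graph := H.coe
  label x y := G.label x y
  label_mem h := G.label_mem (H.coe_adj_sub _ _ h)
  label_symm h := G.label_symm (H.coe_adj_sub _ _ h)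

/-- The subgraph induced by a set of vertices, with the inherited labels. -/
def induce (G : LabeledGraph S V) (U : Set V) : LabeledGraph S U where
  graph := G.graph.induce U
  label x y := G.label x y
  label_mem {x y} h := G.label_mem (show G.graph.Adj x y from h)
  label_symm {x y} h := G.label_symm (show G.graph.Adj x y from h)

/-- Homomorphisms preserve adjacency and labels. -/
def IsHom (G : LabeledGraph S V) (H : LabeledGraph S W) (φ : V → W) : Prop :=
  ∀ x y, G.graph.Adj x y →
    H.graph.Adj (φ x) (φ y) ∧ H.label (φ x) (φ y) = G.label x y

end LabeledGraph

/-- The Cayley graph `G(Γ, S)` of the left multiplication action: distinct `x`, `y` are adjacent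
if `y = σ * x` with `σ ∈ S ∪ S⁻¹`, and the label is this `σ`. -/
def cayleyGraph {Γ : Type u} [Group Γ] (S : Set Γ) : LabeledGraph S Γ where
  graph :=
    { Adj := fun x y => x ≠ y ∧ ∃ σ ∈ S ∪ S⁻¹, y = σ * x
      symm := ⟨by
        rintro x y ⟨hne, σ, hσ, rfl⟩
        refine ⟨hne.symm, σ⁻¹, ?_, by simp⟩
        rcases hσ with h | h
        · exact Or.inr (by simpa using h)
        · exact Or.inl h⟩
      loopless := ⟨fun x h => h.1 rfl⟩ }
  label x y := y * x⁻¹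
  label_mem := by
    rintro x y ⟨-, σ, hσ, rfl⟩
    simpa using hσ
  label_symm := by
    intro x y _
    simp

/-- A pattern is `S`-connected if its domain induces a (nonempty) connected subgraph of the
Cayley graph. -/
def Pattern.IsConnected {Γ : Type u} [Group Γ] (S : Set Γ) {k : ℕ} (p : Pattern Γ k) : Prop :=
  ((cayleyGraph S).induce p.dom).graph.Connected

/-- The pattern `p` occurs in the coloring `f` of the `S`-labeled graph `G`. -/
def Pattern.OccursInGraph {Γ : Type u} [Group Γ] {S : Set Γ} {k : ℕ} {V : Type*}
    (p : Pattern Γ k) (G : LabeledGraph S V) (f : V → Fin k) : Prop :=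
  ∃ φ : p.dom → V, ((cayleyGraph S).induce p.dom).IsHom G φ ∧ ∀ γ, f (φ γ) = p.val γ

/-- No pattern of `P` occurs in the coloring `f` of `G`. -/
def AvoidsOnGraph {Γ : Type u} [Group Γ] {S : Set Γ} {k : ℕ} {V : Type*}
    (P : Set (Pattern Γ k)) (G : LabeledGraph S V) (f : V → Fin k) : Prop :=
  ∀ p ∈ P, ¬ p.OccursInGraph G f

/-! ### The iterated logarithm -/

/-- The least number of applications of the binary logarithm that take `n` to a value at
most `1`. -/
noncomputable def logStar (n : ℕ) : ℕ :=
  sInf {i : ℕ | (Real.logb 2)^[i] (n : ℝ) ≤ 1}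

/-! ### The finite graphs `H_{D,n}` -/

/-- Compatibility of two maps along `σ`. -/
def Compatible {Γ : Type u} [Group Γ] {D : Set Γ} {n : ℕ} (σ : Γ) (q q' : D ↪ Fin n) : Prop :=
  ∀ δ δ' : D, (δ : Γ) = δ' * σ → q δ = q' δ'

theorem Compatible.symm {Γ : Type u} [Group Γ] {D : Set Γ} {n : ℕ} {σ : Γ} {q q' : D ↪ Fin n}
    (h : Compatible σ q q') : Compatible σ⁻¹ q' q := by
  intro δ δ' e
  exact (h δ' δ (by rw [e]; simp)).symm

theorem Compatible.unique {Γ : Type u} [Group Γ] {S D : Set Γ} (hD : S ∪ S⁻¹ ∪ {1} ⊆ D) {n : ℕ}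
    {σ τ : Γ} (hσ : σ ∈ S ∪ S⁻¹) (hτ : τ ∈ S ∪ S⁻¹) {q q' : D ↪ Fin n}
    (h : Compatible σ q q') (h' : Compatible τ q q') : σ = τ := by
  have e := h ⟨σ, hD (Or.inl hσ)⟩ ⟨1, hD (Or.inr rfl)⟩ (by simp)
  have e' := h' ⟨τ, hD (Or.inl hτ)⟩ ⟨1, hD (Or.inr rfl)⟩ (by simp)
  exact congrArg Subtype.val (q.injective (e.trans e'.symm))

theorem inv_mem_union_inv {Γ : Type u} [Group Γ] {S : Set Γ} {σ : Γ} (h : σ ∈ S ∪ S⁻¹) :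
    σ⁻¹ ∈ S ∪ S⁻¹ := by
  rcases h with h | h
  · exact Or.inr (by simpa using h)
  · exact Or.inl h

open Classical in
/-- The `S`-labeled graph `H_{D,n}`: its vertices are the injections `D → {0, …, n-1}`, and there
is an edge with label `σ ∈ S ∪ S⁻¹` from `q` to `q' ≠ q` if `q` and `q'` are `σ`-compatible. Such
a `σ` is unique by `Compatible.unique`. -/
noncomputable def tileGraph {Γ : Type u} [Group Γ] (S : Set Γ) (D : Set Γ)
    (hD : S ∪ S⁻¹ ∪ {1} ⊆ D) (n : ℕ) : LabeledGraph S (D ↪ Fin n) where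
  graph :=
    { Adj := fun q q' => q ≠ q' ∧ ∃ σ ∈ S ∪ S⁻¹, Compatible σ q q'
      symm := ⟨fun _ _ ⟨hne, σ, hσ, h⟩ => ⟨hne.symm, σ⁻¹, inv_mem_union_inv hσ, h.symm⟩⟩
      loopless := ⟨fun _ h => h.1 rfl⟩ }
  label q q' := if h : ∃ σ ∈ S ∪ S⁻¹, Compatible σ q q' then h.choose else 1
  label_mem := by
    rintro q q' ⟨-, h⟩
    rw [dif_pos h]
    exact h.choose_spec.1
  label_symm := by
    rintro q q' ⟨-, h⟩
    have h' : ∃ σ ∈ S ∪ S⁻¹, Compatible σ q' q :=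
      ⟨h.choose⁻¹, inv_mem_union_inv h.choose_spec.1, h.choose_spec.2.symm⟩
    rw [dif_pos h, dif_pos h']
    exact Compatible.unique hD h'.choose_spec.1 (inv_mem_union_inv h.choose_spec.1)
      h'.choose_spec.2 h.choose_spec.2.symm

/-! ### The `LOCAL` model -/

/-- A deterministic algorithm in the `LOCAL` model, for graphs whose edges carry labels in `Γ`,
with outputs in `{0, …, k-1}`. Local computations, states and messages are unrestricted. Every
vertex starts from the number `n` of vertices and its own identifier. In every round it
broadcasts a message to its neighbors, and then updates its state from the messages that it
received, each paired with the label of the edge along which it arrived. -/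
structure LocalAlgorithm (Γ : Type u) (k : ℕ) where
  State : Type u
  Msg : Type u
  init : (n : ℕ) → (ident : ℕ) → State
  send : State → Msg
  update : State → Set (Γ × Msg) → State
  output : State → Fin k

namespace LocalAlgorithm

variable {Γ : Type u} [Group Γ] {S : Set Γ} {k : ℕ} {V : Type*}

/-- The state of a vertex after `t` rounds on the graph `G`. -/
def stateAfter (A : LocalAlgorithm Γ k) (n : ℕ) (G : LabeledGraph S V) (ident : V → ℕ) :
    ℕ → V → A.State
  | 0, x => A.init n (ident x)
  | t + 1, x => A.update (A.stateAfter n G ident t x)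
      {m | ∃ y, G.graph.Adj x y ∧ m = (G.label x y, A.send (A.stateAfter n G ident t y))}

/-- The coloring computed in `t` rounds. -/
def run (A : LocalAlgorithm Γ k) (n : ℕ) (G : LabeledGraph S V) (ident : V → ℕ) (t : ℕ) (x : V) :
    Fin k :=
  A.output (A.stateAfter n G ident t x)

/-- Within `T n` rounds, `A` produces a `P`-avoiding coloring on every `n`-vertex `S`-labeled
subgraph of the Cayley graph, for every assignment of distinct identifiers from `{1, …, n}`. -/
def Solves (A : LocalAlgorithm Γ k) (S : Set Γ) (P : Set (Pattern Γ k)) (T : ℕ → ℕ) : Prop :=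
  ∀ (n : ℕ) (H : (cayleyGraph S).graph.Subgraph), H.verts.Finite → H.verts.ncard = n →
    ∀ ident : H.verts → ℕ, Function.Injective ident → (∀ x, ident x ∈ Set.Icc 1 n) →
      AvoidsOnGraph P ((cayleyGraph S).ofSubgraph H)
        (A.run n ((cayleyGraph S).ofSubgraph H) ident (T n))

end LocalAlgorithm

end ContinuousLocal

namespace ContinuousLocal

/-! Everything is routed through the graphs `H_{D,n}`. Compatibility along edges glues the
injections occurring in a connected pattern into one coloring of a piece of the group
(`isHom_apply_eq`). So a coloring of `H_{D,n}` solves the problem wherever colorings that are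
injective on all translates of the window `D` can be produced. On a free zero-dimensional space
greedy coloring produces them continuously if `n ≥ |D|²`
(`hasContinuousAvoidingColoring_of_tileGraph`). On a finite graph Cole–Vishkin color reduction
produces them in `O(log* n)` rounds with `6 ^ |D|²` colors: one six-coloring for each ordered pair
of window positions (`exists_localAlgorithm_of_tileGraph`).

Conversely, an injection of `D` can be read as an assignment of identifiers, so a local algorithm
colors `H_{D,n}` once `D` contains the ball that it sees, enlarged by the pattern radius
(`exists_tileGraph_coloring_of_solves`). Since `log*` grows so slowly, this is compatible with `|D|²
≤ n`. A continuous coloring is tested on one compact free space, `ColorSpace`: by compactness it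
reads finitely many coordinates, and `t` reduction steps compute these from an injection of a set
`D` with `|D| = O(t)`. As `6 ^ |D|²` colors shrink to six within `t` steps for a suitable `t`, the
graph `H_{D,n}` with `n = 6 ^ |D|²` is colored (`exists_tileGraph_of_colorSpace`).

It remains to pass from the free part of the shift to a free space `X`. For finitely many
prospective periods, `X` maps continuously and equivariantly into the closed set of points at which
the failure of these periods is witnessed in fixed windows. The intersection of all such closed sets
is a compact subset of the free part. There the given coloring reads finitely many coordinates, so
it extends to the whole shift, and by compactness the extension already avoids the patterns on one
of the closed sets. Only finitely many levels are thus written on `X`, which keeps the map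
continuous. The work lies in making the window for the `j`-th period independent of the number of
levels: a bit written at level `j` must stay visible whatever the other levels write. Markers,
binary codes of their colors and positions in general position achieve this by counting
(`exists_mem_T`, `eq_of_mem_ones`, `exists_mem_Q`). -/

/-! ### Color reduction along a function -/

/-- The Cole–Vishkin step: the position of the lowest bit in which `a` and `b` differ, together
with the value of this bit in `a`. -/
noncomputable def cvStep (a b : ℕ) : ℕ :=
  2 * sInf {i | a.testBit i ≠ b.testBit i} +
    (a.testBit (sInf {i | a.testBit i ≠ b.testBit i})).toNat

/-- Equal values would name the same position and the same bit of `a` and `b` there, but the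
position was chosen because these bits differ. Nothing is needed about `c`. -/
theorem cvStep_ne {a b : ℕ} (h : a ≠ b) (c : ℕ) : cvStep a b ≠ cvStep b c := by
  have hne : {i | a.testBit i ≠ b.testBit i}.Nonempty := by
    by_contra hcon
    rw [Set.not_nonempty_iff_eq_empty] at hcon
    refine h (Nat.eq_of_testBit_eq fun i => ?_)
    by_contra hi
    have : i ∈ {i | a.testBit i ≠ b.testBit i} := hi
    rw [hcon] at this
    exact this
  have hmem : a.testBit _ ≠ b.testBit _ := Nat.sInf_mem hne
  intro he
  unfold cvStep at he
  generalize sInf {i | a.testBit i ≠ b.testBit i} = i at *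
  generalize sInf {i | b.testBit i ≠ c.testBit i} = j at *
  have h1 := (a.testBit i).toNat_lt
  have h2 := (b.testBit j).toNat_lt
  have hij : i = j := by omega
  subst hij
  have : (a.testBit i).toNat = (b.testBit i).toNat := by omega
  apply hmem
  revert this
  cases a.testBit i <;> cases b.testBit i <;> simp

theorem cvStep_lt {a b l : ℕ} (hl : 1 ≤ l) (ha : a < 2 ^ l) (hb : b < 2 ^ l) :
    cvStep a b < 2 * l := by
  have hi : sInf {i | a.testBit i ≠ b.testBit i} < l := by
    -- For `a = b` the infimum takes its default value `0`, which is where `1 ≤ l` enters.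
    rcases Set.eq_empty_or_nonempty {i | a.testBit i ≠ b.testBit i} with h | h
    · rw [h, Nat.sInf_empty]; exact hl
    · by_contra hcon
      push Not at hcon
      have hmem : a.testBit _ ≠ b.testBit _ := Nat.sInf_mem h
      apply hmem
      have hp := Nat.pow_le_pow_right (n := 2) (by norm_num) hcon
      rw [Nat.testBit_lt_two_pow (ha.trans_le hp), Nat.testBit_lt_two_pow (hb.trans_le hp)]
  have := (a.testBit (sInf {i | a.testBit i ≠ b.testBit i})).toNat_lt
  unfold cvStep
  omega

/-- The number of colors after one step, starting with `a` colors. -/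
def cvBound (a : ℕ) : ℕ := 2 * Nat.clog 2 a

theorem cvBound_mono : Monotone cvBound := fun _ _ h =>
  Nat.mul_le_mul_left 2 (Nat.clog_mono_right 2 h)

theorem two_le_cvBound {a : ℕ} (h : 2 ≤ a) : 2 ≤ cvBound a := by
  have := Nat.clog_pos (b := 2) (by norm_num) h
  unfold cvBound
  omega

theorem cvStep_lt_cvBound {a b m : ℕ} (hm : 2 ≤ m) (ha : a < m) (hb : b < m) :
    cvStep a b < cvBound m :=
  cvStep_lt (Nat.clog_pos (by norm_num) hm) (ha.trans_le (Nat.le_pow_clog (by norm_num) m))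
    (hb.trans_le (Nat.le_pow_clog (by norm_num) m))

/-- The result of `t` steps along a sequence of colors, at the start of the sequence. -/
noncomputable def cvIter : ℕ → (ℕ → ℕ) → ℕ
  | 0, u => u 0
  | t + 1, u => cvStep (cvIter t u) (cvIter t fun j => u (j + 1))

/-- Each step looks one place further along the sequence. This locality bounds the size of windows
and the number of rounds later on. -/
theorem cvIter_congr {t : ℕ} {u v : ℕ → ℕ} (h : ∀ j ≤ t, u j = v j) : cvIter t u = cvIter t v := by
  induction t generalizing u v with
  | zero => exact h 0 le_rfl
  | succ t ih =>
    rw [cvIter, cvIter, ih fun j hj => h j (by omega), ih fun j hj => h (j + 1) (by omega)]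

/-- Only the first two entries have to differ, so the sequence may become constant or periodic
further on. -/
theorem cvIter_ne {t : ℕ} {u : ℕ → ℕ} (h : u 0 ≠ u 1) :
    cvIter t u ≠ cvIter t fun j => u (j + 1) := by
  induction t with
  | zero => exact h
  | succ t ih => exact cvStep_ne ih _

theorem two_le_cvBound_iterate {m : ℕ} (hm : 2 ≤ m) (t : ℕ) : 2 ≤ cvBound^[t] m := by
  induction t with
  | zero => exact hm
  | succ t ih => rw [Function.iterate_succ_apply']; exact two_le_cvBound ih

theorem cvIter_lt {m : ℕ} (hm : 2 ≤ m) {t : ℕ} {u : ℕ → ℕ} (h : ∀ j ≤ t, u j < m) :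
    cvIter t u < cvBound^[t] m := by
  induction t generalizing u with
  | zero => exact h 0 le_rfl
  | succ t ih =>
    rw [Function.iterate_succ_apply']
    exact cvStep_lt_cvBound (two_le_cvBound_iterate hm t) (ih fun j hj => h j (by omega))
      (ih fun j hj => h (j + 1) (by omega))

/-- Six is a fixed point, as `2 * ⌈log₂ 6⌉ = 6`; hence the six colors everywhere below. -/
theorem cvBound_le_six {a : ℕ} (h : a ≤ 6) : cvBound a ≤ 6 :=
  (cvBound_mono h).trans (by
    have : Nat.clog 2 6 ≤ 3 := Nat.clog_le_of_le_pow (by norm_num)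
    unfold cvBound; omega)

theorem cvBound_lt {a : ℕ} (h : 7 ≤ a) : cvBound a < a := by
  obtain h8 | h8 : a ≤ 8 ∨ 9 ≤ a := by omega
  · have : Nat.clog 2 a ≤ 3 := Nat.clog_le_of_le_pow (by omega)
    unfold cvBound; omega
  -- Used for `n = (a - 1) / 2`, where `a ≤ 2 * n + 2` and `2 * n < a`.
  · have key : ∀ n, 4 ≤ n → 2 * n + 2 ≤ 2 ^ n := by
      intro n hn
      induction n, hn using Nat.le_induction with
      | base => norm_num
      | succ n hn ih => rw [pow_succ]; omega
    have : Nat.clog 2 a ≤ (a - 1) / 2 := Nat.clog_le_of_le_pow (by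
      have := key ((a - 1) / 2) (by omega)
      omega)
    unfold cvBound
    obtain h2 | h2 := Nat.even_or_odd a
    · obtain ⟨b, rfl⟩ := h2; omega
    · obtain ⟨b, rfl⟩ := h2; omega

theorem cvBound_iterate_le_six {a t : ℕ} (h : a ≤ t + 6) : cvBound^[t] a ≤ 6 := by
  induction t generalizing a with
  | zero => simpa using h
  | succ t ih =>
    rw [Function.iterate_succ_apply]
    apply ih
    obtain h6 | h6 : a ≤ 6 ∨ 7 ≤ a := by omega
    · exact (cvBound_le_six h6).trans (by omega)
    · have := cvBound_lt h6; omega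

theorem cvBound_le_logb (a : ℕ) : (cvBound a : ℝ) ≤ 2 * (Real.logb 2 a + 1) := by
  have h1 : Nat.clog 2 a ≤ Nat.log 2 a + 1 :=
    Nat.clog_le_of_le_pow (Nat.lt_pow_succ_log_self (by norm_num) a).le
  have h2 : (Nat.log 2 a : ℝ) ≤ Real.logb 2 a := Real.natLog_le_logb a 2
  have h1' : (Nat.clog 2 a : ℝ) ≤ Nat.log 2 a + 1 := by exact_mod_cast h1
  unfold cvBound
  push_cast
  linarith

/-! ### The iterated logarithm -/

theorem logb_two_le_sub_one {r : ℝ} (hr : 2 ≤ r) : Real.logb 2 r ≤ r - 1 := by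
  rw [Real.logb_le_iff_le_rpow (by norm_num) (by linarith)]
  have := one_add_mul_self_le_rpow_one_add (s := 1) (by norm_num) (p := r - 1) (by linarith)
  norm_num at this
  linarith

/-- The iterated logarithm of a number at most `i + 1` reaches `(-∞, 1]` within `i` steps. -/
theorem exists_logb_iterate_le_one (i : ℕ) {r : ℝ} (hr : r ≤ i + 1) :
    ∃ j ≤ i, (Real.logb 2)^[j] r ≤ 1 := by
  induction i generalizing r with
  | zero => exact ⟨0, le_rfl, by simpa using hr⟩
  | succ i ih =>
    by_cases h1 : r ≤ 1
    · exact ⟨0, by omega, h1⟩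
    by_cases h2 : r ≤ 2
    · refine ⟨1, by omega, ?_⟩
      have h : Real.logb 2 r ≤ Real.logb 2 2 :=
        Real.logb_le_logb_of_le (by norm_num) (by linarith) h2
      simpa using h
    · push_cast at hr
      obtain ⟨j, hj, h⟩ := ih (r := Real.logb 2 r) (by
        have := logb_two_le_sub_one (r := r) (by linarith)
        linarith)
      exact ⟨j + 1, by omega, h⟩

theorem logb_iterate_logStar_le_one (n : ℕ) : (Real.logb 2)^[logStar n] (n : ℝ) ≤ 1 := by
  obtain ⟨j, -, h⟩ := exists_logb_iterate_le_one n (r := n) (by linarith)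
  exact Nat.sInf_mem (s := {i : ℕ | (Real.logb 2)^[i] (n : ℝ) ≤ 1}) ⟨j, h⟩

theorem one_lt_logb_iterate {n i : ℕ} (h : i < logStar n) : 1 < (Real.logb 2)^[i] (n : ℝ) := by
  have := Nat.notMem_of_lt_sInf h
  simpa using this

theorem one_le_logStar {n : ℕ} (h : 2 ≤ n) : 1 ≤ logStar n := by
  by_contra hcon
  have h0 : logStar n = 0 := by omega
  have := logb_iterate_logStar_le_one n
  rw [h0] at this
  have h2 : (2 : ℝ) ≤ n := by exact_mod_cast h
  simp at this
  omega

/-- Two logarithms lead to `m`. The crude bound suffices: balls of radius `O(m)` have size `2 ^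
O(m)`, far below `2 ^ 2 ^ m`. -/
theorem logStar_two_pow_two_pow_le (m : ℕ) : logStar (2 ^ 2 ^ m) ≤ m + 2 := by
  obtain ⟨j, hj, h⟩ := exists_logb_iterate_le_one m (r := m) (by linarith)
  have : logStar (2 ^ 2 ^ m) ≤ j + 2 := Nat.sInf_le (by
    have e1 : Real.logb 2 ((2 : ℝ) ^ 2 ^ m) = (2 : ℝ) ^ m := by
      rw [Real.logb_pow]; simp
    have e2 : Real.logb 2 ((2 : ℝ) ^ m) = m := by
      rw [Real.logb_pow]; simp
    simp only [Set.mem_ofPred_eq, Function.iterate_succ_apply]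
    push_cast
    rw [e1, e2]
    exact h)
  omega

/-- Starting from `O(n)` colors, `log* n + O(1)` steps leave six colors. -/
theorem exists_cvBound_iterate_logStar_le (A : ℕ) :
    ∃ c, ∀ n, cvBound^[logStar n + c] (A * (n + 1)) ≤ 6 := by
  -- More initial colors only make the claim harder; `A / 8 ≥ 2` is needed for `hlogA`.
  wlog hA : 16 ≤ A generalizing A
  · obtain ⟨c, hc⟩ := this 16 le_rfl
    refine ⟨c, fun n => (Monotone.iterate cvBound_mono _ ?_).trans (hc n)⟩
    exact Nat.mul_le_mul_right _ (by omega)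
  -- After `log* n` steps at most `2 * A` colors remain, and each further step above six removes at
  -- least one.
  refine ⟨2 * A, fun n => ?_⟩
  have hA' : (16 : ℝ) ≤ A := by exact_mod_cast hA
  have hlogA : 2 * Real.logb 2 A + 4 ≤ A := by
    have h1 : Real.logb 2 ((A : ℝ) / 8) ≤ (A : ℝ) / 8 - 1 :=
      logb_two_le_sub_one (by linarith)
    rw [Real.logb_div (by positivity) (by norm_num)] at h1
    have h2 : Real.logb 2 8 = 3 := by
      rw [show (8 : ℝ) = 2 ^ 3 by norm_num, Real.logb_pow]; simp
    linarith
  -- The bound is inductive: while the iterated logarithm `r` exceeds `1`, `A * (r + 1) ≤ 2 * A *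
  -- r`, so the next color count is at most `2 * log r + 2 * log A + 4 ≤ A * (log r + 1)` by
  -- `hlogA`.
  have key : ∀ i ≤ logStar n,
      ((cvBound^[i] (A * (n + 1)) : ℕ) : ℝ) ≤ A * ((Real.logb 2)^[i] (n : ℝ) + 1) := by
    intro i
    induction i with
    | zero => intro _; simp
    | succ i ih =>
      intro hi
      have hr := one_lt_logb_iterate (n := n) (i := i) (by omega)
      have hb := ih (by omega)
      rw [Function.iterate_succ_apply', Function.iterate_succ_apply']
      generalize (Real.logb 2)^[i] (n : ℝ) = r at *
      have h2 : 2 ≤ cvBound^[i] (A * (n + 1)) := two_le_cvBound_iterate (by nlinarith) i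
      generalize cvBound^[i] (A * (n + 1)) = a at *
      have ha : (0 : ℝ) < a := by exact_mod_cast (by omega : 0 < a)
      have h3 := cvBound_le_logb a
      have h4 : Real.logb 2 a ≤ Real.logb 2 (A * (2 * r)) :=
        Real.logb_le_logb_of_le (by norm_num) ha (hb.trans (by gcongr; linarith))
      rw [Real.logb_mul (by positivity) (by positivity),
        Real.logb_mul (by positivity) (by positivity), Real.logb_self_eq_one (by norm_num)] at h4
      have h5 : 0 ≤ Real.logb 2 r := Real.logb_nonneg (by norm_num) hr.le
      nlinarith
  have hend := key _ le_rfl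
  have h1 := logb_iterate_logStar_le_one n
  have h2 : cvBound^[logStar n] (A * (n + 1)) ≤ 2 * A := by
    have : ((cvBound^[logStar n] (A * (n + 1)) : ℕ) : ℝ) ≤ 2 * A := hend.trans (by nlinarith)
    exact_mod_cast this
  rw [add_comm, Function.iterate_add_apply]
  exact cvBound_iterate_le_six (by omega)

/-- Two steps bring `2 ^ (C * (t + 1) ^ 2)` colors down to a number much smaller than `t`. -/
theorem exists_cvBound_iterate_two_pow_le (C : ℕ) :
    ∃ t, cvBound^[t] (2 ^ (C * (t + 1) ^ 2)) ≤ 6 := by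
  have hlim : Filter.Tendsto (fun x : ℕ => ((18 * (C + 1) * (x + 1) ^ 2 : ℕ) : ℝ) / 2 ^ x)
      Filter.atTop (nhds 0) := by
    have h2 := tendsto_pow_const_div_const_pow_of_one_lt 2 (r := (2 : ℝ)) (by norm_num)
    have h2' := ((Filter.tendsto_add_atTop_iff_nat 1).2 h2).const_mul ((36 * (C + 1) : ℝ))
    rw [mul_zero] at h2'
    refine h2'.congr fun x => ?_
    push_cast
    field_simp
    ring
  obtain ⟨x, hx⟩ := ((hlim.eventually (gt_mem_nhds (show (0 : ℝ) < 1 by norm_num)))).exists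
  rw [div_lt_one (by positivity)] at hx
  have hx' : 18 * (C + 1) * (x + 1) ^ 2 < 2 ^ x := by exact_mod_cast hx
  -- Two steps lead below `2 ^ x` and then to at most `2 * x` colors; the other `2 * x` steps remove
  -- at least one color each until six are left.
  refine ⟨2 * x + 2, ?_⟩
  rw [Function.iterate_add_apply]
  apply cvBound_iterate_le_six
  have h1 : cvBound (2 ^ (C * (2 * x + 2 + 1) ^ 2)) ≤ 2 ^ x := by
    rw [cvBound, Nat.clog_pow 2 _ (by norm_num)]
    have h3 : (2 * x + 2 + 1) ^ 2 ≤ 9 * (x + 1) ^ 2 :=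
      (Nat.pow_le_pow_left (by omega : _ ≤ 3 * (x + 1)) 2).trans (by rw [mul_pow]; norm_num)
    calc 2 * (C * (2 * x + 2 + 1) ^ 2) ≤ 2 * ((C + 1) * (9 * (x + 1) ^ 2)) := by gcongr; omega
      _ = 18 * (C + 1) * (x + 1) ^ 2 := by ring
      _ ≤ 2 ^ x := hx'.le
  have h2 : cvBound (cvBound (2 ^ (C * (2 * x + 2 + 1) ^ 2))) ≤ 2 * x := by
    refine (cvBound_mono h1).trans ?_
    rw [cvBound, Nat.clog_pow 2 _ (by norm_num)]
  simp only [Function.iterate_succ_apply, Function.iterate_zero_apply]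
  omega

/-! ### Homomorphisms into the graphs `H_{D,n}` -/

section Tile

variable {Γ : Type u} [Group Γ] {S : Set Γ} {k : ℕ}

theorem tileGraph_label {D : Set Γ} (hD : S ∪ S⁻¹ ∪ {1} ⊆ D) {n : ℕ} {q q' : D ↪ Fin n} {σ : Γ}
    (hσ : σ ∈ S ∪ S⁻¹) (h : Compatible σ q q') : (tileGraph S D hD n).label q q' = σ := by
  have hex : ∃ σ ∈ S ∪ S⁻¹, Compatible σ q q' := ⟨σ, hσ, h⟩
  unfold tileGraph
  simp only [dif_pos hex]
  exact Compatible.unique hD hex.choose_spec.1 hσ hex.choose_spec.2 h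

theorem tileGraph_compatible_label {D : Set Γ} (hD : S ∪ S⁻¹ ∪ {1} ⊆ D) {n : ℕ}
    {q q' : D ↪ Fin n} (h : (tileGraph S D hD n).graph.Adj q q') :
    Compatible ((tileGraph S D hD n).label q q') q q' := by
  obtain ⟨-, σ, hσ, hc⟩ := h
  rwa [tileGraph_label hD hσ hc]

theorem Compatible.ne {D : Set Γ} (hD : S ∪ S⁻¹ ∪ {1} ⊆ D) {n : ℕ} {q q' : D ↪ Fin n} {σ : Γ}
    (hσ : σ ∈ S ∪ S⁻¹) (h1 : σ ≠ 1) (h : Compatible σ q q') : q ≠ q' := by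
  rintro rfl
  have e := h ⟨σ, hD (Or.inl hσ)⟩ ⟨1, hD (Or.inr rfl)⟩ (by simp)
  exact h1 (congrArg Subtype.val (q.injective e))

theorem label_mem_of_adj {x y : Γ} (h : (cayleyGraph S).graph.Adj x y) :
    y * x⁻¹ ∈ S ∪ S⁻¹ ∧ y * x⁻¹ ≠ 1 :=
  ⟨(cayleyGraph S).label_mem h, fun e => h.1 (mul_inv_eq_one.1 e).symm⟩

/-- A family of injections that is compatible along the edges of a graph with Cayley labels
is a homomorphism into `H_{D,n}`. -/
theorem isHom_tileGraph {D : Set Γ} (hD : S ∪ S⁻¹ ∪ {1} ⊆ D) {n : ℕ} {V : Type*}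
    {G : LabeledGraph S V} {φ : V → (D ↪ Fin n)} (h1 : ∀ x y, G.graph.Adj x y → G.label x y ≠ 1)
    (h : ∀ x y, G.graph.Adj x y → Compatible (G.label x y) (φ x) (φ y)) :
    G.IsHom (tileGraph S D hD n) φ := fun x y hxy =>
  ⟨⟨(h x y hxy).ne hD (G.label_mem hxy) (h1 x y hxy), _, G.label_mem hxy, h x y hxy⟩,
    tileGraph_label hD (G.label_mem hxy) (h x y hxy)⟩

theorem IsHom.comp {V W Z : Type*} {G : LabeledGraph S V} {H : LabeledGraph S W}
    {K : LabeledGraph S Z} {φ : V → W} {ψ : W → Z} (hψ : H.IsHom K ψ) (hφ : G.IsHom H φ) :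
    G.IsHom K (ψ ∘ φ) := fun x y hxy =>
  ⟨(hψ _ _ (hφ x y hxy).1).1, (hψ _ _ (hφ x y hxy).1).2.trans (hφ x y hxy).2⟩

/-- Avoiding colorings can be pulled back along homomorphisms. -/
theorem AvoidsOnGraph.comp {V W : Type*} {P : Set (Pattern Γ k)} {G : LabeledGraph S V}
    {H : LabeledGraph S W} {φ : V → W} {f : W → Fin k} (hf : AvoidsOnGraph P H f)
    (hφ : G.IsHom H φ) : AvoidsOnGraph P G (f ∘ φ) := by
  rintro p hp ⟨ψ, hψ, h⟩
  exact hf p hp ⟨φ ∘ ψ, IsHom.comp hφ hψ, h⟩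

/-- The values of a homomorphism from a connected pattern are restrictions of one map. -/
theorem isHom_apply_eq {D : Set Γ} (hD : S ∪ S⁻¹ ∪ {1} ⊆ D) {n : ℕ} {p : Pattern Γ k}
    (hp : p.IsConnected S) {φ : p.dom → (D ↪ Fin n)}
    (hφ : ((cayleyGraph S).induce p.dom).IsHom (tileGraph S D hD n) φ) (ε : Γ)
    (hε : ∀ γ : p.dom, ε * (γ : Γ)⁻¹ ∈ D) (γ γ' : p.dom) :
    φ γ ⟨ε * (γ : Γ)⁻¹, hε γ⟩ = φ γ' ⟨ε * (γ' : Γ)⁻¹, hε γ'⟩ := by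
  obtain ⟨w⟩ := hp.preconnected γ γ'
  induction w with
  | nil => rfl
  | @cons a b c hab _ ih =>
    -- The label of the edge is `b * a⁻¹`, so compatibility equates the values of `φ a` and `φ b` at
    -- the same absolute position `ε`.
    rw [← ih]
    obtain ⟨h1, h2⟩ := hφ a b hab
    have hc := tileGraph_compatible_label hD h1
    rw [h2] at hc
    refine hc _ _ ?_
    change ε * (a : Γ)⁻¹ = ε * (b : Γ)⁻¹ * ((b : Γ) * (a : Γ)⁻¹)
    group

end Tile

/-! ### Greedy recoloring -/

section Greedy

theorem exists_free_color {ι : Type*} (R : Finset ι) (f : ι → ℕ) (Q : ι → Prop) :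
    ∃ i ≤ R.card, ∀ r ∈ R, Q r → f r ≠ i := by
  classical
  by_contra! h
  have hsub : Finset.range (R.card + 1) ⊆ R.image f := by
    intro i hi
    obtain ⟨r, hr, -, e⟩ := h i (by simpa [Nat.lt_succ_iff] using hi)
    exact Finset.mem_image.2 ⟨r, hr, e⟩
  have := (Finset.card_le_card hsub).trans Finset.card_image_le
  simp at this

variable {Γ : Type u} [Group Γ] {X : Type*} [MulAction Γ X]

open Classical in
/-- Recolor greedily in the order given by `b`, keeping the colors less than `m`. -/
noncomputable def greedyColoring (R : Finset Γ) (b : X → ℕ) (m : ℕ) (x : X) : ℕ :=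
  if b x < m then b x
  else sInf {i | ∀ r ∈ R, ∀ _ : b (r • x) < b x, greedyColoring R b m (r • x) ≠ i}
termination_by b x

variable {R : Finset Γ} {b : X → ℕ} {m : ℕ}

theorem greedyColoring_of_lt {x : X} (h : b x < m) : greedyColoring R b m x = b x := by
  rw [greedyColoring, if_pos h]

theorem greedyColoring_of_le {x : X} (h : m ≤ b x) : greedyColoring R b m x =
    sInf {i | ∀ r ∈ R, b (r • x) < b x → greedyColoring R b m (r • x) ≠ i} := by
  rw [greedyColoring, if_neg (by omega)]

theorem greedyColoring_le_card {x : X} (h : m ≤ b x) : greedyColoring R b m x ≤ R.card := by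
  rw [greedyColoring_of_le h]
  obtain ⟨i, hi, hf⟩ := exists_free_color R (fun r => greedyColoring R b m (r • x))
    (fun r => b (r • x) < b x)
  exact (Nat.sInf_le (m := i) (by simpa using hf)).trans hi

theorem greedyColoring_ne_of_lt {x : X} {r : Γ} (hr : r ∈ R) (hb : b (r • x) < b x) :
    greedyColoring R b m (r • x) ≠ greedyColoring R b m x := by
  by_cases h : b x < m
  · rw [greedyColoring_of_lt h, greedyColoring_of_lt (hb.trans h)]
    exact hb.ne
  · rw [greedyColoring_of_le (x := x) (by omega)]
    obtain ⟨i, -, hf⟩ := exists_free_color R (fun r => greedyColoring R b m (r • x))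
      (fun r => b (r • x) < b x)
    exact Nat.sInf_mem (s := {i | ∀ r ∈ R, b (r • x) < b x → greedyColoring R b m (r • x) ≠ i})
      ⟨i, hf⟩ r hr hb

theorem greedyColoring_ne (hR : ∀ r ∈ R, r⁻¹ ∈ R) (hb : ∀ x, ∀ r ∈ R, b (r • x) ≠ b x) (x : X)
    {r : Γ} (hr : r ∈ R) : greedyColoring R b m (r • x) ≠ greedyColoring R b m x := by
  rcases lt_or_gt_of_ne (hb x r hr) with h | h
  · exact greedyColoring_ne_of_lt hr h
  · have := greedyColoring_ne_of_lt (m := m) (x := r • x) (hR r hr) (by simpa using h)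
    rw [inv_smul_smul] at this
    exact this.symm

/-- A smaller color was passed over only because a neighbor already has it. With `m = 0` and `i = 0`
this makes the color class `0` a maximal independent set. -/
theorem exists_greedyColoring_eq {x : X} (h : m ≤ b x) {i : ℕ} (hi : i < greedyColoring R b m x) :
    ∃ r ∈ R, greedyColoring R b m (r • x) = i := by
  rw [greedyColoring_of_le h] at hi
  have := Nat.notMem_of_lt_sInf hi
  simp only [Set.mem_ofPred_eq, not_forall, not_not] at this
  obtain ⟨r, hr, -, e⟩ := this
  exact ⟨r, hr, e⟩

/-- By induction on `b x`: the color at `x` is computed from finitely many colors at points with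
smaller `b`, which are locally constant. -/
theorem continuous_greedyColoring [TopologicalSpace X] [ContinuousConstSMul Γ X]
    (hb : Continuous b) : Continuous (greedyColoring R b m) := by
  suffices H : ∀ v x, b x = v → ∀ᶠ y in nhds x, greedyColoring R b m y = greedyColoring R b m x from
    ((IsLocallyConstant.iff_eventually_eq _).2 fun x => H _ x rfl).continuous
  have hb' : ∀ x, ∀ᶠ y in nhds x, b y = b x :=
    (IsLocallyConstant.iff_eventually_eq b).1 (IsLocallyConstant.iff_continuous b |>.2 hb)
  intro v
  induction v using Nat.strong_induction_on with
  | _ v ih =>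
    intro x hx
    have h1 : ∀ᶠ y in nhds x, ∀ r ∈ R, b (r • y) = b (r • x) ∧ (b (r • x) < b x →
        greedyColoring R b m (r • y) = greedyColoring R b m (r • x)) := by
      rw [Filter.eventually_all_finset]
      intro r _
      have hcont : Filter.Tendsto (fun y : X => r • y) (nhds x) (nhds (r • x)) :=
        (continuous_const_smul r).continuousAt
      refine (hcont.eventually (hb' _)).and ?_
      by_cases hlt : b (r • x) < b x
      · filter_upwards [hcont.eventually (ih _ (hx ▸ hlt) (r • x) rfl)] with y hy _ using hy
      · exact Filter.Eventually.of_forall fun y h => absurd h hlt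
    filter_upwards [h1, hb' x] with y hy hyx
    by_cases h : b x < m
    · rw [greedyColoring_of_lt h, greedyColoring_of_lt (hyx ▸ h), hyx]
    · rw [greedyColoring_of_le (x := x) (by omega), greedyColoring_of_le (x := y) (by omega)]
      congr 1
      ext i
      simp only [Set.mem_ofPred_eq, hyx]
      refine forall_congr' fun r => forall_congr' fun hr => ?_
      rw [(hy r hr).1]
      exact forall_congr' fun hlt => by rw [(hy r hr).2 hlt]

/-- A finite set of group elements has a continuous proper coloring with countably many colors. -/
theorem exists_continuous_nat_coloring [TopologicalSpace X] [SecondCountableTopology X] [T2Space X]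
    [ContinuousConstSMul Γ X] (hX : IsZeroDimensional X) (hfree : IsFreeAction Γ X)
    (R : Finset Γ) (hR : (1 : Γ) ∉ R) :
    ∃ b : X → ℕ, Continuous b ∧ ∀ x, ∀ r ∈ R, b (r • x) ≠ b x := by
  classical
  cases isEmpty_or_nonempty X
  · exact ⟨fun _ => 0, continuous_const, fun x => isEmptyElim x⟩
  have hne : ∀ x : X, ∀ r ∈ R, r • x ≠ x := by
    intro x r hr h
    have : r ∈ MulAction.stabilizer Γ x := h
    rw [hfree x, Subgroup.mem_bot] at this
    exact hR (this ▸ hr)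
  -- Freeness and the Hausdorff property give independent clopen neighborhoods. By second
  -- countability countably many cover, and the first one containing a point is its color.
  have hU : ∀ x : X, ∃ U : Set X, IsClopen U ∧ x ∈ U ∧ ∀ y ∈ U, ∀ r ∈ R, r • y ∉ U := by
    intro x
    have h1 : ∀ r ∈ R, ∃ V ∈ nhds x, ∀ y ∈ V, r • y ∉ V := by
      intro r hr
      obtain ⟨A, B, hA, hB, hxA, hxB, hd⟩ := t2_separation (hne x r hr)
      refine ⟨B ∩ (fun y => r • y) ⁻¹' A, Filter.inter_mem (hB.mem_nhds hxB)
        ((hA.preimage (continuous_const_smul r)).mem_nhds hxA), ?_⟩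
      rintro y ⟨-, hy⟩ ⟨hy', -⟩
      exact Set.disjoint_left.1 hd hy hy'
    choose! V hV hV' using h1
    have h2 : (⋂ r ∈ R, V r) ∈ nhds x := (Filter.biInter_finset_mem R).2 hV
    obtain ⟨U, hU, hxU, hUV⟩ := hX.mem_nhds_iff.1 h2
    refine ⟨U, hU, hxU, fun y hy r hr hry => hV' r hr y ?_ ?_⟩
    · exact Set.mem_iInter₂.1 (hUV hy) r hr
    · exact Set.mem_iInter₂.1 (hUV hry) r hr
  choose U hUc hxU hUR using hU
  obtain ⟨s, hs, hcov⟩ := TopologicalSpace.countable_cover_nhds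
    (fun x => (hUc x).isOpen.mem_nhds (hxU x))
  have hsne : s.Nonempty := by
    by_contra h
    rw [Set.not_nonempty_iff_eq_empty] at h
    rw [h] at hcov
    simp at hcov
    exact Set.empty_ne_univ hcov
  obtain ⟨e, he⟩ := hs.exists_eq_range hsne
  have hex : ∀ x, ∃ i, x ∈ U (e i) := by
    intro x
    have : x ∈ ⋃ y ∈ s, U y := hcov ▸ Set.mem_univ x
    obtain ⟨y, hy, hxy⟩ := Set.mem_iUnion₂.1 this
    rw [he] at hy
    obtain ⟨i, rfl⟩ := hy
    exact ⟨i, hxy⟩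
  refine ⟨fun x => Nat.find (hex x), ?_, ?_⟩
  · refine ((IsLocallyConstant.iff_eventually_eq _).2 fun x => ?_).continuous
    have h1 : ∀ᶠ y in nhds x, ∀ i ∈ Finset.range (Nat.find (hex x)), y ∉ U (e i) := by
      rw [Filter.eventually_all_finset]
      intro i hi
      exact (hUc (e i)).compl.isOpen.mem_nhds (Nat.find_min (hex x) (Finset.mem_range.1 hi))
    filter_upwards [h1, (hUc _).isOpen.mem_nhds (Nat.find_spec (hex x))] with y hy hy'
    rw [Nat.find_eq_iff]
    exact ⟨hy', fun i hi => hy i (Finset.mem_range.2 hi)⟩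
  · intro x r hr h
    have h1 := Nat.find_spec (hex x)
    have h2 := Nat.find_spec (hex (r • x))
    simp only at h
    rw [h] at h2
    exact hUR _ _ h1 r hr h2

/-- A continuous proper coloring for a finite set `R` of group elements, with at most `|R| + 1`
colors, such that every point of color other than `0` has a neighbor of color `0`. -/
theorem exists_continuous_coloring [TopologicalSpace X] [SecondCountableTopology X] [T2Space X]
    [ContinuousConstSMul Γ X] (hX : IsZeroDimensional X) (hfree : IsFreeAction Γ X)
    (R : Finset Γ) (hR : (1 : Γ) ∉ R) (hinv : ∀ r ∈ R, r⁻¹ ∈ R) :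
    ∃ c : X → ℕ, Continuous c ∧ (∀ x, ∀ r ∈ R, c (r • x) ≠ c x) ∧ (∀ x, c x ≤ R.card) ∧
      ∀ x, c x ≠ 0 → ∃ r ∈ R, c (r • x) = 0 := by
  obtain ⟨b, hb, hbR⟩ := exists_continuous_nat_coloring hX hfree R hR
  exact ⟨greedyColoring R b 0, continuous_greedyColoring hb,
    fun x r hr => greedyColoring_ne hinv hbR x hr, fun x => greedyColoring_le_card (Nat.zero_le _),
    fun x hx => exists_greedyColoring_eq (Nat.zero_le _) (Nat.pos_of_ne_zero hx)⟩

end Greedy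

/-- A coloring of `H_{D,n}` with `n ≥ |D|²` yields continuous colorings. -/
theorem hasContinuousAvoidingColoring_of_tileGraph {Γ : Type u} [Group Γ] {S : Set Γ} {k : ℕ}
    {P : Set (Pattern Γ k)} {D : Set Γ} (hfin : D.Finite) (hD : S ∪ S⁻¹ ∪ {1} ⊆ D) {n : ℕ}
    (hn : D.ncard ^ 2 ≤ n) {F : (D ↪ Fin n) → Fin k} (hF : AvoidsOnGraph P (tileGraph S D hD n) F)
    (X : Type*) [TopologicalSpace X] [SecondCountableTopology X] [T2Space X] [MulAction Γ X]
    [ContinuousConstSMul Γ X] (hX : IsZeroDimensional X) (hfree : IsFreeAction Γ X) :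
    HasContinuousAvoidingColoring P X := by
  classical
  set E : Finset Γ := hfin.toFinset with hE
  have hmem : ∀ {δ}, δ ∈ E ↔ δ ∈ D := by simp [hE]
  have h1E : (1 : Γ) ∈ E := hmem.2 (hD (Or.inr rfl))
  -- A coloring that is proper for all nontrivial quotients is injective on every translate of `D`.
  -- Removing `1` from the quotients leaves fewer than `|D|²` of them, so `|R| + 1 ≤ n` colors
  -- suffice.
  set R : Finset Γ := (E * E⁻¹).erase 1 with hRdef
  have hRcard : R.card < n := by
    have h1 : (1 : Γ) ∈ E * E⁻¹ := by
      simpa using Finset.mul_mem_mul h1E (Finset.inv_mem_inv h1E)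
    have h2 := Finset.card_erase_lt_of_mem h1
    have h3 := Finset.card_mul_le (s := E) (t := E⁻¹)
    rw [Finset.card_inv] at h3
    rw [Set.ncard_eq_toFinset_card D hfin] at hn
    nlinarith
  obtain ⟨c, hc, hcR, hcn, -⟩ := exists_continuous_coloring hX hfree R (by simp [hRdef]) (by
    intro r hr
    rw [hRdef, Finset.mem_erase] at hr ⊢
    refine ⟨by simpa using hr.1, ?_⟩
    obtain ⟨a, ha, b, hb, e⟩ := Finset.mem_mul.1 hr.2
    rw [← e, mul_inv_rev]
    exact Finset.mul_mem_mul (Finset.mem_inv'.1 hb) (Finset.inv_mem_inv ha))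
  let q : X → (D ↪ Fin n) := fun x =>
    { toFun := fun δ => ⟨c ((δ : Γ) • x), (hcn _).trans_lt hRcard⟩
      inj' := by
        intro δ δ' h
        by_contra hne
        have h' : c ((δ : Γ) • x) = c ((δ' : Γ) • x) := congrArg Fin.val h
        refine hcR ((δ' : Γ) • x) ((δ : Γ) * (δ' : Γ)⁻¹) ?_ ?_
        · rw [hRdef, Finset.mem_erase]
          refine ⟨fun e => hne (Subtype.ext (mul_inv_eq_one.1 e)),
            Finset.mul_mem_mul (hmem.2 δ.2) (Finset.inv_mem_inv (hmem.2 δ'.2))⟩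
        · rw [mul_smul, inv_smul_smul, h'] }
  refine ⟨fun x => F (q x), ?_, ?_⟩
  · have hq : IsLocallyConstant q := by
      rw [IsLocallyConstant.iff_eventually_eq]
      intro x
      have hc' := (IsLocallyConstant.iff_eventually_eq c).1 ((IsLocallyConstant.iff_continuous c).2 hc)
      have : ∀ᶠ y in nhds x, ∀ δ ∈ E, c (δ • y) = c (δ • x) := by
        rw [Filter.eventually_all_finset]
        intro δ _
        exact (continuous_const_smul δ).continuousAt.eventually (hc' _)
      filter_upwards [this] with y hy
      ext δ
      exact hy δ (hmem.2 δ.2)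
    exact (hq.comp F).continuous
  · rintro p hp ⟨x, hx⟩
    -- Windows along one orbit are restrictions of one coloring, hence compatible.
    refine hF p hp ⟨fun γ => q ((γ : Γ) • x), isHom_tileGraph hD ?_ ?_, hx⟩
    · intro γ γ' h
      exact (label_mem_of_adj h).2
    · intro γ γ' h δ δ' e
      apply Fin.ext
      change c ((δ : Γ) • (γ : Γ) • x) = c ((δ' : Γ) • (γ' : Γ) • x)
      have e' : (δ : Γ) = δ' * ((γ' : Γ) * (γ : Γ)⁻¹) := e
      rw [e', smul_smul, smul_smul]
      congr 2
      group

/-! ### From local algorithms to the graphs `H_{D,n}` -/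

/-- Two vertices with the same surroundings are in the same state. -/
theorem LocalAlgorithm.stateAfter_congr {Γ : Type u} [Group Γ] {S : Set Γ} {k : ℕ} {V W : Type*}
    (A : LocalAlgorithm Γ k) (n : ℕ) (G : LabeledGraph S V) (H : LabeledGraph S W) (ident : V → ℕ)
    (ident' : W → ℕ) (ρ : ℕ → V → W → Prop) (h0 : ∀ t x y, ρ t x y → ident x = ident' y)
    (hs : ∀ t x y, ρ (t + 1) x y → ρ t x y ∧
      (∀ x', G.graph.Adj x x' → ∃ y', H.graph.Adj y y' ∧ G.label x x' = H.label y y' ∧ ρ t x' y') ∧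
      (∀ y', H.graph.Adj y y' → ∃ x', G.graph.Adj x x' ∧ G.label x x' = H.label y y' ∧ ρ t x' y'))
    (t : ℕ) (x : V) (y : W) (h : ρ t x y) :
    A.stateAfter n G ident t x = A.stateAfter n H ident' t y := by
  -- The index of `ρ` counts the rounds still to be explained.
  induction t generalizing x y with
  | zero => rw [stateAfter, stateAfter, h0 0 x y h]
  | succ t ih =>
    obtain ⟨h1, h2, h3⟩ := hs t x y h
    rw [stateAfter, stateAfter, ih x y h1]
    congr 1
    ext m
    constructor
    · rintro ⟨x', hx, rfl⟩
      obtain ⟨y', hy, hl, hr⟩ := h2 x' hx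
      exact ⟨y', hy, by rw [hl, ih _ _ hr]⟩
    · rintro ⟨y', hy, rfl⟩
      obtain ⟨x', hx, hl, hr⟩ := h3 y' hy
      exact ⟨x', hx, by rw [hl, ih _ _ hr]⟩

theorem exists_subset_of_monotone {α : Type*} {F : ℕ → Set α} (hF : Monotone F) {V : Set α}
    (hV : V.Finite) (h : ∀ v ∈ V, ∃ i, v ∈ F i) : ∃ i, V ⊆ F i := by
  choose! i hi using h
  obtain ⟨N, hN⟩ := (hV.image i).bddAbove
  exact ⟨N, fun v hv => hF (hN ⟨v, hv, rfl⟩) (hi v hv)⟩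

theorem finite_set_pow {Γ : Type u} [Group Γ] {B : Set Γ} (hB : B.Finite) (n : ℕ) :
    (B ^ n).Finite := by
  induction n with
  | zero => rw [pow_zero]; exact Set.finite_one
  | succ n ih => rw [pow_succ]; exact ih.mul hB

theorem monotone_ball_pow {Γ : Type u} [Group Γ] (S : Set Γ) :
    Monotone fun i : ℕ => (S ∪ S⁻¹ ∪ {1}) ^ i := fun _ _ h =>
  Set.pow_subset_pow_right (Or.inr rfl) h

/-- The connected patterns of a finite set have bounded radius. -/
theorem exists_pattern_radius {Γ : Type u} [Group Γ] {S : Set Γ} {k : ℕ} {P : Set (Pattern Γ k)}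
    (hP : P.Finite) (hconn : ∀ p ∈ P, p.IsConnected S) :
    ∃ r : ℕ, ∀ p ∈ P, ∀ γ ∈ p.dom, ∀ γ' ∈ p.dom, γ * γ'⁻¹ ∈ (S ∪ S⁻¹ ∪ {1}) ^ r := by
  have hfin : (⋃ p ∈ P, p.dom * p.dom⁻¹).Finite :=
    hP.biUnion fun p _ => p.finite_dom.mul p.finite_dom.inv
  obtain ⟨r, hr⟩ := exists_subset_of_monotone (monotone_ball_pow S) hfin (by
    intro v hv
    obtain ⟨p, hp, hv⟩ := Set.mem_iUnion₂.1 hv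
    obtain ⟨γ, hγ, δ, hδ, rfl⟩ := Set.mem_mul.1 hv
    obtain ⟨w⟩ := (hconn p hp).preconnected ⟨δ⁻¹, Set.mem_inv.1 hδ⟩ ⟨γ, hγ⟩
    suffices H : ∀ a b : p.dom, ((cayleyGraph S).induce p.dom).graph.Walk a b →
        ∃ i : ℕ, (b : Γ) * (a : Γ)⁻¹ ∈ (S ∪ S⁻¹ ∪ {1}) ^ i by simpa using H _ _ w
    intro a b w
    induction w with
    | nil => exact ⟨0, by simp⟩
    | @cons a b c hab _ ih =>
      obtain ⟨i, hi⟩ := ih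
      refine ⟨i + 1, ?_⟩
      have h1 : (b : Γ) * (a : Γ)⁻¹ ∈ S ∪ S⁻¹ ∪ {1} := Or.inl (label_mem_of_adj hab).1
      have := Set.mul_mem_mul hi h1
      rw [← pow_succ] at this
      convert this using 1
      group)
  refine ⟨r, fun p hp γ hγ δ hδ => hr (Set.mem_iUnion₂.2 ⟨p, hp, ?_⟩)⟩
  exact Set.mul_mem_mul hγ (Set.inv_mem_inv.2 hδ)

/-- If `D` contains the ball that is seen by a local algorithm, the algorithm colors `H_{D,n}`. -/
theorem exists_tileGraph_coloring_of_solves {Γ : Type u} [Group Γ] [Infinite Γ] {S : Set Γ} {k : ℕ}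
    {P : Set (Pattern Γ k)} (hconn : ∀ p ∈ P, p.IsConnected S) {A : LocalAlgorithm Γ k} {T : ℕ → ℕ}
    (hA : A.Solves S P T) {r : ℕ}
    (hr : ∀ p ∈ P, ∀ γ ∈ p.dom, ∀ γ' ∈ p.dom, γ * γ'⁻¹ ∈ (S ∪ S⁻¹ ∪ {1}) ^ r) (n : ℕ) {D : Set Γ}
    (hD : S ∪ S⁻¹ ∪ {1} ⊆ D) (hsub : (S ∪ S⁻¹ ∪ {1}) ^ (T n + r) ⊆ D) :
    ∃ f, AvoidsOnGraph P (tileGraph S D hD n) f := by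
  classical
  -- A simulation only: the algorithm is told `n`, although `D` need not have `n` points. Its output
  -- at `1` is trusted because the visible part will be embedded in a genuine `n`-vertex graph.
  refine ⟨fun q => A.run n ((cayleyGraph S).induce D) (fun δ => (q δ : ℕ) + 1) (T n)
    ⟨1, hD (Or.inr rfl)⟩, ?_⟩
  rintro p hp ⟨φ, hφ, hval⟩
  obtain ⟨γ₀⟩ := (hconn p hp).nonempty
  set B : Set Γ := S ∪ S⁻¹ ∪ {1} with hB
  have hmono := monotone_ball_pow S
  -- The existence of an injection `D → Fin n` forces `D` to be finite.
  have hBfin : (B ^ (T n + r)).Finite := by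
    have : Finite D := Finite.of_injective (φ γ₀) (φ γ₀).injective
    exact (Set.toFinite D).subset hsub
  have hUinf : Infinite ↥((fun u => u * (γ₀ : Γ)) '' (B ^ (T n + r)))ᶜ :=
    ((hBfin.image _).infinite_compl).to_subtype
  let g := Infinite.natEmbedding ↥((fun u => u * (γ₀ : Γ)) '' (B ^ (T n + r)))ᶜ
  -- The identifiers that `φ γ₀` uses on the ball go to the corresponding points around `γ₀`; the
  -- unused ones go to points outside, of which the infinite group has enough. The image is the
  -- vertex set of the `n`-vertex graph.
  let j : Fin n → Γ := fun i =>
    if h : ∃ u, ∃ hu : u ∈ B ^ (T n + r), φ γ₀ ⟨u, hsub hu⟩ = i then h.choose * γ₀ else g i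
  have hj1 : ∀ u (hu : u ∈ B ^ (T n + r)), j (φ γ₀ ⟨u, hsub hu⟩) = u * γ₀ := by
    intro u hu
    have h : ∃ u', ∃ hu' : u' ∈ B ^ (T n + r), φ γ₀ ⟨u', hsub hu'⟩ = φ γ₀ ⟨u, hsub hu⟩ :=
      ⟨u, hu, rfl⟩
    have e : h.choose = u := congrArg Subtype.val ((φ γ₀).injective h.choose_spec.choose_spec)
    simp only [j]
    rw [dif_pos h, e]
  have hj2 : ∀ i, (¬ ∃ u, ∃ hu : u ∈ B ^ (T n + r), φ γ₀ ⟨u, hsub hu⟩ = i) → j i = g i := by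
    intro i h
    simp only [j]
    rw [dif_neg h]
  have hjinj : Function.Injective j := by
    intro a b hab
    by_cases ha : ∃ u, ∃ hu : u ∈ B ^ (T n + r), φ γ₀ ⟨u, hsub hu⟩ = a
    · by_cases hb : ∃ u, ∃ hu : u ∈ B ^ (T n + r), φ γ₀ ⟨u, hsub hu⟩ = b
      · obtain ⟨u, hu, rfl⟩ := ha
        obtain ⟨v, hv, rfl⟩ := hb
        rw [hj1 u hu, hj1 v hv] at hab
        have := mul_right_cancel hab
        subst this
        rfl
      · obtain ⟨u, hu, rfl⟩ := ha
        rw [hj1 u hu, hj2 b hb] at hab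
        exact absurd ⟨u, hu, hab⟩ (g b).2
    · by_cases hb : ∃ u, ∃ hu : u ∈ B ^ (T n + r), φ γ₀ ⟨u, hsub hu⟩ = b
      · obtain ⟨u, hu, rfl⟩ := hb
        rw [hj1 u hu, hj2 a ha] at hab
        exact absurd ⟨u, hu, hab.symm⟩ (g a).2
      · rw [hj2 a ha, hj2 b hb] at hab
        exact Fin.ext (g.injective (Subtype.ext hab))
  let H : (cayleyGraph S).graph.Subgraph := (⊤ : (cayleyGraph S).graph.Subgraph).induce (Set.range j)
  let e : Fin n ≃ H.verts := Equiv.ofInjective j hjinj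
  let ident : H.verts → ℕ := fun y => (e.symm y : ℕ) + 1
  have hadj : ∀ y y' : H.verts, ((cayleyGraph S).ofSubgraph H).graph.Adj y y' ↔
      (cayleyGraph S).graph.Adj y y' := by
    intro y y'
    refine ⟨fun h => H.coe_adj_sub _ _ h, fun h => ?_⟩
    exact ⟨y.2, y'.2, h⟩
  have hmemU : ∀ γ : p.dom, ∀ u ∈ B ^ (T n), u * (γ : Γ) * (γ₀ : Γ)⁻¹ ∈ B ^ (T n + r) := by
    intro γ u hu
    rw [pow_add, mul_assoc]
    exact Set.mul_mem_mul hu (hr p hp γ γ.2 γ₀ γ₀.2)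
  have hverts : ∀ γ : p.dom, ∀ u ∈ B ^ (T n), u * (γ : Γ) ∈ H.verts := by
    intro γ u hu
    refine ⟨_, (hj1 _ (hmemU γ u hu)).trans (by group)⟩
  -- By gluing, the identifiers fixed through `γ₀` are also those that each `φ γ` prescribes on the
  -- `T n`-ball around `γ`; the extra radius `r` keeps this ball inside the one around `γ₀`.
  have hident : ∀ γ : p.dom, ∀ u (hu : u ∈ B ^ (T n)) (hu' : u ∈ D),
      (φ γ ⟨u, hu'⟩ : ℕ) + 1 = ident ⟨u * γ, hverts γ u hu⟩ := by
    intro γ u hu hu'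
    have h1 : e.symm ⟨u * γ, hverts γ u hu⟩ = φ γ₀ ⟨_, hsub (hmemU γ u hu)⟩ := by
      rw [Equiv.symm_apply_eq]
      apply Subtype.ext
      change _ = j _
      rw [hj1 _ (hmemU γ u hu)]
      group
    have h2 := isHom_apply_eq hD (hconn p hp) hφ (u * γ) (fun γ' => hsub (by
      rw [pow_add, mul_assoc]
      exact Set.mul_mem_mul hu (hr p hp γ γ.2 γ' γ'.2))) γ γ₀
    simp only [ident]
    rw [h1, ← h2]
    congr 4
    group
  refine hA n H (Set.finite_range j) ?_ ident ?_ ?_ p hp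
    ⟨fun γ => ⟨γ, by simpa using hverts γ 1 (Set.one_mem_pow (Or.inr rfl))⟩, ?_, ?_⟩
  · change (Set.range j).ncard = n
    rw [← Set.image_univ, Set.ncard_image_of_injective _ hjinj, Set.ncard_univ]
    simp
  · intro a b hab
    simp only [ident] at hab
    exact e.symm.injective (Fin.ext (by omega))
  · intro y
    have := (e.symm y).2
    simp only [ident, Set.mem_Icc]
    omega
  · intro γ γ' h
    exact ⟨(hadj _ _).2 h, rfl⟩
  · intro γ
    rw [← hval γ]
    unfold LocalAlgorithm.run
    congr 1
    -- Right translation by `γ` matches the two graphs. With `t` rounds left, a point at word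
    -- distance at most `s = T n - t` from `1` is involved, so its neighbors still lie in the ball
    -- while `t` is positive.
    refine (A.stateAfter_congr n ((cayleyGraph S).induce D) ((cayleyGraph S).ofSubgraph H) _ ident
      (fun t u y => (y : Γ) = u * γ ∧ ∃ s, s + t = T n ∧ (u : Γ) ∈ B ^ s) ?_ ?_ (T n) _ _ ?_).symm
    · rintro t ⟨u, hu⟩ ⟨y, hy⟩ ⟨e1, s, hs, hus⟩
      simp only at e1 hus
      subst e1
      exact hident γ u (hmono (by omega : s ≤ T n) hus) hu
    · rintro t ⟨u, hu⟩ ⟨y, hy⟩ ⟨e1, s, hs, hus⟩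
      simp only at e1 hus
      subst e1
      have hstep : ∀ u', (cayleyGraph S).graph.Adj u u' → u' ∈ B ^ (s + 1) := by
        intro u' h
        have h1 : u' * u⁻¹ ∈ B := Or.inl (label_mem_of_adj h).1
        rw [pow_succ']
        simpa using Set.mul_mem_mul h1 hus
      refine ⟨⟨rfl, s + 1, by omega, hmono (by omega : s ≤ s + 1) hus⟩, ?_, ?_⟩
      · rintro ⟨u', hu'⟩ h
        have h' : (cayleyGraph S).graph.Adj u u' := h
        have hu's := hstep u' h'
        refine ⟨⟨u' * γ, hverts γ u' (hmono (by omega : s + 1 ≤ T n) hu's)⟩,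
          (hadj _ _).2 ?_, ?_, rfl, s + 1, by omega, hu's⟩
        · obtain ⟨hne, σ, hσ, e1⟩ := h'
          exact ⟨fun e => hne (mul_right_cancel e), σ, hσ, by
            change u' * γ = σ * (u * γ); rw [e1, mul_assoc]⟩
        · change u' * u⁻¹ = u' * γ * (u * γ)⁻¹
          group
      · rintro ⟨y', hy'⟩ h
        obtain ⟨hne, σ, hσ, e1⟩ := (hadj _ _).1 h
        simp only at e1 hne
        have h' : (cayleyGraph S).graph.Adj u (σ * u) :=
          ⟨fun e => hne (by rw [e1, ← mul_assoc, ← e]), σ, hσ, rfl⟩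
        have hu's := hstep _ h'
        refine ⟨⟨σ * u, hsub (hmono (by omega : s + 1 ≤ T n + r) hu's)⟩, h', ?_, ?_, s + 1,
          by omega, hu's⟩
        · change σ * u * u⁻¹ = y' * (u * γ)⁻¹
          rw [e1]; group
        · change y' = σ * u * γ
          rw [e1]; group
    · exact ⟨by simp, 0, by simp, by simp⟩

theorem exists_nat_bound_of_isBigO {T : ℕ → ℕ}
    (h : (fun n => (T n : ℝ)) =O[Filter.atTop] (fun n => (logStar n : ℝ))) :
    ∃ C N : ℕ, ∀ n ≥ N, T n ≤ C * logStar n := by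
  obtain ⟨c, hc⟩ := h.bound
  obtain ⟨N, hN⟩ := Filter.eventually_atTop.1 hc
  refine ⟨⌈c⌉₊, N, fun n hn => ?_⟩
  have h1 := hN n hn
  rw [Real.norm_natCast, Real.norm_natCast] at h1
  have h2 : c * (logStar n : ℝ) ≤ ⌈c⌉₊ * logStar n := by
    gcongr
    exact Nat.le_ceil c
  exact_mod_cast h1.trans h2

theorem exists_mul_le_two_pow (A M : ℕ) : ∃ m ≥ M, A * (m + 1) ≤ 2 ^ m := by
  -- An even exponent `2 * a` gives `2 ^ a * 2 ^ a ≥ (a + 1) ^ 2`.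
  refine ⟨2 * (2 * A + M), by omega, ?_⟩
  have h := Nat.lt_two_pow_self (n := 2 * A + M)
  rw [two_mul, pow_add]
  calc A * (2 * A + M + (2 * A + M) + 1) ≤ (2 * A + M + 1) * (2 * A + M + 1) := by nlinarith
    _ ≤ _ := Nat.mul_le_mul h h

/-- A local algorithm yields a coloring of some graph `H_{D,n}` with `n ≥ |D|²`. -/
theorem exists_tileGraph_of_solves {Γ : Type u} [Group Γ] [Infinite Γ] {S : Set Γ} (hS : S.Finite)
    {k : ℕ} {P : Set (Pattern Γ k)} (hP : P.Finite) (hconn : ∀ p ∈ P, p.IsConnected S)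
    {A : LocalAlgorithm Γ k} {T : ℕ → ℕ}
    (hT : (fun n => (T n : ℝ)) =O[Filter.atTop] (fun n => (logStar n : ℝ))) (hA : A.Solves S P T) :
    ∃ (D : Set Γ) (hD : S ∪ S⁻¹ ∪ {1} ⊆ D) (n : ℕ), D.Finite ∧ D.ncard ^ 2 ≤ n ∧
      ∃ f, AvoidsOnGraph P (tileGraph S D hD n) f := by
  classical
  obtain ⟨r, hr⟩ := exists_pattern_radius hP hconn
  obtain ⟨C, N, hC⟩ := exists_nat_bound_of_isBigO hT
  have hBfin : (S ∪ S⁻¹ ∪ {1}).Finite := (hS.union hS.inv).union (Set.finite_singleton 1)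
  set B : Finset Γ := hBfin.toFinset with hBdef
  have hBc : (B : Set Γ) = S ∪ S⁻¹ ∪ {1} := by simp [hBdef]
  obtain ⟨m, hm, hexp⟩ := exists_mul_le_two_pow (B.card * 2 * (2 * C + r + 1)) N
  -- The radius `T n + r + 1` is linear in `m`, so `|D|²` is at most 2 to a linear function of `m`;
  -- `hexp` puts this exponent below `2 ^ m`.
  set n := 2 ^ 2 ^ m with hn
  have hNn : N ≤ n := hm.trans (Nat.lt_two_pow_self.le.trans
    (Nat.pow_le_pow_right (by norm_num) Nat.lt_two_pow_self.le))
  have hTn : T n ≤ C * (m + 2) :=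
    (hC n hNn).trans (Nat.mul_le_mul_left C (logStar_two_pow_two_pow_le m))
  set D : Finset Γ := B ^ (T n + r + 1) with hDdef
  have hDc : (D : Set Γ) = (S ∪ S⁻¹ ∪ {1}) ^ (T n + r + 1) := by
    rw [hDdef, Finset.coe_pow, hBc]
  have hmono := monotone_ball_pow S
  have hD : S ∪ S⁻¹ ∪ {1} ⊆ (D : Set Γ) := by
    rw [hDc]
    simpa using hmono (by omega : 1 ≤ T n + r + 1)
  refine ⟨D, hD, n, D.finite_toSet, ?_, exists_tileGraph_coloring_of_solves hconn hA hr n hD ?_⟩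
  · rw [Set.ncard_coe_finset]
    calc D.card ^ 2 ≤ (B.card ^ (T n + r + 1)) ^ 2 := Nat.pow_le_pow_left Finset.card_pow_le 2
      _ ≤ ((2 ^ B.card) ^ (T n + r + 1)) ^ 2 := by
        gcongr
        exact Nat.lt_two_pow_self.le
      _ = 2 ^ (B.card * (T n + r + 1) * 2) := by rw [← pow_mul, ← pow_mul, mul_assoc]
      _ ≤ 2 ^ 2 ^ m := by
        apply Nat.pow_le_pow_right (by norm_num)
        refine le_trans ?_ hexp
        have : T n + r + 1 ≤ (2 * C + r + 1) * (m + 1) := by nlinarith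
        calc B.card * (T n + r + 1) * 2 ≤ B.card * ((2 * C + r + 1) * (m + 1)) * 2 := by gcongr
          _ = _ := by ring
  · rw [hDc]
    exact hmono (by omega)

/-- A local algorithm yields colorings of almost all graphs `H_{D,n}` of an exhausting family. -/
theorem finite_not_tileGraph_of_solves {Γ : Type u} [Group Γ] [Infinite Γ] {S : Set Γ}
    (hS : S.Finite) {k : ℕ} {P : Set (Pattern Γ k)} (hP : P.Finite)
    (hconn : ∀ p ∈ P, p.IsConnected S) {A : LocalAlgorithm Γ k} {T : ℕ → ℕ}
    (hT : (fun n => (T n : ℝ)) =O[Filter.atTop] (fun n => (logStar n : ℝ))) (hA : A.Solves S P T)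
    {F : ℕ → Set Γ} {m : ℕ → ℕ} (hFfin : ∀ i, (F i).Finite) (hF : Monotone F)
    (hFu : ⋃ i, F i = Set.univ) (hm : ∀ i, (F i).ncard ^ (2 * logStar (m i)) ≤ m i)
    (hD : ∀ i, S ∪ S⁻¹ ∪ {1} ⊆ F i ^ logStar (m i)) :
    {i | ¬ ∃ f, AvoidsOnGraph P (tileGraph S (F i ^ logStar (m i)) (hD i) (m i)) f}.Finite := by
  obtain ⟨r, hr⟩ := exists_pattern_radius hP hconn
  obtain ⟨C, N, hC⟩ := exists_nat_bound_of_isBigO hT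
  have hBfin : (S ∪ S⁻¹ ∪ {1}).Finite := (hS.union hS.inv).union (Set.finite_singleton 1)
  have hmono := monotone_ball_pow S
  have hex : ∀ V : Set Γ, V.Finite → ∃ i, V ⊆ F i := fun V hV =>
    exists_subset_of_monotone hF hV fun v _ => Set.mem_iUnion.1 (hFu ▸ Set.mem_univ v)
  obtain ⟨i₁, hi₁⟩ := hex _ (finite_set_pow hBfin (C + r))
  -- Once `F i` has more than `N` elements, the size condition forces `m i ≥ N`, where the bound on
  -- `T` is valid.
  obtain ⟨V, -, hV⟩ := (Set.infinite_univ (α := Γ)).exists_subset_card_eq (N + 1)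
  obtain ⟨i₂, hi₂⟩ := hex _ V.finite_toSet
  refine (Set.finite_lt_nat (max i₁ i₂)).subset fun i hi => ?_
  by_contra hlt
  simp only [Set.mem_ofPred_eq, not_lt, max_le_iff] at hlt
  refine hi (exists_tileGraph_coloring_of_solves hconn hA hr (m i) (hD i) ?_)
  -- If `log* (m i) = 0`, the window is `{1}`; it contains `S`, so all balls are trivial.
  rcases Nat.eq_zero_or_pos (logStar (m i)) with h0 | hpos
  · have h1 : S ∪ S⁻¹ ∪ {1} ⊆ (1 : Set Γ) := by simpa [h0] using hD i
    rw [h0, pow_zero]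
    calc (S ∪ S⁻¹ ∪ {1}) ^ (T (m i) + r) ⊆ 1 ^ (T (m i) + r) := Set.pow_subset_pow_left h1
      _ = 1 := one_pow _
  · have hN : N ≤ m i := by
      have h1 : N + 1 ≤ (F i).ncard := by
        rw [← hV, ← Set.ncard_coe_finset]
        exact Set.ncard_le_ncard (hi₂.trans (hF hlt.2)) (hFfin i)
      calc N ≤ (F i).ncard ^ 1 := by rw [pow_one]; omega
        _ ≤ (F i).ncard ^ (2 * logStar (m i)) := Nat.pow_le_pow_right (by omega) (by omega)
        _ ≤ m i := hm i
    calc (S ∪ S⁻¹ ∪ {1}) ^ (T (m i) + r) ⊆ (S ∪ S⁻¹ ∪ {1}) ^ ((C + r) * logStar (m i)) :=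
          hmono (by have := hC _ hN; nlinarith)
      _ = ((S ∪ S⁻¹ ∪ {1}) ^ (C + r)) ^ logStar (m i) := pow_mul _ _ _
      _ ⊆ F i ^ logStar (m i) := Set.pow_subset_pow_left (hi₁.trans (hF hlt.1))

/-! ### From continuous colorings to the graphs `H_{D,n}` -/

/-- A continuous map from a compact subspace of a product of discrete spaces to a discrete space
is determined by finitely many coordinates. -/
theorem exists_finset_determining {ι α κ X : Type*} [TopologicalSpace α] [DiscreteTopology α]
    [TopologicalSpace κ] [DiscreteTopology κ] [TopologicalSpace X] [CompactSpace X]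
    {e : X → ι → α} (he : Topology.IsInducing e) {f : X → κ} (hf : Continuous f) :
    ∃ J : Finset ι, ∀ x y, (∀ i ∈ J, e x i = e y i) → f x = f y := by
  classical
  have h1 : ∀ x, ∃ J : Finset ι, ∀ y, (∀ i ∈ J, e y i = e x i) → f y = f x := by
    intro x
    obtain ⟨U, hU, hUf⟩ := he.isOpen_iff.1 ((isOpen_discrete {f x}).preimage hf)
    have hx : e x ∈ U := by
      have : x ∈ e ⁻¹' U := by rw [hUf]; rfl
      exact this
    obtain ⟨I, u, hu, hsub⟩ := isOpen_pi_iff.1 hU (e x) hx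
    refine ⟨I, fun y hy => ?_⟩
    have : y ∈ e ⁻¹' U := hsub fun i hi => by
      rw [hy i hi]
      exact (hu i hi).2
    rw [hUf] at this
    exact this
  choose J hJ using h1
  have h2 : ∀ x, {y | ∀ i ∈ J x, e y i = e x i} ∈ nhds x := by
    intro x
    have hev : ∀ᶠ y in nhds x, ∀ i ∈ J x, e y i = e x i := by
      rw [Filter.eventually_all_finset]
      intro i _
      have hc : Continuous fun y => e y i := (continuous_apply i).comp he.continuous
      exact hc.continuousAt.eventually (isOpen_discrete {e x i} |>.mem_nhds rfl)
    exact hev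
  obtain ⟨t, ht⟩ := finite_cover_nhds h2
  refine ⟨t.biUnion J, fun x y hxy => ?_⟩
  have hx : x ∈ ⋃ z ∈ t, {y | ∀ i ∈ J z, e y i = e z i} := by rw [ht]; trivial
  obtain ⟨z, hz, hxz⟩ := Set.mem_iUnion₂.1 hx
  rw [hJ z x hxz, hJ z y fun i hi => (hxy i (Finset.mem_biUnion.2 ⟨z, hz, hi⟩)).symm.trans (hxz i hi)]

/-- The space of families of six-colorings of `Γ`, the one with index `γ ≠ 1` being proper for
left multiplication by `γ`. -/
def ColorSpace (Γ : Type u) [Group Γ] : Type u :=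
  {c : Γ × Γ → Fin 6 // ∀ γ δ : Γ, γ ≠ 1 → c (γ, γ * δ) ≠ c (γ, δ)}

namespace ColorSpace

variable {Γ : Type u} [Group Γ]

instance : TopologicalSpace (ColorSpace Γ) :=
  inferInstanceAs (TopologicalSpace
    {c : Γ × Γ → Fin 6 // ∀ γ δ : Γ, γ ≠ 1 → c (γ, γ * δ) ≠ c (γ, δ)})

instance : MulAction Γ (ColorSpace Γ) where
  smul η c := ⟨fun i => c.1 (i.1, i.2 * η), fun γ δ h => by
    simpa only [mul_assoc] using c.2 γ (δ * η) h⟩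
  one_smul c := Subtype.ext (funext fun i => by
    change c.1 (i.1, i.2 * 1) = c.1 i
    rw [mul_one])
  mul_smul η η' c := Subtype.ext (funext fun i => by
    change c.1 (i.1, i.2 * (η * η')) = c.1 (i.1, i.2 * η * η')
    rw [mul_assoc])

theorem smul_apply (η : Γ) (c : ColorSpace Γ) (γ δ : Γ) : (η • c).1 (γ, δ) = c.1 (γ, δ * η) := rfl

theorem isClosed_carrier :
    IsClosed {c : Γ × Γ → Fin 6 | ∀ γ δ : Γ, γ ≠ 1 → c (γ, γ * δ) ≠ c (γ, δ)} := by
  have : {c : Γ × Γ → Fin 6 | ∀ γ δ : Γ, γ ≠ 1 → c (γ, γ * δ) ≠ c (γ, δ)} =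
      ⋂ (γ : Γ) (δ : Γ) (_ : γ ≠ 1),
        (fun c : Γ × Γ → Fin 6 => (c (γ, γ * δ), c (γ, δ))) ⁻¹' {z | z.1 ≠ z.2} := by
    ext c
    simp
  rw [this]
  refine isClosed_iInter fun γ => isClosed_iInter fun δ => isClosed_iInter fun _ => ?_
  exact (isClosed_discrete _).preimage ((continuous_apply _).prodMk (continuous_apply _))

instance : CompactSpace (ColorSpace Γ) :=
  isCompact_iff_compactSpace.1 (isClosed_carrier (Γ := Γ)).isCompact

instance [Countable Γ] : PolishSpace (ColorSpace Γ) :=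
  have : PolishSpace (Fin 6) := inferInstance
  (isClosed_carrier (Γ := Γ)).polishSpace

theorem isInducing_val : Topology.IsInducing fun c : ColorSpace Γ => c.1 := ⟨rfl⟩

theorem continuous_val : Continuous fun c : ColorSpace Γ => c.1 := isInducing_val.continuous

instance : ContinuousConstSMul Γ (ColorSpace Γ) where
  continuous_const_smul η := Continuous.subtype_mk
    (continuous_pi fun i : Γ × Γ => (continuous_apply (i.1, i.2 * η)).comp continuous_val) _

theorem isZeroDimensional : IsZeroDimensional (ColorSpace Γ) := by
  have : T2Space (ColorSpace Γ) := inferInstanceAs (T2Space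
    {c : Γ × Γ → Fin 6 // ∀ γ δ : Γ, γ ≠ 1 → c (γ, γ * δ) ≠ c (γ, δ)})
  have : TotallyDisconnectedSpace (ColorSpace Γ) := inferInstanceAs (TotallyDisconnectedSpace
    {c : Γ × Γ → Fin 6 // ∀ γ δ : Γ, γ ≠ 1 → c (γ, γ * δ) ≠ c (γ, δ)})
  exact isTopologicalBasis_isClopen

/-- The coloring with index `η` alone rules out the period `η`. -/
theorem isFreeAction : IsFreeAction Γ (ColorSpace Γ) := by
  intro c
  rw [Subgroup.eq_bot_iff_forall]
  intro η hη
  by_contra h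
  have h1 : η • c = c := hη
  have h2 := c.2 η 1 h
  rw [mul_one] at h2
  have h3 := smul_apply η c η 1
  rw [h1, one_mul] at h3
  exact h2 h3.symm

variable {q : Γ → ℕ}

theorem cvIter_mul_ne (hq : Function.Injective q) (t : ℕ) {γ : Γ} (hγ : γ ≠ 1) (δ : Γ) :
    cvIter t (fun j => q (γ ^ j * (γ * δ))) ≠ cvIter t (fun j => q (γ ^ j * δ)) := by
  have h := cvIter_ne (t := t) (u := fun j => q (γ ^ j * δ)) fun h => hγ (by
    simpa using (hq h).symm)
  simp only [pow_succ, mul_assoc] at h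
  exact h.symm

open Classical in
/-- The point obtained from an injective coloring by `t` steps of color reduction along every
group element, followed by greedy recoloring with six colors. -/
noncomputable def ofInjective (q : Γ → ℕ) (hq : Function.Injective q) (t : ℕ) : ColorSpace Γ :=
  ⟨fun i => ⟨greedyColoring {i.1, i.1⁻¹} (fun δ => cvIter t fun j => q (i.1 ^ j * δ)) 6 i.2, by
      by_cases h : cvIter t (fun j => q (i.1 ^ j * i.2)) < 6
      · exact (greedyColoring_of_lt (b := fun δ => cvIter t fun j => q (i.1 ^ j * δ)) h).trans_lt h
      · exact (greedyColoring_le_card (by omega)).trans_lt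
          (Finset.card_le_two.trans_lt (by norm_num))⟩, by
    intro γ δ hγ h
    refine greedyColoring_ne (R := {γ, γ⁻¹}) (m := 6)
      (b := fun δ => cvIter t fun j => q (γ ^ j * δ)) ?_ ?_ δ (r := γ) (by simp)
      (congrArg Fin.val h)
    · intro r hr
      simp only [Finset.mem_insert, Finset.mem_singleton] at hr ⊢
      rcases hr with rfl | rfl <;> simp
    · intro x r hr
      simp only [Finset.mem_insert, Finset.mem_singleton] at hr
      rcases hr with rfl | rfl
      · exact cvIter_mul_ne hq t hγ x
      · have := cvIter_mul_ne hq t hγ (γ⁻¹ * x)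
        rw [mul_inv_cancel_left] at this
        exact this.symm⟩

/-- Greedy recoloring may depend on far away points, but it keeps colors below six. Where reduction
alone reaches six colors, the value depends on `q` at only `t + 1` points. -/
theorem ofInjective_apply (hq : Function.Injective q) {t : ℕ} {γ δ : Γ}
    (h : cvIter t (fun j => q (γ ^ j * δ)) < 6) :
    ((ofInjective q hq t).1 (γ, δ) : ℕ) = cvIter t (fun j => q (γ ^ j * δ)) :=
  greedyColoring_of_lt (b := fun δ => cvIter t fun j => q (γ ^ j * δ)) h

end ColorSpace

open Classical in
/-- An extension of a coloring of a part of a countable group to an injection. -/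
noncomputable def extendColoring {Γ : Type u} [Countable Γ] {D : Set Γ} {n : ℕ} (q : D ↪ Fin n)
    (g : Γ) : ℕ :=
  if h : g ∈ D then q ⟨g, h⟩ else n + (exists_injective_nat Γ).choose g

theorem extendColoring_of_mem {Γ : Type u} [Countable Γ] {D : Set Γ} {n : ℕ} (q : D ↪ Fin n)
    {g : Γ} (h : g ∈ D) : extendColoring q g = q ⟨g, h⟩ := by
  rw [extendColoring, dif_pos h]

theorem extendColoring_injective {Γ : Type u} [Countable Γ] {D : Set Γ} {n : ℕ} (q : D ↪ Fin n) :
    Function.Injective (extendColoring q) := by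
  intro a b hab
  unfold extendColoring at hab
  split_ifs at hab with ha hb hb
  · exact congrArg Subtype.val (q.injective (Fin.ext hab))
  · have := (q ⟨a, ha⟩).2; omega
  · have := (q ⟨b, hb⟩).2; omega
  · exact (exists_injective_nat Γ).choose_spec (by omega)

/-- A continuous coloring of the color space yields a coloring of some graph `H_{D,n}`, where `n`
can be as large as a local algorithm needs it. -/
theorem exists_tileGraph_of_colorSpace {Γ : Type u} [Group Γ] [Countable Γ] {S : Set Γ}
    (hS : S.Finite) {k : ℕ} {P : Set (Pattern Γ k)} (hP : P.Finite)
    (hconn : ∀ p ∈ P, p.IsConnected S) (h : HasContinuousAvoidingColoring P (ColorSpace Γ)) :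
    ∃ (D : Finset Γ) (hD : S ∪ S⁻¹ ∪ {1} ⊆ (D : Set Γ)),
      ∃ f, AvoidsOnGraph P (tileGraph S D hD (6 ^ (D.card ^ 2))) f := by
  classical
  obtain ⟨f, hf, hfP⟩ := h
  obtain ⟨J, hJ⟩ := exists_finset_determining ColorSpace.isInducing_val hf
  have hBfin : (S ∪ S⁻¹ ∪ {1}).Finite := (hS.union hS.inv).union (Set.finite_singleton 1)
  have hVfin : (⋃ p ∈ P, p.dom * p.dom⁻¹).Finite :=
    hP.biUnion fun p _ => p.finite_dom.mul p.finite_dom.inv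
  set B : Finset Γ := hBfin.toFinset with hBdef
  set V : Finset Γ := hVfin.toFinset with hVdef
  set I : Finset Γ := J.image Prod.fst with hI
  set W : Finset Γ := J.image Prod.snd with hW
  set C : ℕ := I.card * W.card * V.card + B.card with hC
  -- The constant `C` does not depend on `t`, and `D` below has at most `C * (t + 1)` elements, so
  -- `6 ^ |D|² ≤ 2 ^ (3 * C ^ 2 * (t + 1) ^ 2)`.
  obtain ⟨t, ht⟩ := exists_cvBound_iterate_two_pow_le (3 * C ^ 2)
  -- `E * W` contains the points read when the coordinates in `J` are computed by `t` steps; `V`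
  -- lets them be seen from every point of a pattern.
  set E : Finset Γ := I.biUnion fun η => (Finset.range (t + 1)).image fun j => η ^ j with hE
  set D : Finset Γ := E * W * V ∪ B with hDdef
  have hD : S ∪ S⁻¹ ∪ {1} ⊆ (D : Set Γ) := by
    intro x hx
    exact Finset.mem_coe.2 (Finset.mem_union_right _ (by simpa [hBdef] using hx))
  have hEcard : E.card ≤ I.card * (t + 1) := Finset.card_biUnion_le_card_mul _ _ _ fun η _ =>
    Finset.card_image_le.trans (by simp)
  have hDcard : D.card ≤ C * (t + 1) := by
    calc D.card ≤ (E * W * V).card + B.card := Finset.card_union_le _ _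
      _ ≤ E.card * W.card * V.card + B.card := by
        gcongr
        exact Finset.card_mul_le.trans (Nat.mul_le_mul_right _ Finset.card_mul_le)
      _ ≤ I.card * (t + 1) * W.card * V.card + B.card * (t + 1) := by
        gcongr
        nlinarith
      _ = C * (t + 1) := by rw [hC]; ring
  set n := 6 ^ (D.card ^ 2) with hn
  have hn6 : cvBound^[t] n ≤ 6 := by
    refine (Monotone.iterate cvBound_mono t ?_).trans ht
    calc n ≤ (2 ^ 3) ^ (D.card ^ 2) := Nat.pow_le_pow_left (by norm_num) _
      _ = 2 ^ (3 * D.card ^ 2) := by rw [pow_mul]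
      _ ≤ 2 ^ (3 * (C * (t + 1)) ^ 2) := Nat.pow_le_pow_right (by norm_num) (by gcongr)
      _ = 2 ^ (3 * C ^ 2 * (t + 1) ^ 2) := by rw [mul_pow, mul_assoc]
  have hn2 : 2 ≤ n := by
    have h1 : 1 ∈ D := Finset.mem_coe.1 (hD (Or.inr rfl))
    have h2 : 0 < D.card := Finset.card_pos.2 ⟨1, h1⟩
    calc 2 ≤ 6 ^ 1 := by norm_num
      _ ≤ n := Nat.pow_le_pow_right (by norm_num) (Nat.one_le_pow _ _ h2)
  refine ⟨D, hD, fun q => f (ColorSpace.ofInjective _ (extendColoring_injective q) t), ?_⟩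
  rintro p hp ⟨φ, hφ, hval⟩
  obtain ⟨γ₀⟩ := (hconn p hp).nonempty
  -- The points obtained from the various `φ γ` need not lie on one orbit, but on the coordinates in
  -- `J` they agree with translates of the one from `φ γ₀`.
  refine hfP p hp ⟨(γ₀ : Γ)⁻¹ • ColorSpace.ofInjective _ (extendColoring_injective (φ γ₀)) t,
    fun γ => ?_⟩
  rw [← hval γ]
  apply hJ
  rintro ⟨η, δ⟩ hηδ
  rw [ColorSpace.smul_apply, ColorSpace.smul_apply]
  have hmem : ∀ j ≤ t, ∀ γ' : p.dom, η ^ j * δ * γ * (γ' : Γ)⁻¹ ∈ (D : Set Γ) := by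
    intro j hj γ'
    refine Finset.mem_coe.2 (Finset.mem_union_left _ ?_)
    rw [mul_assoc (η ^ j * δ)]
    refine Finset.mul_mem_mul (Finset.mul_mem_mul ?_ (Finset.mem_image.2 ⟨_, hηδ, rfl⟩)) ?_
    · exact Finset.mem_biUnion.2 ⟨η, Finset.mem_image.2 ⟨_, hηδ, rfl⟩,
        Finset.mem_image.2 ⟨j, Finset.mem_range.2 (by omega), rfl⟩⟩
    · rw [hVdef, Set.Finite.mem_toFinset]
      exact Set.mem_iUnion₂.2 ⟨p, hp, Set.mul_mem_mul γ.2 (Set.inv_mem_inv.2 γ'.2)⟩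
  have hval1 : ∀ j ≤ t, ∀ γ' : p.dom, extendColoring (φ γ') (η ^ j * δ * γ * (γ' : Γ)⁻¹) < n := by
    intro j hj γ'
    rw [extendColoring_of_mem _ (hmem j hj γ')]
    exact Fin.is_lt _
  have hval2 : ∀ j ≤ t, extendColoring (φ γ₀) (η ^ j * (δ * γ * (γ₀ : Γ)⁻¹)) =
      extendColoring (φ γ) (η ^ j * δ) := by
    intro j hj
    have h1 := isHom_apply_eq hD (hconn p hp) hφ (η ^ j * δ * γ) (hmem j hj) γ₀ γ
    have h2 := congrArg Fin.val h1
    rw [← extendColoring_of_mem, ← extendColoring_of_mem] at h2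
    rw [mul_inv_cancel_right] at h2
    rw [← h2]
    congr 1
    group
  have hval3 : ∀ j ≤ t, extendColoring (φ γ) (η ^ j * δ) < n := by
    intro j hj
    simpa using hval1 j hj γ
  have hlt := (cvIter_lt hn2 hval3).trans_le hn6
  have heq := cvIter_congr hval2
  apply Fin.ext
  rw [ColorSpace.ofInjective_apply _ hlt, ← heq]
  exact ColorSpace.ofInjective_apply _ (heq ▸ hlt)

/-! ### From the graphs `H_{D,n}` to local algorithms -/

section Local

open Classical in
/-- The identifiers of the vertices of a subgraph, extended by `0`. -/
noncomputable def extendIdent {Γ : Type*} {s : Set Γ} (ident : s → ℕ) (x : Γ) : ℕ :=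
  if h : x ∈ s then ident ⟨x, h⟩ else 0

theorem extendIdent_coe {Γ : Type*} {s : Set Γ} (ident : s → ℕ) (x : s) : extendIdent ident x = ident x := by
  rw [extendIdent, dif_pos x.2]

variable {Γ : Type u} [Group Γ]

/-- The `t`-balls around `x` and `x'` are isomorphic, including labels and identifiers. -/
def Agree (G : SimpleGraph Γ) (ι : Γ → ℕ) (G' : SimpleGraph Γ) (ι' : Γ → ℕ) : ℕ → Γ → Γ → Prop
  | 0, x, x' => ι x = ι' x'
  | t + 1, x, x' => ι x = ι' x' ∧ ∀ σ, (G.Adj x (σ * x) ↔ G'.Adj x' (σ * x')) ∧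
      (G.Adj x (σ * x) → Agree G ι G' ι' t (σ * x) (σ * x'))

variable {G G' : SimpleGraph Γ} {ι ι' : Γ → ℕ}

theorem Agree.ident {t : ℕ} {x x' : Γ} (h : Agree G ι G' ι' t x x') : ι x = ι' x' := by
  cases t with
  | zero => exact h
  | succ t => exact h.1

theorem Agree.of_succ {t : ℕ} {x x' : Γ} (h : Agree G ι G' ι' (t + 1) x x') :
    Agree G ι G' ι' t x x' := by
  induction t generalizing x x' with
  | zero => exact h.1
  | succ t ih => exact ⟨h.1, fun σ => ⟨(h.2 σ).1, fun hσ => ih ((h.2 σ).2 hσ)⟩⟩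

theorem Agree.of_le {s t : ℕ} (hst : s ≤ t) {x x' : Γ} (h : Agree G ι G' ι' t x x') :
    Agree G ι G' ι' s x x' := by
  induction t, hst using Nat.le_induction with
  | base => exact h
  | succ t _ ih => exact ih h.of_succ

theorem Agree.symm {t : ℕ} {x x' : Γ} (h : Agree G ι G' ι' t x x') : Agree G' ι' G ι t x' x := by
  induction t generalizing x x' with
  | zero => exact Eq.symm h
  | succ t ih =>
    exact ⟨h.1.symm, fun σ => ⟨(h.2 σ).1.symm, fun hσ => ih ((h.2 σ).2 ((h.2 σ).1.2 hσ))⟩⟩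

/-- All label sequences of walks of length at most `t` from `x`, with the identifiers of the ends. -/
def info (G : SimpleGraph Γ) (ι : Γ → ℕ) : ℕ → Γ → Set (List Γ × ℕ)
  | 0, x => {([], ι x)}
  | t + 1, x => info G ι t x ∪ {z | ∃ σ w, z.1 = σ :: w ∧ G.Adj x (σ * x) ∧ (w, z.2) ∈ info G ι t (σ * x)}

theorem nil_mem_info {t : ℕ} {x : Γ} {i : ℕ} : (([] : List Γ), i) ∈ info G ι t x ↔ i = ι x := by
  induction t with
  | zero => simp [info]
  | succ t ih => simp [info, ih]

theorem info_subset_succ (t : ℕ) (x : Γ) : info G ι t x ⊆ info G ι (t + 1) x :=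
  Set.subset_union_left

theorem cons_mem_info {t : ℕ} {x σ : Γ} {w : List Γ} {i : ℕ} :
    (σ :: w, i) ∈ info G ι (t + 1) x ↔ G.Adj x (σ * x) ∧ (w, i) ∈ info G ι t (σ * x) := by
  induction t generalizing x σ w with
  | zero => simp [info]; tauto
  | succ t ih =>
    rw [info, Set.mem_union, ih]
    constructor
    · rintro (h | ⟨σ', w', e, h1, h2⟩)
      · exact ⟨h.1, info_subset_succ t _ h.2⟩
      · simp only [List.cons.injEq] at e
        obtain ⟨rfl, rfl⟩ := e
        exact ⟨h1, h2⟩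
    · rintro ⟨h1, h2⟩
      exact Or.inr ⟨σ, w, rfl, h1, h2⟩

/-- The one-letter word `σ` witnesses the edge to `σ * x`, and the words beginning with `σ` give the
information at its other end. -/
theorem agree_of_info_eq {t : ℕ} {x x' : Γ} (h : info G ι t x = info G' ι' t x') :
    Agree G ι G' ι' t x x' := by
  induction t generalizing x x' with
  | zero =>
    have : (([] : List Γ), ι x) ∈ info G' ι' 0 x' := h ▸ nil_mem_info.2 rfl
    exact nil_mem_info.1 this
  | succ t ih =>
    have h0 : (([] : List Γ), ι x) ∈ info G' ι' (t + 1) x' := h ▸ nil_mem_info.2 rfl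
    refine ⟨nil_mem_info.1 h0, fun σ => ?_⟩
    have hadj : ∀ (K : SimpleGraph Γ) (κ : Γ → ℕ) (y : Γ),
        K.Adj y (σ * y) ↔ ∃ i, ([σ], i) ∈ info K κ (t + 1) y := by
      intro K κ y
      simp only [cons_mem_info, nil_mem_info]
      exact ⟨fun h => ⟨_, h, rfl⟩, fun ⟨_, h, _⟩ => h⟩
    have h1 : G.Adj x (σ * x) ↔ G'.Adj x' (σ * x') := by
      rw [hadj G ι x, hadj G' ι' x', h]
    refine ⟨h1, fun hx => ih ?_⟩
    ext ⟨w, i⟩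
    have h2 : (σ :: w, i) ∈ info G ι (t + 1) x ↔ (σ :: w, i) ∈ info G' ι' (t + 1) x' := by rw [h]
    rw [cons_mem_info, cons_mem_info] at h2
    simpa [hx, h1.1 hx] using h2

open Classical in
/-- Collect all information about the `T n`-ball and apply the rule `Φ`. -/
noncomputable def gatherAlgorithm {k : ℕ} (T : ℕ → ℕ)
    (Φ : ℕ → SimpleGraph Γ → (Γ → ℕ) → Γ → Fin k) (c : Fin k) : LocalAlgorithm Γ k where
  State := ℕ × Set (List Γ × ℕ)
  Msg := Set (List Γ × ℕ)
  init n i := (n, {([], i)})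
  send s := s.2
  update s m := (s.1, s.2 ∪ {z | ∃ σ w, z.1 = σ :: w ∧ ∃ I, (σ, I) ∈ m ∧ (w, z.2) ∈ I})
  -- The rule is applied to any graph with the collected information; for a rule that depends on `T
  -- n`-balls only, the choice does not matter. After `T n` rounds the true graph is a candidate, so
  -- the default is not used.
  output s := if h : ∃ z : SimpleGraph Γ × (Γ → ℕ) × Γ, info z.1 z.2.1 (T s.1) z.2.2 = s.2
    then Φ s.1 h.choose.1 h.choose.2.1 h.choose.2.2 else c

theorem gatherAlgorithm_stateAfter {k : ℕ} (T : ℕ → ℕ)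
    (Φ : ℕ → SimpleGraph Γ → (Γ → ℕ) → Γ → Fin k) (c : Fin k) {S : Set Γ} (n : ℕ)
    (H : (cayleyGraph S).graph.Subgraph) (ident : H.verts → ℕ) (t : ℕ) (x : H.verts) :
    (gatherAlgorithm T Φ c).stateAfter n ((cayleyGraph S).ofSubgraph H) ident t x =
      (n, info H.spanningCoe (extendIdent ident) t x) := by
  induction t generalizing x with
  | zero =>
    rw [LocalAlgorithm.stateAfter, info, extendIdent_coe]
    rfl
  | succ t ih =>
    rw [LocalAlgorithm.stateAfter, info, ih]
    change (n, _) = (n, _)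
    congr 2
    ext ⟨v, i⟩
    constructor
    · rintro ⟨σ, w, e, I, ⟨y, hy, e2⟩, hI⟩
      rw [ih] at e2
      have h1 : σ = (y : Γ) * (x : Γ)⁻¹ := congrArg Prod.fst e2
      have h2 : I = info H.spanningCoe (extendIdent ident) t y := congrArg Prod.snd e2
      have h3 : (y : Γ) = σ * x := by rw [h1]; group
      refine ⟨σ, w, e, ?_, ?_⟩
      · rw [← h3]; exact hy
      · rw [← h3, ← h2]; exact hI
    · rintro ⟨σ, w, e, hadj, hI⟩
      have hadj' : H.Adj x (σ * x) := hadj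
      refine ⟨σ, w, e, _, ⟨⟨σ * x, hadj'.snd_mem⟩, hadj', ?_⟩, hI⟩
      rw [ih]
      have : ((cayleyGraph S).ofSubgraph H).label x ⟨σ * x, hadj'.snd_mem⟩ = σ := by
        change σ * (x : Γ) * (x : Γ)⁻¹ = σ
        group
      rw [this]
      rfl

/-- Every rule that depends only on balls of radius `T n` is computed in `T n` rounds. -/
theorem gatherAlgorithm_run {k : ℕ} (T : ℕ → ℕ)
    (Φ : ℕ → SimpleGraph Γ → (Γ → ℕ) → Γ → Fin k)
    (hΦ : ∀ n G ι G' ι' x x', Agree G ι G' ι' (T n) x x' → Φ n G ι x = Φ n G' ι' x') (c : Fin k)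
    {S : Set Γ} (n : ℕ) (H : (cayleyGraph S).graph.Subgraph) (ident : H.verts → ℕ) (x : H.verts) :
    (gatherAlgorithm T Φ c).run n ((cayleyGraph S).ofSubgraph H) ident (T n) x =
      Φ n H.spanningCoe (extendIdent ident) x := by
  rw [LocalAlgorithm.run, gatherAlgorithm_stateAfter]
  have hex : ∃ z : SimpleGraph Γ × (Γ → ℕ) × Γ, info z.1 z.2.1 (T n) z.2.2 =
      info H.spanningCoe (extendIdent ident) (T n) x := ⟨(_, _, _), rfl⟩
  simp only [gatherAlgorithm]
  rw [dif_pos hex]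
  exact hΦ _ _ _ _ _ _ _ (agree_of_info_eq hex.choose_spec)

/-! #### Virtual vertices

A pair `(p, δ)` with `δ ∈ D` stands for the point `p` of the group, seen from the vertex `δ⁻¹ p`.
Pairs with the same `p` are identified along the edges of the graph. -/

variable {D : Finset Γ}

/-- The graph on `D` along which the points of view on `p` are identified. -/
def viewGraph (G : SimpleGraph Γ) (D : Finset Γ) (p : Γ) : SimpleGraph D :=
  G.comap fun δ => (δ : Γ)⁻¹ * p

/-- A step from view `a` to view `b` multiplies by `b⁻¹ * a`, whatever the point, so it can be
copied; each step costs one unit of radius. -/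
theorem Agree.walk {t : ℕ} {p p' : Γ} {δ δ' : D} (w : (viewGraph G D p).Walk δ δ')
    (h : Agree G ι G' ι' (t + w.length) ((δ : Γ)⁻¹ * p) ((δ : Γ)⁻¹ * p')) :
    (viewGraph G' D p').Reachable δ δ' ∧
      Agree G ι G' ι' t ((δ' : Γ)⁻¹ * p) ((δ' : Γ)⁻¹ * p') := by
  induction w with
  | nil => exact ⟨SimpleGraph.Reachable.refl _, h⟩
  | @cons a b c hab w ih =>
    rw [SimpleGraph.Walk.length_cons, ← add_assoc] at h
    have hab' : G.Adj ((a : Γ)⁻¹ * p) ((b : Γ)⁻¹ * p) := hab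
    have e : ∀ p : Γ, (b : Γ)⁻¹ * (a : Γ) * ((a : Γ)⁻¹ * p) = (b : Γ)⁻¹ * p := fun p => by group
    have h1 := h.2 ((b : Γ)⁻¹ * (a : Γ))
    rw [e, e] at h1
    obtain ⟨h2, h3⟩ := ih (h1.2 hab')
    have hadj : (viewGraph G' D p').Adj a b := h1.1.1 hab'
    exact ⟨hadj.reachable.trans h2, h3⟩

/-- A path in a graph on `D` has length less than `|D|`, so one identification query costs at most
`|D|` rounds. -/
theorem Agree.reachable {t : ℕ} {p p' : Γ} {δ δ' : D} (hr : (viewGraph G D p).Reachable δ δ')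
    (h : Agree G ι G' ι' (t + D.card) ((δ : Γ)⁻¹ * p) ((δ : Γ)⁻¹ * p')) :
    (viewGraph G' D p').Reachable δ δ' ∧
      Agree G ι G' ι' t ((δ' : Γ)⁻¹ * p) ((δ' : Γ)⁻¹ * p') := by
  classical
  obtain ⟨w, hw⟩ := hr.exists_isPath
  have := hw.length_lt
  rw [Fintype.card_coe] at this
  exact Agree.walk w (h.of_le (by omega))

theorem Agree.reachable_iff {t : ℕ} {p p' : Γ} {δ δ' : D}
    (h : Agree G ι G' ι' (t + D.card) ((δ : Γ)⁻¹ * p) ((δ : Γ)⁻¹ * p')) :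
    (viewGraph G D p).Reachable δ δ' ↔ (viewGraph G' D p').Reachable δ δ' :=
  ⟨fun hr => (h.reachable hr).1, fun hr => (h.symm.reachable hr).1⟩

/-- An identifier of the virtual vertex `v`. -/
noncomputable def initColor (G : SimpleGraph Γ) (ι : Γ → ℕ) (v : Γ × D) : ℕ :=
  -- The code records an observing vertex and a position in its window, hence the point. The minimum
  -- over all identified views makes it independent of the view.
  sInf {c | ∃ δ : D, (viewGraph G D v.1).Reachable v.2 δ ∧
    c = D.card * ι ((δ : Γ)⁻¹ * v.1) + D.equivFin δ}

theorem exists_initColor_eq (G : SimpleGraph Γ) (ι : Γ → ℕ) (v : Γ × D) :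
    ∃ δ : D, (viewGraph G D v.1).Reachable v.2 δ ∧
      initColor G ι v = D.card * ι ((δ : Γ)⁻¹ * v.1) + D.equivFin δ :=
  Nat.sInf_mem (s := {c | ∃ δ : D, (viewGraph G D v.1).Reachable v.2 δ ∧
    c = D.card * ι ((δ : Γ)⁻¹ * v.1) + D.equivFin δ}) ⟨_, v.2, SimpleGraph.Reachable.refl _, rfl⟩

theorem Agree.initColor_eq {p p' : Γ} {δ : D}
    (h : Agree G ι G' ι' D.card ((δ : Γ)⁻¹ * p) ((δ : Γ)⁻¹ * p')) :
    initColor G ι (p, δ) = initColor G' ι' (p', δ) := by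
  have h' : Agree G ι G' ι' (0 + D.card) ((δ : Γ)⁻¹ * p) ((δ : Γ)⁻¹ * p') := by rwa [zero_add]
  unfold initColor
  congr 1
  ext c
  refine exists_congr fun δ' => ?_
  constructor
  · rintro ⟨h1, e⟩
    exact ⟨h'.reachable_iff.1 h1, by rw [e, (h'.reachable h1).2.ident]⟩
  · rintro ⟨h1, e⟩
    exact ⟨h'.reachable_iff.2 h1, by rw [e, (h'.symm.reachable h1).2.ident]⟩

theorem initColor_eq_of_reachable {p : Γ} {δ δ' : D} (h : (viewGraph G D p).Reachable δ δ') :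
    initColor G ι (p, δ) = initColor G ι (p, δ') := by
  unfold initColor
  congr 1
  ext c
  exact exists_congr fun δ'' => and_congr_left fun _ => ⟨h.symm.trans, h.trans⟩

open Classical in
/-- The virtual vertex that is `s.2` in the view from which `v` is `s.1`. -/
noncomputable def slotMap (G : SimpleGraph Γ) (s : D × D) (v : Γ × D) : Γ × D :=
  if (viewGraph G D v.1).Reachable v.2 s.1 then ((s.2 : Γ) * (s.1 : Γ)⁻¹ * v.1, s.2) else v

theorem Agree.slot_step {t : ℕ} {s : D × D} {v v' : Γ × D} (hv : v.2 = v'.2)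
    (h : Agree G ι G' ι' (t + D.card) ((v.2 : Γ)⁻¹ * v.1) ((v'.2 : Γ)⁻¹ * v'.1)) :
    (slotMap G s v).2 = (slotMap G' s v').2 ∧
      Agree G ι G' ι' t (((slotMap G s v).2 : Γ)⁻¹ * (slotMap G s v).1)
        (((slotMap G' s v').2 : Γ)⁻¹ * (slotMap G' s v').1) := by
  obtain ⟨p, δ⟩ := v
  obtain ⟨p', δ'⟩ := v'
  simp only at hv h
  subst hv
  have hiff := h.reachable_iff (δ' := s.1)
  unfold slotMap
  by_cases hr : (viewGraph G D p).Reachable δ s.1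
  · rw [if_pos hr, if_pos (hiff.1 hr)]
    refine ⟨rfl, ?_⟩
    simp only [mul_assoc, inv_mul_cancel_left]
    exact (h.reachable hr).2
  · rw [if_neg hr, if_neg (mt hiff.2 hr)]
    exact ⟨rfl, h.of_le (by omega)⟩

theorem Agree.slot_step_iterate {t j : ℕ} {s : D × D} {v v' : Γ × D} (hv : v.2 = v'.2)
    (h : Agree G ι G' ι' (t + j * D.card) ((v.2 : Γ)⁻¹ * v.1) ((v'.2 : Γ)⁻¹ * v'.1)) :
    ((slotMap G s)^[j] v).2 = ((slotMap G' s)^[j] v').2 ∧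
      Agree G ι G' ι' t
        ((((slotMap G s)^[j] v).2 : Γ)⁻¹ * ((slotMap G s)^[j] v).1)
        ((((slotMap G' s)^[j] v').2 : Γ)⁻¹ *
          ((slotMap G' s)^[j] v').1) := by
  induction j generalizing v v' with
  | zero => exact ⟨hv, by simpa using h⟩
  | succ j ih =>
    rw [Nat.succ_mul, ← add_assoc] at h
    obtain ⟨h1, h2⟩ := Agree.slot_step (s := s) hv h
    exact ih h1 h2

/-- The slot is visible either from all identified views, and then they have the same successor, or
from none, and then they stay in place. -/
theorem initColor_slotMap_iterate {s : D × D} {p : Γ} {δ δ' : D}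
    (h : (viewGraph G D p).Reachable δ δ') (j : ℕ) :
    initColor G ι ((slotMap G s)^[j] (p, δ)) = initColor G ι ((slotMap G s)^[j] (p, δ')) := by
  induction j generalizing p δ δ' with
  | zero => exact initColor_eq_of_reachable h
  | succ j ih =>
    rw [Function.iterate_succ_apply, Function.iterate_succ_apply]
    by_cases hr : (viewGraph G D p).Reachable δ s.1
    · rw [slotMap, slotMap, if_pos hr, if_pos (h.symm.trans hr)]
    · rw [slotMap, slotMap, if_neg hr, if_neg fun h' => hr (h.trans h')]
      exact ih h

/-- The result of `t` steps of color reduction along the slot `s`. -/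
noncomputable def slotColor (G : SimpleGraph Γ) (ι : Γ → ℕ) (t : ℕ) (s : D × D) (v : Γ × D) : ℕ :=
  cvIter t fun j => initColor G ι ((slotMap G s)^[j] v)

theorem Agree.slotColor_eq {t : ℕ} {s : D × D} {p p' : Γ} {δ : D}
    (h : Agree G ι G' ι' ((t + 1) * D.card) ((δ : Γ)⁻¹ * p) ((δ : Γ)⁻¹ * p')) :
    slotColor G ι t s (p, δ) = slotColor G' ι' t s (p', δ) := by
  refine cvIter_congr fun j hj => ?_
  -- Each of the `j ≤ t` moves costs `|D|`, and so does reading the initial color.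
  have h1 : Agree G ι G' ι' (D.card + j * D.card) ((δ : Γ)⁻¹ * p) ((δ : Γ)⁻¹ * p') :=
    h.of_le (by nlinarith)
  obtain ⟨h2, h3⟩ := Agree.slot_step_iterate (s := s) (v := (p, δ)) (v' := (p', δ)) rfl h1
  generalize (slotMap G s)^[j] (p, δ) = v at *
  generalize (slotMap G' s)^[j] (p', δ) = v' at *
  obtain ⟨a, b⟩ := v
  obtain ⟨a', b'⟩ := v'
  simp only at h2 h3
  subst h2
  exact h3.initColor_eq

theorem slotColor_eq_of_reachable {t : ℕ} {s : D × D} {p : Γ} {δ δ' : D}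
    (h : (viewGraph G D p).Reachable δ δ') :
    slotColor G ι t s (p, δ) = slotColor G ι t s (p, δ') :=
  cvIter_congr fun j _ => initColor_slotMap_iterate h j

theorem reachable_mem {V : Set Γ} (hV : ∀ x y, G.Adj x y → y ∈ V) {p : Γ} {δ δ' : D}
    (h : (viewGraph G D p).Reachable δ δ') (hδ : (δ : Γ)⁻¹ * p ∈ V) : (δ' : Γ)⁻¹ * p ∈ V := by
  obtain ⟨w⟩ := h
  induction w with
  | nil => exact hδ
  | @cons a b c hab w ih => exact ih (hV _ _ hab)

/-- Division by `|D|` recovers the identifier and the position from a code, so equal codes would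
mean the same point `δ * x = δ' * x`. Identified views of a point stay in `V`, where identifiers are
distinct. -/
theorem initColor_ne {V : Set Γ} (hV : ∀ x y, G.Adj x y → y ∈ V) (hι : Set.InjOn ι V) {x : Γ}
    (hx : x ∈ V) {δ δ' : D} (hne : δ ≠ δ') :
    initColor G ι ((δ : Γ) * x, δ) ≠ initColor G ι ((δ' : Γ) * x, δ') := by
  intro h
  obtain ⟨a, ha, e⟩ := exists_initColor_eq G ι ((δ : Γ) * x, δ)
  obtain ⟨b, hb, e'⟩ := exists_initColor_eq G ι ((δ' : Γ) * x, δ')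
  simp only at ha hb e e'
  rw [e, e'] at h
  have ha2 := (D.equivFin a).2
  have hb2 := (D.equivFin b).2
  have h1 := congrArg (· % D.card) h
  have h2 := congrArg (· / D.card) h
  simp only [Nat.mul_add_mod, Nat.mod_eq_of_lt ha2, Nat.mod_eq_of_lt hb2] at h1
  rw [Nat.mul_add_div (by omega), Nat.mul_add_div (by omega), Nat.div_eq_of_lt ha2,
    Nat.div_eq_of_lt hb2] at h2
  have hab : a = b := D.equivFin.injective (Fin.ext h1)
  subst hab
  have h3 := hι (reachable_mem hV ha (by simpa using hx)) (reachable_mem hV hb (by simpa using hx))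
    (by simpa using h2)
  exact hne (Subtype.ext (mul_right_cancel (mul_left_cancel h3)))

/-- The slot `(δ, δ')` moves `δ * x` to `δ' * x` in one step, so reduction along it separates this
pair. All slots together make the colors in a window distinct. -/
theorem slotColor_ne {V : Set Γ} (hV : ∀ x y, G.Adj x y → y ∈ V) (hι : Set.InjOn ι V) {x : Γ}
    (hx : x ∈ V) {δ δ' : D} (hne : δ ≠ δ') (t : ℕ) :
    slotColor G ι t (δ, δ') ((δ : Γ) * x, δ) ≠ slotColor G ι t (δ, δ') ((δ' : Γ) * x, δ') := by
  have e : slotMap G (δ, δ') ((δ : Γ) * x, δ) = ((δ' : Γ) * x, δ') := by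
    rw [slotMap, if_pos (SimpleGraph.Reachable.refl _)]
    simp [mul_assoc]
  have := cvIter_ne (t := t)
    (u := fun j => initColor G ι ((slotMap G (δ, δ'))^[j] ((δ : Γ) * x, δ))) (by
      simp only [Function.iterate_zero_apply, Function.iterate_one, e]
      exact initColor_ne hV hι hx hne)
  simp only [Function.iterate_succ_apply, e] at this
  exact this

/-- The tuples of colors, as numbers. -/
noncomputable def slotColorsEquiv (D : Finset Γ) : (D × D → Fin 6) ≃ Fin (6 ^ D.card ^ 2) := by
  classical
  exact Fintype.equivFinOfCardEq (by simp [sq])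

/-- The colors of the virtual vertices around `x`, for all slots together. -/
noncomputable def viewColor (G : SimpleGraph Γ) (ι : Γ → ℕ) (D : Finset Γ) (t : ℕ) (x : Γ) (δ : D) :
    Fin (6 ^ D.card ^ 2) :=
  slotColorsEquiv D fun s => Fin.ofNat 6 (slotColor G ι t s ((δ : Γ) * x, δ))

open Classical in
/-- Apply `F` to the colors around `x`. -/
noncomputable def viewRule {k : ℕ} (D : Finset Γ) (F : ((D : Set Γ) ↪ Fin (6 ^ D.card ^ 2)) → Fin k)
    (c : Fin k) (t : ℕ) (G : SimpleGraph Γ) (ι : Γ → ℕ) (x : Γ) : Fin k :=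
  if h : Function.Injective (viewColor G ι D t x) then F ⟨viewColor G ι D t x, h⟩ else c

theorem viewRule_congr {k : ℕ} (F : ((D : Set Γ) ↪ Fin (6 ^ D.card ^ 2)) → Fin k) (c : Fin k)
    {t : ℕ} {x x' : Γ} (h : Agree G ι G' ι' ((t + 1) * D.card) x x') :
    viewRule D F c t G ι x = viewRule D F c t G' ι' x' := by
  have : viewColor G ι D t x = viewColor G' ι' D t x' := by
    funext δ
    unfold viewColor
    congr 1
    funext s
    rw [Agree.slotColor_eq (p' := (δ : Γ) * x') (by simpa using h)]
  unfold viewRule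
  simp only [this]

/-- A coloring of a graph `H_{D,n}` with sufficiently large `n` yields a local algorithm. -/
theorem exists_localAlgorithm_of_tileGraph {S : Set Γ} {k : ℕ} (hk : 1 ≤ k)
    {P : Set (Pattern Γ k)} {D : Finset Γ} (hD : S ∪ S⁻¹ ∪ {1} ⊆ (D : Set Γ))
    {F : ((D : Set Γ) ↪ Fin (6 ^ D.card ^ 2)) → Fin k}
    (hF : AvoidsOnGraph P (tileGraph S D hD (6 ^ D.card ^ 2)) F) :
    ∃ (A : LocalAlgorithm Γ k) (T : ℕ → ℕ),
      (fun n => (T n : ℝ)) =O[Filter.atTop] (fun n => (logStar n : ℝ)) ∧ A.Solves S P T := by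
  obtain ⟨c, hc⟩ := exists_cvBound_iterate_logStar_le D.card
  let Φ : ℕ → SimpleGraph Γ → (Γ → ℕ) → Γ → Fin k := fun n G ι x =>
    viewRule D F ⟨0, hk⟩ (logStar n + c) G ι x
  let T : ℕ → ℕ := fun n => (logStar n + c + 1) * D.card
  refine ⟨gatherAlgorithm T Φ ⟨0, hk⟩, T, ?_, ?_⟩
  · refine Asymptotics.IsBigO.of_bound ((c + 2) * D.card) ?_
    filter_upwards [Filter.eventually_ge_atTop 2] with n hn
    rw [Real.norm_natCast, Real.norm_natCast]
    have h1 := one_le_logStar hn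
    have : T n ≤ (c + 2) * D.card * logStar n := by
      simp only [T]
      calc (logStar n + c + 1) * D.card ≤ ((c + 2) * logStar n) * D.card := by
            gcongr
            nlinarith
        _ = _ := by ring
    exact_mod_cast this
  intro n H hfin hcard ident hinj hident
  have hrun : (gatherAlgorithm T Φ ⟨0, hk⟩).run n ((cayleyGraph S).ofSubgraph H) ident (T n) =
      fun x : H.verts => Φ n H.spanningCoe (extendIdent ident) x :=
    funext fun x => gatherAlgorithm_run T Φ
      (fun n G ι G' ι' x x' h => viewRule_congr F ⟨0, hk⟩ h) ⟨0, hk⟩ n H ident x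
  rw [hrun]
  set G := H.spanningCoe with hG
  set ι := extendIdent ident with hι
  set t := logStar n + c with ht
  have hV : ∀ x y, G.Adj x y → y ∈ H.verts := fun x y h => SimpleGraph.Subgraph.Adj.snd_mem h
  have hιV : Set.InjOn ι H.verts := by
    intro x hx y hy hxy
    rw [hι, extendIdent_coe ident ⟨x, hx⟩, extendIdent_coe ident ⟨y, hy⟩] at hxy
    exact congrArg Subtype.val (hinj hxy)
  have hιn : ∀ x, ι x ≤ n := by
    intro x
    rw [hι, extendIdent]
    split_ifs with h
    · exact (hident ⟨x, h⟩).2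
    · exact Nat.zero_le _
  have h1D : 1 ∈ D := hD (Or.inr rfl)
  have hDpos : 0 < D.card := Finset.card_pos.2 ⟨1, h1D⟩
  have hlt : ∀ x ∈ H.verts, ∀ (s : D × D) (v : Γ × D), slotColor G ι t s v < 6 := by
    intro x hx s v
    have hn : 1 ≤ n := by
      rw [← hcard]
      exact (Set.ncard_pos hfin).2 ⟨x, hx⟩
    -- Identifiers are at most `n`, including the default `0` outside the subgraph, so initial
    -- colors are below `|D| * (n + 1)`.
    refine (cvIter_lt (m := D.card * (n + 1)) (by nlinarith) fun j _ => ?_).trans_le (hc n)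
    obtain ⟨δ, -, e⟩ := exists_initColor_eq G ι ((slotMap G s)^[j] v)
    rw [e]
    have h1 := (D.equivFin δ).2
    have h2 := Nat.mul_le_mul_left D.card (hιn ((δ : Γ)⁻¹ * ((slotMap G s)^[j] v).1))
    rw [mul_add, mul_one]
    omega
  have hval : ∀ x ∈ H.verts, ∀ (s : D × D) (v : Γ × D),
      ((Fin.ofNat 6 (slotColor G ι t s v) : Fin 6) : ℕ) = slotColor G ι t s v := by
    intro x hx s v
    simpa using Nat.mod_eq_of_lt (hlt x hx s v)
  have hinjv : ∀ x ∈ H.verts, Function.Injective (viewColor G ι D t x) := by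
    intro x hx δ δ' h
    by_contra hne
    have h1 := congrFun ((slotColorsEquiv D).injective h) (δ, δ')
    have h2 := congrArg Fin.val h1
    rw [hval x hx, hval x hx] at h2
    exact slotColor_ne hV hιV hx hne t h2
  let q : H.verts → ((D : Set Γ) ↪ Fin (6 ^ D.card ^ 2)) := fun x =>
    ⟨viewColor G ι D t x, hinjv x x.2⟩
  have hq : (fun x : H.verts => Φ n G ι x) = F ∘ q := by
    funext x
    change viewRule D F _ t G ι x = _
    rw [viewRule, dif_pos (hinjv x x.2)]
    rfl
  rw [hq]
  refine hF.comp (isHom_tileGraph hD ?_ ?_)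
  · intro x y h
    exact (label_mem_of_adj (H.coe_adj_sub _ _ h)).2
  · intro x y h δ δ' e
    change viewColor G ι D t x δ = viewColor G ι D t y δ'
    have e' : (δ : Γ) = δ' * ((y : Γ) * (x : Γ)⁻¹) := e
    have ep : (δ : Γ) * x = δ' * y := by rw [e']; group
    unfold viewColor
    congr 1
    funext s
    rw [ep]
    congr 1
    apply slotColor_eq_of_reachable
    -- The edge from `x` to `y` itself identifies their views of the common point. Only edges
    -- present in the subgraph matter, so it need not be induced.
    refine SimpleGraph.Adj.reachable ?_
    change G.Adj ((δ : Γ)⁻¹ * (δ' * y)) ((δ' : Γ)⁻¹ * (δ' * y))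
    rw [← ep, inv_mul_cancel_left, ep, inv_mul_cancel_left]
    exact h

end Local

/-! ### Generic translates -/

section Generic

theorem exists_seq_notMem {α : Type*} [Infinite α] [DecidableEq α] (f : Finset α → Finset α) :
    ∃ t : ℕ → α, ∀ m, t m ∉ f ((Finset.range m).image t) := by
  have hex : ∀ A : Finset α, ∃ x, x ∉ f A := fun A => Infinite.exists_notMem_finset (f A)
  choose pick hpick using hex
  let A : ℕ → Finset α := fun m => Nat.rec ∅ (fun _ A => insert (pick A) A) m
  have hA : ∀ m, A m = (Finset.range m).image fun i => pick (A i) := by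
    intro m
    induction m with
    | zero => rfl
    | succ m ih =>
      rw [Finset.range_add_one, Finset.image_insert, ← ih]
  exact ⟨fun m => pick (A m), fun m => by rw [← hA m]; exact hpick _⟩

variable {Γ : Type u} [Group Γ]

/-- Some translate `T t_m` with `m ≠ l` meets `T t_l θ`. -/
def MeetsOther (T : Finset Γ) (t : ℕ → Γ) (θ : Γ) (l : ℕ) : Prop :=
  ∃ m ≠ l, ∃ a ∈ T, ∃ a' ∈ T, a * t l * θ = a' * t m

/-- The translates `T t_m` are in general position. -/
structure IsGeneric [DecidableEq Γ] (T P : Finset Γ) (t : ℕ → Γ) : Prop where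
  spread : ∀ {m m' : ℕ} {a a' p : Γ}, a ∈ T → a' ∈ T → p ∈ P ∪ T * T⁻¹ →
    a * t m = p * (a' * t m') → m = m'
  meets : ∀ {θ : Γ} {l₁ l₂ l₃ : ℕ}, MeetsOther T t θ l₁ → MeetsOther T t θ l₂ →
    MeetsOther T t θ l₃ → l₁ = l₂ ∨ l₁ = l₃ ∨ l₂ = l₃

/-- Choose `t m` one after another, outside the finitely many solutions of the forbidden equations
in earlier terms. At most two translates can meet others, since `θ` determines the largest index in
any relation that it causes. -/
theorem exists_isGeneric [Infinite Γ] [DecidableEq Γ] (T P : Finset Γ) :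
    ∃ t : ℕ → Γ, IsGeneric T P t := by
  set R : Finset Γ := P ∪ T * T⁻¹ with hR
  obtain ⟨t, ht⟩ := exists_seq_notMem fun A : Finset Γ =>
    T⁻¹ * (R ∪ R⁻¹) * T * A ∪ T⁻¹ * T * A * A⁻¹ * T⁻¹ * T * A
  have hmem : ∀ {i m : ℕ}, i < m → t i ∈ (Finset.range m).image t := fun h =>
    Finset.mem_image.2 ⟨_, Finset.mem_range.2 h, rfl⟩
  have h1 : ∀ {m m' : ℕ} {a a' p : Γ}, a ∈ T → a' ∈ T → p ∈ R ∪ R⁻¹ → m' < m →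
      t m ≠ a⁻¹ * p * a' * t m' := by
    intro m m' a a' p ha ha' hp hlt e
    refine ht m (Finset.mem_union_left _ ?_)
    rw [e]
    exact Finset.mul_mem_mul (Finset.mul_mem_mul (Finset.mul_mem_mul (Finset.inv_mem_inv ha) hp) ha')
      (hmem hlt)
  have h2 : ∀ {m i j l : ℕ} {a b c d : Γ}, a ∈ T → b ∈ T → c ∈ T → d ∈ T → i < m → j < m → l < m →
      t m ≠ a⁻¹ * b * t i * (t j)⁻¹ * c⁻¹ * d * t l := by
    intro m i j l a b c d ha hb hc hd hi hj hl e
    refine ht m (Finset.mem_union_right _ ?_)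
    rw [e]
    exact Finset.mul_mem_mul (Finset.mul_mem_mul (Finset.mul_mem_mul (Finset.mul_mem_mul
      (Finset.mul_mem_mul (Finset.mul_mem_mul (Finset.inv_mem_inv ha) hb) (hmem hi))
      (Finset.inv_mem_inv (hmem hj))) (Finset.inv_mem_inv hc)) hd) (hmem hl)
  have hspread : ∀ {m m' : ℕ} {a a' p : Γ}, a ∈ T → a' ∈ T → p ∈ R →
      a * t m = p * (a' * t m') → m = m' := by
    intro m m' a a' p ha ha' hp e
    rcases lt_trichotomy m m' with h | h | h
    · refine absurd ?_ (h1 ha' ha (Finset.mem_union_right R (Finset.inv_mem_inv hp)) h)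
      rw [mul_assoc _ a, e]
      group
    · exact h
    · refine absurd ?_ (h1 ha ha' (Finset.mem_union_left _ hp) h)
      rw [mul_assoc _ a', mul_assoc, ← e]
      group
  -- Express `θ` by the relation with smaller indices and substitute: the largest index of the other
  -- relation would be given by earlier terms.
  have hmax : ∀ {θ : Γ} {l m l' m' : ℕ} {a a' b b' : Γ}, a ∈ T → a' ∈ T → b ∈ T → b' ∈ T → l ≠ m →
      a * t l * θ = a' * t m → b * t l' * θ = b' * t m' → max l m ≤ max l' m' := by
    intro θ l m l' m' a a' b b' ha ha' hb hb' hne e e'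
    by_contra! hlt
    have hθ : θ = (t l')⁻¹ * b⁻¹ * (b' * t m') := by rw [← e']; group
    rw [hθ] at e
    rcases lt_or_gt_of_ne hne with h | h
    · rw [max_eq_right h.le] at hlt
      refine h2 ha' ha hb hb' h ((le_max_left l' m').trans_lt hlt) ((le_max_right l' m').trans_lt hlt) ?_
      calc t m = a'⁻¹ * (a' * t m) := by group
        _ = _ := by rw [← e]; group
    · rw [max_eq_left h.le] at hlt
      refine h2 ha ha' hb' hb h ((le_max_right l' m').trans_lt hlt) ((le_max_left l' m').trans_lt hlt) ?_
      calc t l = a⁻¹ * (a * t l * ((t l')⁻¹ * b⁻¹ * (b' * t m'))) * ((t l')⁻¹ * b⁻¹ * (b' * t m'))⁻¹ := by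
            group
        _ = _ := by rw [e]; group
  have hsame : ∀ {θ : Γ} {l l' m : ℕ} {a a' b b' : Γ}, a ∈ T → a' ∈ T → b ∈ T → b' ∈ T →
      a * t l * θ = a' * t m → b * t l' * θ = b' * t m → l = l' := by
    intro θ l l' m a a' b b' ha ha' hb hb' e e'
    refine hspread ha hb (p := a' * b'⁻¹)
      (Finset.mem_union_right _ (Finset.mul_mem_mul ha' (Finset.inv_mem_inv hb'))) ?_
    calc a * t l = a' * t m * θ⁻¹ := by rw [← e]; group
      _ = a' * b'⁻¹ * (b' * t m) * θ⁻¹ := by group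
      _ = _ := by rw [← e']; group
  refine ⟨t, hspread, ?_⟩
  rintro θ l₁ l₂ l₃ ⟨m₁, n₁, a₁, ha₁, b₁, hb₁, e₁⟩ ⟨m₂, n₂, a₂, ha₂, b₂, hb₂, e₂⟩
    ⟨m₃, n₃, a₃, ha₃, b₃, hb₃, e₃⟩
  have h12 := le_antisymm (hmax ha₁ hb₁ ha₂ hb₂ n₁.symm e₁ e₂) (hmax ha₂ hb₂ ha₁ hb₁ n₂.symm e₂ e₁)
  have h13 := le_antisymm (hmax ha₁ hb₁ ha₃ hb₃ n₁.symm e₁ e₃) (hmax ha₃ hb₃ ha₁ hb₁ n₃.symm e₃ e₁)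
  have k12 : m₁ = m₂ → l₁ = l₂ := by rintro rfl; exact hsame ha₁ hb₁ ha₂ hb₂ e₁ e₂
  have k13 : m₁ = m₃ → l₁ = l₃ := by rintro rfl; exact hsame ha₁ hb₁ ha₃ hb₃ e₁ e₃
  have k23 : m₂ = m₃ → l₂ = l₃ := by rintro rfl; exact hsame ha₂ hb₂ ha₃ hb₃ e₂ e₃
  -- All pairs `(l, m)` have the same maximum. At most one `l` attains it, and by `hsame` at most
  -- one `l` has a partner `m` attaining it.
  omega

end Generic

/-! ### The levels of the construction -/

/-- The parameters of one level: positions `T t_l` for the bits that are written around a marker,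
the set `P` of displacements from earlier levels, the number `n` of bits of a marker color, and the
translations `s` by which `T` is enlarged for the next level. -/
structure Level (Γ : Type u) where
  T : Finset Γ
  P : Finset Γ
  n : ℕ
  t : ℕ → Γ
  s : ℕ → Γ

namespace Level

variable {Γ : Type u} [Group Γ] [DecidableEq Γ] (L : Level Γ)

/-- The positions around a marker in which bits may be written. -/
def Q : Finset Γ := L.T * (Finset.range (8 * L.n)).image L.t

/-- The positions around a marker which later levels have to avoid. -/
def K : Finset Γ := L.P * L.Q

/-- Five translates, because at most `1 + 1 + 2` of them are spoiled in `exists_mem_T`. -/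
def nextT : Finset Γ := L.T * (Finset.range 5).image L.s

/-- The displacements between positions of this level are remembered: through `K = P * Q`, a later
level reserves everything that an earlier window would compare with one of its own positions. -/
def nextP : Finset Γ := L.P ∪ L.Q * L.Q⁻¹

/-- The three parts make markers unique in `eq_of_smul_eq`, `exists_mem_Q` and `eq_of_mem_ones`,
respectively. -/
def reach : Finset Γ := L.nextT⁻¹ * L.K ∪ L.Q⁻¹ * L.Q ∪ L.K

/-- Distinct markers do not differ by elements of this set. -/
def R : Finset Γ := L.reach⁻¹ * L.reach

/-- The conjugates of `γ` that have to be detected at markers. -/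
def conj (γ : Γ) : Finset Γ := (insert 1 L.R).image fun δ => δ * γ * δ⁻¹

/-- Distinct markers that differ by elements of this set get distinct colors. -/
def colorR (γ : Γ) : Finset Γ := L.Q⁻¹ * L.Q * L.conj γ ∪ (L.Q⁻¹ * L.Q * L.conj γ)⁻¹

structure IsGood (γ : Γ) : Prop where
  t_generic : IsGeneric L.T L.P L.t
  s_generic : IsGeneric L.T (L.P ∪ L.K * L.K⁻¹) L.s
  one_le_n : 1 ≤ L.n
  card_lt : (L.colorR γ).card < 2 ^ L.n

/-- Only polynomial growth in `n` matters, since `n` bits give `2 ^ n` colors. The bound involves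
neither `t` nor `s`, so `n` can be fixed before `s`. -/
theorem card_colorR_le (γ : Γ) : (L.colorR γ).card ≤
    4 * (5 * L.T.card * L.P.card + 1 + L.P.card) ^ 2 * (8 * L.n * L.T.card + 1) ^ 6 := by
  set q := 8 * L.n * L.T.card + 1 with hq
  set c := 5 * L.T.card * L.P.card + 1 + L.P.card with hc
  have hQ : L.Q.card ≤ q := by
    calc L.Q.card ≤ L.T.card * ((Finset.range (8 * L.n)).image L.t).card := Finset.card_mul_le
      _ ≤ L.T.card * (8 * L.n) := by
        gcongr
        exact Finset.card_image_le.trans (by simp)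
      _ ≤ q := by rw [hq, mul_comm]; omega
  have hK : L.K.card ≤ L.P.card * q := Finset.card_mul_le.trans (by gcongr)
  have hT : L.nextT.card ≤ 5 * L.T.card := by
    calc L.nextT.card ≤ L.T.card * ((Finset.range 5).image L.s).card := Finset.card_mul_le
      _ ≤ L.T.card * 5 := by
        gcongr
        exact Finset.card_image_le.trans (by simp)
      _ = _ := mul_comm _ _
  have hq1 : 1 ≤ q := by omega
  have hreach : L.reach.card ≤ c * q ^ 2 := by
    calc L.reach.card ≤ (L.nextT⁻¹ * L.K).card + (L.Q⁻¹ * L.Q).card + L.K.card :=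
          (Finset.card_union_le _ _).trans (by gcongr; exact Finset.card_union_le _ _)
      _ ≤ (5 * L.T.card) * (L.P.card * q) + q * q + L.P.card * q := by
        gcongr
        · refine Finset.card_mul_le.trans ?_
          rw [Finset.card_inv]
          gcongr
        · refine Finset.card_mul_le.trans ?_
          rw [Finset.card_inv]
          gcongr
      _ ≤ (5 * L.T.card) * (L.P.card * (q * q)) + q * q + L.P.card * (q * q) := by
        gcongr <;> nlinarith
      _ = c * q ^ 2 := by rw [hc]; ring
  have hR : L.R.card ≤ c ^ 2 * q ^ 4 := by
    refine Finset.card_mul_le.trans ?_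
    rw [Finset.card_inv]
    calc L.reach.card * L.reach.card ≤ (c * q ^ 2) * (c * q ^ 2) := by gcongr
      _ = _ := by ring
  have hC : (L.conj γ).card ≤ 2 * (c ^ 2 * q ^ 4) := by
    have h1 : 1 ≤ c ^ 2 * q ^ 4 := Nat.one_le_iff_ne_zero.2 (by
      have : c ≠ 0 := by omega
      positivity)
    calc (L.conj γ).card ≤ (insert 1 L.R).card := Finset.card_image_le
      _ ≤ L.R.card + 1 := Finset.card_insert_le _ _
      _ ≤ _ := by omega
  have hmul : (L.Q⁻¹ * L.Q * L.conj γ).card ≤ q * q * (2 * (c ^ 2 * q ^ 4)) := by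
    refine Finset.card_mul_le.trans (Nat.mul_le_mul (Finset.card_mul_le.trans ?_) hC)
    rw [Finset.card_inv]
    gcongr
  calc (L.colorR γ).card ≤ _ := Finset.card_union_le _ _
    _ ≤ q * q * (2 * (c ^ 2 * q ^ 4)) + q * q * (2 * (c ^ 2 * q ^ 4)) := by
      rw [Finset.card_inv]
      gcongr
    _ = _ := by ring

end Level

theorem exists_poly_lt_two_pow (C c : ℕ) : ∃ n ≥ 1, C * (8 * n * c + 1) ^ 6 < 2 ^ n := by
  have h := (tendsto_pow_const_div_const_pow_of_one_lt 6 (r := (2 : ℝ)) (by norm_num)).const_mul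
    ((C * (8 * c + 1) ^ 6 : ℕ) : ℝ)
  rw [mul_zero] at h
  obtain ⟨n, hn, hn1⟩ := ((h.eventually (gt_mem_nhds (show (0 : ℝ) < 1 by norm_num))).and
    (Filter.eventually_ge_atTop 1)).exists
  refine ⟨n, hn1, ?_⟩
  rw [← mul_div_assoc, div_lt_one (by positivity)] at hn
  have h2 : C * (8 * c + 1) ^ 6 * n ^ 6 < 2 ^ n := by exact_mod_cast hn
  refine lt_of_le_of_lt ?_ h2
  rw [mul_assoc C, ← mul_pow]
  gcongr
  nlinarith

theorem exists_level {Γ : Type u} [Group Γ] [Infinite Γ] [DecidableEq Γ] (γ : Γ)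
    (T P : Finset Γ) : ∃ L : Level Γ, L.T = T ∧ L.P = P ∧ L.IsGood γ := by
  obtain ⟨t, ht⟩ := exists_isGeneric T P
  obtain ⟨n, hn1, hn⟩ := exists_poly_lt_two_pow
    (4 * (5 * T.card * P.card + 1 + P.card) ^ 2) T.card
  obtain ⟨s, hs⟩ := exists_isGeneric T (P ∪ (Level.mk T P n t t).K * (Level.mk T P n t t).K⁻¹)
  exact ⟨⟨T, P, n, t, s⟩, rfl, rfl, ht, hs, hn1, ((Level.mk T P n t s).card_colorR_le γ).trans_lt hn⟩

/-- A sequence of levels, each of which starts from the output of the previous one. -/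
structure IsLevelSeq {Γ : Type u} [Group Γ] [DecidableEq Γ] (γ : ℕ → Γ) (L : ℕ → Level Γ) :
    Prop where
  T_zero : (L 0).T = {1}
  P_zero : (L 0).P = {1}
  T_succ : ∀ j, (L (j + 1)).T = (L j).nextT
  P_succ : ∀ j, (L (j + 1)).P = (L j).nextP
  good : ∀ j, (L j).IsGood (γ j)

theorem exists_isLevelSeq {Γ : Type u} [Group Γ] [Infinite Γ] [DecidableEq Γ] (γ : ℕ → Γ) :
    ∃ L, IsLevelSeq γ L := by
  choose f hT hP hf using fun γ : Γ => exists_level γ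
  let L : ℕ → Level Γ := fun j =>
    Nat.rec (f (γ 0) {1} {1}) (fun i M => f (γ (i + 1)) M.nextT M.nextP) j
  refine ⟨L, hT _ _ _, hP _ _ _, fun j => hT _ _ _, fun j => hP _ _ _, fun j => ?_⟩
  cases j with
  | zero => exact hf _ _ _
  | succ j => exact hf _ _ _

namespace IsLevelSeq

variable {Γ : Type u} [Group Γ] [DecidableEq Γ] {γ : ℕ → Γ} {L : ℕ → Level Γ}

theorem P_subset (h : IsLevelSeq γ L) {i j : ℕ} (hij : i ≤ j) : (L i).P ⊆ (L j).P := by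
  induction j, hij using Nat.le_induction with
  | base => exact subset_rfl
  | succ j _ ih => rw [h.P_succ]; exact ih.trans Finset.subset_union_left

theorem one_mem_P (h : IsLevelSeq γ L) (j : ℕ) : 1 ∈ (L j).P :=
  h.P_subset (Nat.zero_le j) (by rw [h.P_zero]; simp)

theorem mul_inv_mem_P (h : IsLevelSeq γ L) {i j : ℕ} (hij : i < j) {a b : Γ} (ha : a ∈ (L i).Q)
    (hb : b ∈ (L i).Q) : a * b⁻¹ ∈ (L j).P := by
  refine h.P_subset (Nat.succ_le_of_lt hij) ?_
  rw [h.P_succ]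
  exact Finset.mem_union_right _ (Finset.mul_mem_mul ha (Finset.inv_mem_inv hb))

theorem Q_subset_K (h : IsLevelSeq γ L) (j : ℕ) : (L j).Q ⊆ (L j).K := fun a ha => by
  have := Finset.mul_mem_mul (h.one_mem_P j) ha
  rwa [one_mul] at this

theorem mem_Q {j l : ℕ} {a : Γ} (ha : a ∈ (L j).T) (hl : l < 8 * (L j).n) :
    a * (L j).t l ∈ (L j).Q :=
  Finset.mul_mem_mul ha (Finset.mem_image.2 ⟨l, Finset.mem_range.2 hl, rfl⟩)

/-- Translates of positions of distinct bits of an earlier level do not lie in `T`. -/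
theorem eq_of_mul_mem_T (h : IsLevelSeq γ L) {i j : ℕ} (hij : j < i) {l l' : ℕ}
    (hl : l < 8 * (L j).n) (hl' : l' < 8 * (L j).n) {a a' θ : Γ} (ha : a ∈ (L j).T)
    (ha' : a' ∈ (L j).T) (h1 : a * (L j).t l * θ ∈ (L i).T) (h2 : a' * (L j).t l' * θ ∈ (L i).T) :
    l = l' := by
  have hprod : ∀ θ c c' s : Γ, a * (L j).t l * θ = c * s → a' * (L j).t l' * θ = c' * s →
      a * (L j).t l = c * c'⁻¹ * (a' * (L j).t l') := by
    intro θ c c' s e e'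
    have e1 : a * (L j).t l = c * s * θ⁻¹ := by rw [← e]; group
    have e2 : a' * (L j).t l' = c' * s * θ⁻¹ := by rw [← e']; group
    rw [e1, e2]; group
  have hdiff : ∀ θ c c' s s' : Γ, a * (L j).t l * θ = c * s → a' * (L j).t l' * θ = c' * s' →
      c * s = a * (L j).t l * (a' * (L j).t l')⁻¹ * (c' * s') := by
    intro θ c c' s s' e e'
    rw [← e, ← e']; group
  -- Both points lie in `T * s r` with the same `r`, because their displacement is among those that
  -- `s` spreads apart. Removing `s r` leads one level down, and at level `j` spreading of `t`
  -- finishes.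
  induction i, (Nat.succ_le_of_lt hij) using Nat.le_induction generalizing θ with
  | base =>
    rw [Nat.succ_eq_add_one, h.T_succ] at h1 h2
    obtain ⟨c, hc, s, hs, e⟩ := Finset.mem_mul.1 h1
    obtain ⟨c', hc', s', hs', e'⟩ := Finset.mem_mul.1 h2
    obtain ⟨r, -, rfl⟩ := Finset.mem_image.1 hs
    obtain ⟨r', -, rfl⟩ := Finset.mem_image.1 hs'
    have hr : r = r' := (h.good j).s_generic.spread hc hc' (Finset.mem_union_left _
      (Finset.mem_union_right _ (Finset.mul_mem_mul (h.Q_subset_K j (mem_Q ha hl))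
        (Finset.inv_mem_inv (h.Q_subset_K j (mem_Q ha' hl')))))) (hdiff _ _ _ _ _ e.symm e'.symm)
    subst hr
    exact (h.good j).t_generic.spread ha ha' (Finset.mem_union_right _
      (Finset.mul_mem_mul hc (Finset.inv_mem_inv hc'))) (hprod _ _ _ _ e.symm e'.symm)
  | succ i hi ih =>
    rw [h.T_succ] at h1 h2
    obtain ⟨c, hc, s, hs, e⟩ := Finset.mem_mul.1 h1
    obtain ⟨c', hc', s', hs', e'⟩ := Finset.mem_mul.1 h2
    obtain ⟨r, -, rfl⟩ := Finset.mem_image.1 hs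
    obtain ⟨r', -, rfl⟩ := Finset.mem_image.1 hs'
    have hr : r = r' := (h.good i).s_generic.spread hc hc' (Finset.mem_union_left _
      (Finset.mem_union_left _ (h.mul_inv_mem_P (by omega) (mem_Q ha hl) (mem_Q ha' hl'))))
      (hdiff _ _ _ _ _ e.symm e'.symm)
    subst hr
    have e1 : a * (L j).t l * (θ * ((L i).s r)⁻¹) = c := by
      rw [← mul_assoc, ← e]; group
    have e2 : a' * (L j).t l' * (θ * ((L i).s r)⁻¹) = c' := by
      rw [← mul_assoc, ← e']; group
    exact ih (by omega) (e1 ▸ hc) (e2 ▸ hc')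

end IsLevelSeq

/-! ### Codes -/

/-- The bits of `κ` and their complements, each four times. -/
def codeBit (κ l : ℕ) : Prop := κ.testBit (l / 8) = decide (l / 4 % 2 = 0)

/-- Writing complements too ensures that of two different colors each has a `1` where the other has
none. The fourfold repetition leaves a choice of positions. -/
theorem exists_codeBit (κ : ℕ) {i n : ℕ} (hi : i < n) : ∃ l₀, ∀ r < 4, l₀ + r < 8 * n ∧
    codeBit κ (l₀ + r) ∧ ∀ κ' : ℕ, κ'.testBit i ≠ κ.testBit i → ¬ codeBit κ' (l₀ + r) := by
  obtain ⟨e, he, hb⟩ : ∃ e < 2, κ.testBit i = decide (e = 0) := by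
    cases κ.testBit i
    · exact ⟨1, by norm_num, rfl⟩
    · exact ⟨0, by norm_num, rfl⟩
  refine ⟨8 * i + 4 * e, fun r hr => ?_⟩
  have h1 : (8 * i + 4 * e + r) / 8 = i := by omega
  have h2 : (8 * i + 4 * e + r) / 4 % 2 = e := by omega
  refine ⟨by omega, ?_, fun κ' h => ?_⟩
  · rw [codeBit, h1, h2, hb]
  · rw [codeBit, h1, h2, ← hb]
    exact h

theorem exists_testBit_ne {κ κ' n : ℕ} (hκ : κ < 2 ^ n) (hκ' : κ' < 2 ^ n) (h : κ' ≠ κ) :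
    ∃ i < n, κ'.testBit i ≠ κ.testBit i := by
  by_contra! hcon
  refine h (Nat.eq_of_testBit_eq fun i => ?_)
  by_cases hi : i < n
  · exact hcon i hi
  · have hp := Nat.pow_le_pow_right (n := 2) (by norm_num) (not_lt.1 hi)
    rw [Nat.testBit_lt_two_pow (hκ.trans_le hp), Nat.testBit_lt_two_pow (hκ'.trans_le hp)]

theorem exists_not_of_few {N c₁ c₂ c₃ : ℕ} (hN : c₁ + c₂ + c₃ < N) (A B C : ℕ → Prop)
    (hA : ∀ s : Finset ℕ, (∀ x ∈ s, x < N ∧ A x) → s.card ≤ c₁)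
    (hB : ∀ s : Finset ℕ, (∀ x ∈ s, x < N ∧ B x) → s.card ≤ c₂)
    (hC : ∀ s : Finset ℕ, (∀ x ∈ s, x < N ∧ C x) → s.card ≤ c₃) :
    ∃ x < N, ¬ A x ∧ ¬ B x ∧ ¬ C x := by
  classical
  by_contra! hcon
  have hsub : Finset.range N ⊆ (Finset.range N).filter A ∪ (Finset.range N).filter B ∪
      (Finset.range N).filter C := by
    intro x hx
    simp only [Finset.mem_union, Finset.mem_filter, hx, true_and]
    by_contra! h
    exact h.2 (hcon x (Finset.mem_range.1 hx) h.1.1 h.1.2)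
  have h1 := Finset.card_le_card hsub
  have h2 := hA ((Finset.range N).filter A) fun x hx => by simpa using hx
  have h3 := hB ((Finset.range N).filter B) fun x hx => by simpa using hx
  have h4 := hC ((Finset.range N).filter C) fun x hx => by simpa using hx
  have h5 := Finset.card_union_le ((Finset.range N).filter A ∪ (Finset.range N).filter B)
    ((Finset.range N).filter C)
  have h6 := Finset.card_union_le ((Finset.range N).filter A) ((Finset.range N).filter B)
  rw [Finset.card_range] at h1
  omega

theorem card_le_two_of_forall {s : Finset ℕ}
    (h : ∀ a ∈ s, ∀ b ∈ s, ∀ c ∈ s, a = b ∨ a = c ∨ b = c) : s.card ≤ 2 := by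
  by_contra! hlt
  obtain ⟨a, ha, b, hb, c, hc, h1, h2, h3⟩ := Finset.two_lt_card.1 hlt
  rcases h a ha b hb c hc with e | e | e
  · exact h1 e
  · exact h2 e
  · exact h3 e

/-! ### Writing the bits -/

theorem IsFreeAction.eq_of_smul_eq {Γ : Type u} [Group Γ] {X : Type*} [MulAction Γ X]
    (hfree : IsFreeAction Γ X) {a b : Γ} {x : X} (h : a • x = b • x) : a = b := by
  have h1 : b⁻¹ * a ∈ MulAction.stabilizer Γ x := by
    rw [MulAction.mem_stabilizer_iff, mul_smul, h, inv_smul_smul]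
  rw [hfree x, Subgroup.mem_bot, inv_mul_eq_one] at h1
  exact h1.symm

/-- Sets of markers with colors, for each level. -/
structure MarkerSystem {Γ : Type u} [Group Γ] [DecidableEq Γ] (γ : ℕ → Γ) (L : ℕ → Level Γ)
    (X : Type*) [MulAction Γ X] where
  M : ℕ → Set X
  κ : ℕ → X → ℕ
  separated : ∀ j, ∀ y ∈ M j, ∀ r ∈ (L j).R, r • y ∈ M j → r • y = y
  syndetic : ∀ j x, ∃ δ ∈ insert 1 (L j).R, δ • x ∈ M j
  color_ne : ∀ j x, ∀ r ∈ (L j).colorR (γ j), r • x ≠ x → κ j (r • x) ≠ κ j x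
  color_lt : ∀ j x, κ j x < 2 ^ (L j).n

namespace MarkerSystem

variable {Γ : Type u} [Group Γ] [DecidableEq Γ] {γ : ℕ → Γ} {L : ℕ → Level Γ}
  {X : Type*} [MulAction Γ X] (m : MarkerSystem γ L X)

/-- The points that are reserved before level `j`. -/
def U (j : ℕ) : Set X := {x | ∃ i < j, ∃ a ∈ (L i).K, a⁻¹ • x ∈ m.M i}

/-- The points where a `1` is written at level `j`. -/
def ones (j : ℕ) : Set X := {x | x ∉ m.U j ∧ ∃ a ∈ (L j).T, ∃ l < 8 * (L j).n,
  (a * (L j).t l)⁻¹ • x ∈ m.M j ∧ codeBit (m.κ j ((a * (L j).t l)⁻¹ • x)) l}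

variable {m}

theorem smul_mem_U {i j : ℕ} (hij : i < j) {a : Γ} (ha : a ∈ (L i).K) {y : X} (hy : y ∈ m.M i) :
    a • y ∈ m.U j := ⟨i, hij, a, ha, by rwa [inv_smul_smul]⟩

theorem U_succ {j : ℕ} {x : X} (hx : x ∉ m.U j) (hx' : x ∈ m.U (j + 1)) :
    ∃ a ∈ (L j).K, ∃ y ∈ m.M j, x = a • y := by
  obtain ⟨i, hi, a, ha, hy⟩ := hx'
  obtain rfl | hlt : i = j ∨ i < j := by omega
  · exact ⟨a, ha, _, hy, by rw [smul_inv_smul]⟩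
  · exact absurd ⟨i, hlt, a, ha, hy⟩ hx

theorem exists_of_mem_ones {j : ℕ} {x : X} (hx : x ∈ m.ones j) : ∃ y ∈ m.M j, ∃ a ∈ (L j).T,
    ∃ l < 8 * (L j).n, x = (a * (L j).t l) • y ∧ codeBit (m.κ j y) l := by
  obtain ⟨-, a, ha, l, hl, hy, hc⟩ := hx
  exact ⟨_, hy, a, ha, l, hl, by rw [smul_inv_smul], hc⟩

theorem eq_of_reach {j : ℕ} {y y' : X} (hy : y ∈ m.M j) (hy' : y' ∈ m.M j) {r : Γ}
    (hr : r ∈ (L j).R) (e : y' = r • y) : y' = y := by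
  rw [e]
  exact m.separated j y hy r hr (e ▸ hy')

theorem inv_mul_mem_R {j : ℕ} {a b : Γ} (ha : a ∈ (L j).reach) (hb : b ∈ (L j).reach) :
    a⁻¹ * b ∈ (L j).R := Finset.mul_mem_mul (Finset.inv_mem_inv ha) hb

/-- Among the translates `T s_r x`, at most one meets the points reserved at level `j`. -/
theorem eq_of_smul_eq (h : IsLevelSeq γ L) (hfree : IsFreeAction Γ X) {j r r' : ℕ} (hr : r < 5)
    (hr' : r' < 5) {a a' b b' : Γ} (ha : a ∈ (L j).T) (ha' : a' ∈ (L j).T) (hb : b ∈ (L j).K)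
    (hb' : b' ∈ (L j).K) {x y y' : X} (hy : y ∈ m.M j) (hy' : y' ∈ m.M j)
    (e : (a * (L j).s r) • x = b • y) (e' : (a' * (L j).s r') • x = b' • y') : r = r' := by
  have hmem : ∀ {a b : Γ} {r : ℕ}, r < 5 → a ∈ (L j).T → b ∈ (L j).K →
      (a * (L j).s r)⁻¹ * b ∈ (L j).reach := fun hr ha hb =>
    Finset.mem_union_left _ (Finset.mem_union_left _ (Finset.mul_mem_mul (Finset.inv_mem_inv
      (Finset.mul_mem_mul ha (Finset.mem_image.2 ⟨_, Finset.mem_range.2 hr, rfl⟩))) hb))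
  have hyy : y' = y := by
    refine eq_of_reach hy hy' (inv_mul_mem_R (hmem hr' ha' hb') (hmem hr ha hb)) ?_
    rw [mul_smul, mul_smul _ b, ← e, inv_smul_smul, mul_inv_rev, inv_inv, mul_smul, e',
      inv_smul_smul]
  subst hyy
  have hx : a * (L j).s r = b * b'⁻¹ * (a' * (L j).s r') := by
    refine hfree.eq_of_smul_eq (x := x) ?_
    rw [e, mul_smul, e', smul_smul, inv_mul_cancel_right]
  exact (h.good j).s_generic.spread ha ha' (Finset.mem_union_left _ (Finset.mem_union_right _
    (Finset.mul_mem_mul hb (Finset.inv_mem_inv hb')))) hx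

/-- The set `T` of level `j` contains a position that is not reserved around two given points
and whose translate leaves `T`. -/
theorem exists_mem_T (h : IsLevelSeq γ L) (hfree : IsFreeAction Γ X) (j : ℕ) {β : Γ} (hβ : β ≠ 1)
    (x : X) : ∃ a ∈ (L j).T, a • x ∉ m.U j ∧ (a * β) • x ∉ m.U j ∧ a * β ∉ (L j).T := by
  induction j generalizing β x with
  | zero =>
    rw [h.T_zero]
    have hU : ∀ z : X, z ∉ m.U 0 := by
      rintro z ⟨i, hi, -⟩
      omega
    exact ⟨1, by simp, hU _, hU _, by simpa using hβ⟩
  | succ j ih =>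
    -- The induction hypothesis is applied at `s r • x`, where `β` acts as its conjugate by `s r`.
    have hr : ∀ r : ℕ, ∃ a ∈ (L j).T, (a * (L j).s r) • x ∉ m.U j ∧
        (a * (L j).s r) • β • x ∉ m.U j ∧ a * ((L j).s r * β * ((L j).s r)⁻¹) ∉ (L j).T := by
      intro r
      obtain ⟨a, ha, h1, h2, h3⟩ := ih (β := (L j).s r * β * ((L j).s r)⁻¹)
        (by simpa using hβ) ((L j).s r • x)
      refine ⟨a, ha, by rwa [mul_smul], ?_, h3⟩
      convert h2 using 2
      rw [smul_smul, smul_smul]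
      congr 1
      group
    choose a ha h1 h2 h3 using hr
    have few : ∀ z : X, (∀ r, (a r * (L j).s r) • z ∉ m.U j) → ∀ s : Finset ℕ,
        (∀ r ∈ s, r < 5 ∧ (a r * (L j).s r) • z ∈ m.U (j + 1)) → s.card ≤ 1 := by
      intro z hz s hs
      rw [Finset.card_le_one]
      intro r hr r' hr'
      obtain ⟨b, hb, y, hy, e⟩ := U_succ (hz r) (hs r hr).2
      obtain ⟨b', hb', y', hy', e'⟩ := U_succ (hz r') (hs r' hr').2
      exact eq_of_smul_eq h hfree (hs r hr).1 (hs r' hr').1 (ha r) (ha r') hb hb' hy hy' e e'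
    -- Newly reserved points exclude at most one `r` at `x` and one at `β • x`. Returning to the
    -- enlarged `T` means meeting another translate, as `h3` excludes the same one; by genericity
    -- this happens for at most two `r`.
    obtain ⟨r, hr5, k1, k2, k3⟩ := exists_not_of_few (N := 5) (c₁ := 1) (c₂ := 1) (c₃ := 2)
      (by norm_num) (fun r => (a r * (L j).s r) • x ∈ m.U (j + 1))
      (fun r => (a r * (L j).s r) • β • x ∈ m.U (j + 1))
      (fun r => a r * (L j).s r * β ∈ (L (j + 1)).T) (few x h1) (few (β • x) h2) (by
        intro s hs
        refine card_le_two_of_forall ?_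
        have hmeets : ∀ r ∈ s, MeetsOther (L j).T (L j).s β r := by
          intro r hr
          have := (hs r hr).2
          rw [h.T_succ] at this
          obtain ⟨c, hc, z, hz, e⟩ := Finset.mem_mul.1 this
          obtain ⟨r', -, rfl⟩ := Finset.mem_image.1 hz
          refine ⟨r', ?_, a r, ha r, c, hc, e.symm⟩
          rintro rfl
          refine h3 r' ?_
          have : a r' * ((L j).s r' * β * ((L j).s r')⁻¹) = c := by
            rw [← mul_assoc, ← mul_assoc, ← e]; group
          rwa [this]
        intro r₁ hr₁ r₂ hr₂ r₃ hr₃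
        exact (h.good j).s_generic.meets (hmeets _ hr₁) (hmeets _ hr₂) (hmeets _ hr₃))
    refine ⟨a r * (L j).s r, ?_, k1, by rwa [mul_smul], k3⟩
    rw [h.T_succ]
    exact Finset.mul_mem_mul (ha r) (Finset.mem_image.2 ⟨r, Finset.mem_range.2 hr5, rfl⟩)

/-- Later levels write into at most one of the positions `a_l t_l` around a point. -/
theorem eq_of_mem_ones (h : IsLevelSeq γ L) (hfree : IsFreeAction Γ X) {j i i' l l' : ℕ}
    (hi : j < i) (hii : i ≤ i') (hl : l < 8 * (L j).n) (hl' : l' < 8 * (L j).n) {a a' : Γ}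
    (ha : a ∈ (L j).T) (ha' : a' ∈ (L j).T) {x : X} (h1 : (a * (L j).t l) • x ∈ m.ones i)
    (h2 : (a' * (L j).t l') • x ∈ m.ones i') : l = l' := by
  obtain ⟨y, hy, b, hb, k, hk, e, -⟩ := exists_of_mem_ones h1
  obtain ⟨y', hy', b', hb', k', hk', e', -⟩ := exists_of_mem_ones h2
  have hP := h.mul_inv_mem_P hi (IsLevelSeq.mem_Q ha' hl') (IsLevelSeq.mem_Q ha hl)
  have hP' := h.mul_inv_mem_P hi (IsLevelSeq.mem_Q ha hl) (IsLevelSeq.mem_Q ha' hl')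
  have hQ := IsLevelSeq.mem_Q hb hk
  have hshift : (a' * (L j).t l') • x =
      (a' * (L j).t l' * (a * (L j).t l)⁻¹ * (b * (L i).t k)) • y := by
    rw [mul_smul _ (b * _), ← e, smul_smul, inv_mul_cancel_right]
  have hK : a' * (L j).t l' * (a * (L j).t l)⁻¹ * (b * (L i).t k) ∈ (L i).K :=
    Finset.mul_mem_mul hP hQ
  -- The second position lies in `K • y`, so it is reserved for levels after `i`. Hence both bits
  -- belong to level `i`, then to the same marker by separation, and to the same bit index by
  -- spreading.
  obtain hlt | rfl := hii.lt_or_eq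
  · exact absurd (hshift ▸ smul_mem_U hlt hK hy) h2.1
  have hyy : y' = y := by
    refine eq_of_reach hy hy' (inv_mul_mem_R (a := b' * (L i).t k') (Finset.mem_union_right _
      (h.Q_subset_K i (IsLevelSeq.mem_Q hb' hk'))) (Finset.mem_union_right _ hK)) ?_
    rw [mul_smul, ← hshift, e', inv_smul_smul]
  subst hyy
  have hkk : k = k' := by
    refine (h.good i).t_generic.spread hb hb' (Finset.mem_union_left _ hP') ?_
    refine hfree.eq_of_smul_eq (x := y') ?_
    rw [mul_smul _ (b' * _), ← e', smul_smul, inv_mul_cancel_right, e]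
  subst hkk
  have hy1 : y' = ((b * (L i).t k)⁻¹ * (a * (L j).t l)) • x := by
    rw [mul_smul, e, inv_smul_smul]
  set ζ := (b * (L i).t k)⁻¹ * (a * (L j).t l) with hζ
  have e1 : a * (L j).t l * (ζ⁻¹ * ((L i).t k)⁻¹) = b := by rw [hζ]; group
  have e2 : a' * (L j).t l' * (ζ⁻¹ * ((L i).t k)⁻¹) = b' := by
    rw [hy1, smul_smul] at e'
    rw [hfree.eq_of_smul_eq e']; group
  have hb2 : a' * (L j).t l' * (ζ⁻¹ * ((L i).t k)⁻¹) ∈ (L i).T := by rwa [e2]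
  exact h.eq_of_mul_mem_T hi hl hl' ha ha' (e1 ▸ hb) hb2

/-- Conjugates of `γ j` are detected at the markers of level `j`. -/
theorem exists_mem_Q (h : IsLevelSeq γ L) (hfree : IsFreeAction Γ X) (j : ℕ) {y : X}
    (hy : y ∈ m.M j) {β : Γ} (hβ : β ∈ (L j).conj (γ j)) (hβ1 : β ≠ 1) :
    ∃ q ∈ (L j).Q, q • y ∈ m.ones j ∧ ∀ i, (q * β) • y ∉ m.ones i := by
  -- For every bit, a copy is found that no earlier level can disturb, neither at the position
  -- itself nor at its `β`-translate.
  have hstar : ∀ l : ℕ, ∃ a ∈ (L j).T, (a * (L j).t l) • y ∉ m.U j ∧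
      (a * (L j).t l) • β • y ∉ m.U j ∧ a * ((L j).t l * β * ((L j).t l)⁻¹) ∉ (L j).T := by
    intro l
    obtain ⟨a, ha, h1, h2, h3⟩ := exists_mem_T (m := m) h hfree j
      (β := (L j).t l * β * ((L j).t l)⁻¹) (by simpa using hβ1) ((L j).t l • y)
    refine ⟨a, ha, by rwa [mul_smul], ?_, h3⟩
    convert h2 using 2
    rw [smul_smul, smul_smul]
    congr 1
    group
  choose a ha h1 h2 h3 using hstar
  set A : ℕ → Γ := fun l => a l * (L j).t l with hA
  have hAQ : ∀ {l}, l < 8 * (L j).n → A l ∈ (L j).Q := fun hl => IsLevelSeq.mem_Q (ha _) hl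
  have huniq : ∀ {l l' : ℕ} {q q' : Γ} {z z' : X}, l < 8 * (L j).n → l' < 8 * (L j).n →
      q ∈ (L j).Q → q' ∈ (L j).Q → z ∈ m.M j → z' ∈ m.M j → A l • β • y = q • z →
      A l' • β • y = q' • z' → z' = z := by
    intro l l' q q' z z' hl hl' hq hq' hz hz' e e'
    refine eq_of_reach hz hz' (inv_mul_mem_R (a := (A l')⁻¹ * q') (b := (A l)⁻¹ * q) ?_ ?_) ?_
    · exact Finset.mem_union_left _ (Finset.mem_union_right _
        (Finset.mul_mem_mul (Finset.inv_mem_inv (hAQ hl')) hq'))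
    · exact Finset.mem_union_left _ (Finset.mem_union_right _
        (Finset.mul_mem_mul (Finset.inv_mem_inv (hAQ hl)) hq))
    · rw [mul_smul, mul_smul _ q, ← e, inv_smul_smul, mul_inv_rev, inv_inv, mul_smul, e',
        inv_smul_smul]
  -- By `huniq` at most one marker `z` is met by the translated positions. If it is not `y`, its
  -- color differs, so four copies of some code bit are set for `y` but not for `z`.
  obtain ⟨l₀, hl₀⟩ : ∃ l₀, ∀ r < 4, l₀ + r < 8 * (L j).n ∧ codeBit (m.κ j y) (l₀ + r) ∧
      ∀ z ∈ m.M j, z ≠ y → ∀ b ∈ (L j).T,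
        A (l₀ + r) • β • y = (b * (L j).t (l₀ + r)) • z → ¬ codeBit (m.κ j z) (l₀ + r) := by
    by_cases hz : ∃ z ∈ m.M j, z ≠ y ∧ ∃ l < 8 * (L j).n, ∃ q ∈ (L j).Q, A l • β • y = q • z
    · obtain ⟨z, hz, hzy, l, hl, q, hq, e⟩ := hz
      have hzr : z = (q⁻¹ * A l * β) • y := by
        rw [mul_smul, mul_smul, e, inv_smul_smul]
      have hmem : q⁻¹ * A l * β ∈ (L j).colorR (γ j) := Finset.mem_union_left _
        (Finset.mul_mem_mul (Finset.mul_mem_mul (Finset.inv_mem_inv hq) (hAQ hl)) hβ)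
      have hne : m.κ j z ≠ m.κ j y := by
        rw [hzr]
        exact m.color_ne j y _ hmem (hzr ▸ hzy)
      obtain ⟨i, hi, hbit⟩ := exists_testBit_ne (m.color_lt j y) (m.color_lt j z) hne
      obtain ⟨l₀, hl₀⟩ := exists_codeBit (m.κ j y) hi
      refine ⟨l₀, fun r hr => ⟨(hl₀ r hr).1, (hl₀ r hr).2.1, fun z' hz' hzy' b hb e' => ?_⟩⟩
      have : z' = z := huniq hl (hl₀ r hr).1 hq (IsLevelSeq.mem_Q hb (hl₀ r hr).1) hz hz' e e'
      subst this
      exact (hl₀ r hr).2.2 _ hbit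
    · obtain ⟨l₀, hl₀⟩ := exists_codeBit (m.κ j y) (h.good j).one_le_n
      refine ⟨l₀, fun r hr => ⟨(hl₀ r hr).1, (hl₀ r hr).2.1, fun z' hz' hzy' b hb e' => ?_⟩⟩
      exact absurd ⟨z', hz', hzy', _, (hl₀ r hr).1, _, IsLevelSeq.mem_Q hb (hl₀ r hr).1, e'⟩ hz
  -- Of the four copies, later levels spoil at most one and other bit indices of level `j` at most
  -- two; the first predicate is a filler.
  obtain ⟨r, hr, -, k1, k2⟩ := exists_not_of_few (N := 4) (c₁ := 0) (c₂ := 1) (c₃ := 2)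
    (by norm_num) (fun _ => False) (fun r => ∃ i > j, A (l₀ + r) • β • y ∈ m.ones i)
    (fun r => ∃ z ∈ m.M j, ∃ l ≠ l₀ + r, l < 8 * (L j).n ∧ ∃ b ∈ (L j).T,
      A (l₀ + r) • β • y = (b * (L j).t l) • z)
    (by
      intro s hs
      rw [Nat.le_zero, Finset.card_eq_zero, Finset.eq_empty_iff_forall_notMem]
      exact fun x hx => (hs x hx).2)
    (by
      intro s hs
      rw [Finset.card_le_one]
      intro r hr r' hr'
      obtain ⟨hr4, i, hi, ho⟩ := hs r hr
      obtain ⟨hr4', i', hi', ho'⟩ := hs r' hr'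
      rcases le_total i i' with hii | hii
      · have := eq_of_mem_ones h hfree hi hii (hl₀ r hr4).1 (hl₀ r' hr4').1 (ha _) (ha _) ho ho'
        omega
      · have := eq_of_mem_ones h hfree hi' hii (hl₀ r' hr4').1 (hl₀ r hr4).1 (ha _) (ha _) ho' ho
        omega)
    (by
      intro s hs
      refine card_le_two_of_forall ?_
      rcases s.eq_empty_or_nonempty with rfl | ⟨r₀, hr₀⟩
      · simp
      obtain ⟨hr4, z, hz, l, -, hl, b, hb, e⟩ := hs r₀ hr₀
      have hzr : z = ((b * (L j).t l)⁻¹ * A (l₀ + r₀) * β) • y := by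
        rw [mul_smul, mul_smul, e, inv_smul_smul]
      set ζ := (b * (L j).t l)⁻¹ * A (l₀ + r₀) * β
      have hmeets : ∀ r ∈ s, MeetsOther (L j).T (L j).t (β * ζ⁻¹) (l₀ + r) := by
        intro r hr
        obtain ⟨hr4', z', hz', l', hne, hl', b', hb', e'⟩ := hs r hr
        have : z' = z := huniq (hl₀ _ hr4).1 (hl₀ _ hr4').1 (IsLevelSeq.mem_Q hb hl)
          (IsLevelSeq.mem_Q hb' hl') hz hz' e e'
        rw [this, hzr, smul_smul, smul_smul] at e'
        refine ⟨l', hne, a (l₀ + r), ha (l₀ + r), b', hb', ?_⟩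
        have := hfree.eq_of_smul_eq e'
        calc A (l₀ + r) * (β * ζ⁻¹) = A (l₀ + r) * β * ζ⁻¹ := by group
          _ = b' * (L j).t l' := by rw [this]; group
      intro r₁ hr₁ r₂ hr₂ r₃ hr₃
      have := (h.good j).t_generic.meets (hmeets _ hr₁) (hmeets _ hr₂) (hmeets _ hr₃)
      omega)
  obtain ⟨hl, hc, hother⟩ := hl₀ r hr
  refine ⟨A (l₀ + r), hAQ hl, ⟨h1 (l₀ + r), a (l₀ + r), ha (l₀ + r), l₀ + r, hl, ?_, ?_⟩, fun i => ?_⟩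
  · rwa [inv_smul_smul]
  · rwa [inv_smul_smul]
  rw [mul_smul]
  -- Earlier levels write only at reserved points. At level `j` itself, the same bit index at `y`
  -- contradicts `h3`, at another marker the choice of `l₀`, and a different index `k2`.
  rcases lt_trichotomy i j with hi | rfl | hi
  · intro ho
    obtain ⟨z, hz, b, hb, l, hl, e, -⟩ := exists_of_mem_ones ho
    refine h2 (l₀ + r) ?_
    change A (l₀ + r) • β • y ∈ _
    rw [e]
    exact smul_mem_U hi (h.Q_subset_K i (IsLevelSeq.mem_Q hb hl)) hz
  · intro ho
    obtain ⟨z, hz, b, hb, l, hl', e, hcz⟩ := exists_of_mem_ones ho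
    by_cases hll : l = l₀ + r
    · subst hll
      by_cases hzy : z = y
      · subst hzy
        rw [smul_smul] at e
        have e1 := hfree.eq_of_smul_eq e
        refine h3 (l₀ + r) ?_
        have : a (l₀ + r) * ((L i).t (l₀ + r) * β * ((L i).t (l₀ + r))⁻¹) = b := by
          calc _ = A (l₀ + r) * β * ((L i).t (l₀ + r))⁻¹ := by simp only [hA]; group
            _ = b := by rw [e1]; group
        rwa [this]
      · exact hother z hz hzy b hb e hcz
    · exact k2 ⟨z, hz, l, hll, hl', b, hb, e⟩
  · exact fun ho => k1 ⟨i, hi, ho⟩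

end MarkerSystem

/-! ### From the free part of the shift to all free zero-dimensional spaces -/

theorem Level.inv_mem_R {Γ : Type u} [Group Γ] [DecidableEq Γ] (L : Level Γ) {r : Γ}
    (hr : r ∈ L.R) : r⁻¹ ∈ L.R := by
  have h : L.R⁻¹ = L.R := by rw [Level.R, mul_inv_rev, inv_inv]
  rw [← h]
  exact Finset.inv_mem_inv hr

theorem Level.inv_mem_colorR {Γ : Type u} [Group Γ] [DecidableEq Γ] (L : Level Γ) {γ r : Γ}
    (hr : r ∈ L.colorR γ) : r⁻¹ ∈ L.colorR γ := by
  rcases Finset.mem_union.1 hr with h | h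
  · exact Finset.mem_union_right _ (Finset.inv_mem_inv h)
  · exact Finset.mem_union_left _ (Finset.mem_inv'.1 h)

section Detection

variable {Γ : Type u} [Group Γ] [DecidableEq Γ] {γ : ℕ → Γ} {L : ℕ → Level Γ} {X : Type*}
  [TopologicalSpace X] [MulAction Γ X] [ContinuousConstSMul Γ X]

/-- The color class `0` of a greedy coloring is a maximal independent set, hence separated and
syndetic. A second greedy coloring supplies the marker colors, few enough to be coded by `n` bits.
-/
theorem exists_markerSystem [SecondCountableTopology X] [T2Space X] (hX : IsZeroDimensional X)
    (hfree : IsFreeAction Γ X) (h : IsLevelSeq γ L) :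
    ∃ m : MarkerSystem γ L X, (∀ j, IsClopen (m.M j)) ∧ ∀ j, Continuous (m.κ j) := by
  have hinv : ∀ {R : Finset Γ}, (∀ r ∈ R, r⁻¹ ∈ R) → ∀ r ∈ R.erase 1, r⁻¹ ∈ R.erase 1 := by
    intro R hR r hr
    rw [Finset.mem_erase] at hr ⊢
    exact ⟨inv_ne_one.2 hr.1, hR r hr.2⟩
  choose c hc hcne _ hc0 using fun j => exists_continuous_coloring hX hfree ((L j).R.erase 1)
    (by simp) (hinv fun r hr => (L j).inv_mem_R hr)
  choose d hd hdne hdle _ using fun j => exists_continuous_coloring hX hfree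
    (((L j).colorR (γ j)).erase 1) (by simp) (hinv fun r hr => (L j).inv_mem_colorR hr)
  refine ⟨⟨fun j => c j ⁻¹' {0}, d, ?_, ?_, ?_, ?_⟩,
    fun j => (isClopen_discrete {0}).preimage (hc j), hd⟩
  · intro j y hy r hr hry
    by_contra hne
    have hr1 : r ≠ 1 := by
      rintro rfl
      exact hne (one_smul _ _)
    exact hcne j y r (Finset.mem_erase.2 ⟨hr1, hr⟩) (hry.trans hy.symm)
  · intro j x
    by_cases hx : c j x = 0
    · exact ⟨1, Finset.mem_insert_self _ _, by rwa [one_smul]⟩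
    · obtain ⟨r, hr, hr0⟩ := hc0 j x hx
      exact ⟨r, Finset.mem_insert_of_mem (Finset.mem_of_mem_erase hr), hr0⟩
  · intro j x r hr hne
    have hr1 : r ≠ 1 := by
      rintro rfl
      exact hne (one_smul _ _)
    exact hdne j x r (Finset.mem_erase.2 ⟨hr1, hr⟩)
  · exact fun j x => (hdle j x).trans_lt
      ((Finset.card_erase_le).trans_lt (h.good j).card_lt)

namespace MarkerSystem

variable {m : MarkerSystem γ L X}

theorem isClopen_U (hM : ∀ j, IsClopen (m.M j)) (j : ℕ) : IsClopen (m.U j) := by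
  have : m.U j = ⋃ i ∈ Finset.range j, ⋃ a ∈ (L i).K, (fun x => a⁻¹ • x) ⁻¹' m.M i := by
    ext x
    simp [U]
  rw [this]
  exact isClopen_biUnion_finset fun i _ => isClopen_biUnion_finset fun a _ =>
    (hM i).preimage (continuous_const_smul _)

theorem isClopen_ones (hM : ∀ j, IsClopen (m.M j)) (hκ : ∀ j, Continuous (m.κ j)) (j : ℕ) :
    IsClopen (m.ones j) := by
  have : m.ones j = (m.U j)ᶜ ∩ ⋃ a ∈ (L j).T, ⋃ l ∈ Finset.range (8 * (L j).n),
      (fun x => (a * (L j).t l)⁻¹ • x) ⁻¹' (m.M j ∩ m.κ j ⁻¹' {c | codeBit c l}) := by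
    ext x
    simp only [ones, Set.mem_ofPred_eq, Set.mem_inter_iff, Set.mem_compl_iff, Set.mem_iUnion,
      Set.mem_preimage, Finset.mem_range, exists_prop]
  rw [this]
  exact (isClopen_U hM j).compl.inter (isClopen_biUnion_finset fun a _ =>
    isClopen_biUnion_finset fun l _ => ((hM j).inter ((isClopen_discrete _).preimage (hκ j))).preimage
      (continuous_const_smul _))

end MarkerSystem

/-- The window in which the failure of `γ` to be a period is detected. -/
def Level.window (L : Level Γ) : Finset Γ := L.Q * insert 1 L.R

/-- Free zero-dimensional spaces have continuous `2`-colorings without any of finitely many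
periods. -/
theorem exists_continuous_detecting [SecondCountableTopology X] [T2Space X]
    (hX : IsZeroDimensional X) (hfree : IsFreeAction Γ X) (h : IsLevelSeq γ L)
    (hγ : ∀ j, γ j ≠ 1) (J : ℕ) : ∃ g : X → Fin 2, Continuous g ∧
      ∀ j < J, ∀ x, ∃ w ∈ (L j).window, g (w • x) ≠ g ((w * γ j) • x) := by
  classical
  obtain ⟨m, hM, hκ⟩ := exists_markerSystem hX hfree h
  have hclopen : IsClopen {x | ∃ i < J, x ∈ m.ones i} := by
    have : {x | ∃ i < J, x ∈ m.ones i} = ⋃ i ∈ Finset.range J, m.ones i := by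
      ext x
      simp
    rw [this]
    exact isClopen_biUnion_finset fun i _ => MarkerSystem.isClopen_ones hM hκ i
  -- Finitely many levels keep the set clopen. The windows depend neither on `J` nor on `X`, since a
  -- bit of level `j` is detected whatever all the other levels write.
  refine ⟨fun x => if ∃ i < J, x ∈ m.ones i then 1 else 0,
    continuous_const.if (fun x hx => ?_) continuous_const, fun j hj x => ?_⟩
  · rw [hclopen.frontier_eq] at hx
    exact hx.elim
  · obtain ⟨δ, hδ, hy⟩ := m.syndetic j x
    obtain ⟨q, hq, h1, h2⟩ := MarkerSystem.exists_mem_Q h hfree j hy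
      (β := δ * γ j * δ⁻¹) (Finset.mem_image.2 ⟨δ, hδ, rfl⟩) (by simpa using hγ j)
    refine ⟨q * δ, Finset.mul_mem_mul hq hδ, ?_⟩
    have e : (q * δ * γ j) • x = (q * (δ * γ j * δ⁻¹)) • δ • x := by
      rw [smul_smul]
      congr 1
      group
    have h1' : ∃ i < J, (q * δ) • x ∈ m.ones i := ⟨j, hj, by rwa [mul_smul]⟩
    have h2' : ¬ ∃ i < J, (q * δ * γ j) • x ∈ m.ones i := by
      rintro ⟨i, -, hi⟩
      exact h2 i (e ▸ hi)
    beta_reduce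
    rw [if_pos h1', if_neg h2']
    exact one_ne_zero

end Detection

/-! ### Closed sets of detected aperiodicity in the shift and the compactness argument -/

namespace Shift

variable {Γ : Type u} {k : ℕ}

instance : CompactSpace (Shift Γ k) := inferInstanceAs (CompactSpace (Γ → Fin k))

instance : T2Space (Shift Γ k) := inferInstanceAs (T2Space (Γ → Fin k))

instance : TotallyDisconnectedSpace (Shift Γ k) :=
  inferInstanceAs (TotallyDisconnectedSpace (Γ → Fin k))

instance [Countable Γ] : SecondCountableTopology (Shift Γ k) :=
  inferInstanceAs (SecondCountableTopology (Γ → Fin k))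

theorem continuous_eval (δ : Γ) : Continuous fun z : Shift Γ k => z δ :=
  continuous_apply (A := fun _ : Γ => Fin k) δ

variable [Group Γ]

theorem smul_apply (γ δ : Γ) (z : Shift Γ k) : (γ • z) δ = z (δ * γ) := rfl

instance : ContinuousConstSMul Γ (Shift Γ k) where
  continuous_const_smul γ := continuous_pi fun δ => continuous_eval (δ * γ)

/-- The points without the periods `γ j`, `j < J`, as witnessed in the windows `W j`. -/
def detecting (γ : ℕ → Γ) (W : ℕ → Finset Γ) (J : ℕ) : Set (Shift Γ k) :=
  {z | ∀ j < J, ∀ δ, ∃ w ∈ W j, z (w * δ) ≠ z (w * γ j * δ)}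

variable {γ : ℕ → Γ} {W : ℕ → Finset Γ}

theorem isClosed_detecting (J : ℕ) : IsClosed (detecting (k := k) γ W J) := by
  have : detecting (k := k) γ W J = ⋂ (j : ℕ) (_ : j < J) (δ : Γ), ⋃ w ∈ W j,
      (fun z : Shift Γ k => (z (w * δ), z (w * γ j * δ))) ⁻¹' {y | y.1 ≠ y.2} := by
    ext z
    simp [detecting]
  rw [this]
  refine isClosed_iInter fun j => isClosed_iInter fun _ => isClosed_iInter fun δ =>
    isClosed_biUnion_finset fun w _ => ?_
  exact (isClosed_discrete _).preimage ((continuous_eval _).prodMk (continuous_eval _))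

theorem detecting_antitone : Antitone (detecting (k := k) γ W) :=
  fun _ _ hJ _ hz j hj => hz j (hj.trans_le hJ)

theorem smul_mem_detecting {J : ℕ} {z : Shift Γ k} (hz : z ∈ detecting γ W J) (η : Γ) :
    η • z ∈ detecting γ W J := by
  intro j hj δ
  obtain ⟨w, hw, hne⟩ := hz j hj (δ * η)
  refine ⟨w, hw, ?_⟩
  rwa [smul_apply, smul_apply, mul_assoc, mul_assoc _ δ]

theorem mem_freePart_of_detecting (hγ : ∀ η : Γ, η ≠ 1 → ∃ j, γ j = η) {z : Shift Γ k}
    (hz : ∀ J, z ∈ detecting γ W J) : z ∈ freePart Γ (Shift Γ k) := by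
  change MulAction.stabilizer Γ z = ⊥
  rw [Subgroup.eq_bot_iff_forall]
  intro η hη
  by_contra h1
  obtain ⟨j, rfl⟩ := hγ η h1
  obtain ⟨w, -, hne⟩ := hz (j + 1) j (Nat.lt_succ_self j) 1
  rw [mul_one, mul_one] at hne
  exact hne (congrArg (fun y : Shift Γ k => y w) (MulAction.mem_stabilizer_iff.1 hη)).symm

end Shift

theorem IsZeroDimensional.of_isInducing {X Y : Type*} [TopologicalSpace X] [TopologicalSpace Y]
    {e : X → Y} (he : Topology.IsInducing e) (hY : IsZeroDimensional Y) : IsZeroDimensional X := by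
  refine TopologicalSpace.isTopologicalBasis_of_isOpen_of_nhds (fun s hs => hs.isOpen) ?_
  intro x U hx hU
  obtain ⟨V, hV, rfl⟩ := he.isOpen_iff.1 hU
  obtain ⟨s, hs, hxs, hsV⟩ := hY.exists_subset_of_mem_open hx hV
  exact ⟨e ⁻¹' s, IsClopen.preimage hs he.continuous, hxs, Set.preimage_mono hsV⟩

section FreePart

variable {Γ : Type u} [Group Γ] {k : ℕ}

theorem isZeroDimensional_freePart : IsZeroDimensional (freePart Γ (Shift Γ k)) :=
  IsZeroDimensional.of_isInducing Topology.IsInducing.subtypeVal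
    (isTopologicalBasis_isClopen (X := Shift Γ k))

theorem isFreeAction_freePart (X : Type*) [MulAction Γ X] : IsFreeAction Γ (freePart Γ X) := by
  intro x
  have hx : MulAction.stabilizer Γ (x : X) = ⊥ := x.2
  rw [Subgroup.eq_bot_iff_forall]
  intro η hη
  rw [← Subgroup.mem_bot, ← hx]
  exact congrArg Subtype.val (MulAction.mem_stabilizer_iff.1 hη)

instance : ContinuousConstSMul Γ (freePart Γ (Shift Γ k)) where
  continuous_const_smul γ := by
    have h : Continuous fun z : Shift Γ k => γ • z := continuous_const_smul γ
    exact (h.comp continuous_subtype_val).subtype_mk _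

instance [Countable Γ] : SecondCountableTopology (freePart Γ (Shift Γ k)) :=
  Topology.IsInducing.subtypeVal.secondCountableTopology

end FreePart

/-- Continuous colorings of the free part of the shift can be pulled back to all free
zero-dimensional spaces. -/
theorem hasContinuousAvoidingColoring_of_freePart {Γ : Type u} [Group Γ] [Countable Γ] [Infinite Γ]
    {k : ℕ} (hk : 1 ≤ k) {P : Set (Pattern Γ k)} (hP : P.Finite)
    (h : HasContinuousAvoidingColoring P (freePart Γ (Shift Γ 2))) (X : Type*) [TopologicalSpace X]
    [SecondCountableTopology X] [T2Space X] [MulAction Γ X] [ContinuousConstSMul Γ X]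
    (hX : IsZeroDimensional X) (hfree : IsFreeAction Γ X) : HasContinuousAvoidingColoring P X := by
  classical
  obtain ⟨f, hf, hfP⟩ := h
  obtain ⟨η, hη⟩ := exists_ne (1 : Γ)
  have : Nonempty {γ : Γ // γ ≠ 1} := ⟨⟨η, hη⟩⟩
  obtain ⟨e, he⟩ := exists_surjective_nat {γ : Γ // γ ≠ 1}
  obtain ⟨L, hL⟩ := exists_isLevelSeq fun j => (e j : Γ)
  let W : ℕ → Finset Γ := fun j => (L j).window
  let D : ℕ → Set (Shift Γ 2) := Shift.detecting (fun j => (e j : Γ)) W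
  have hDfree : ∀ z ∈ ⋂ J, D J, z ∈ freePart Γ (Shift Γ 2) := fun z hz =>
    Shift.mem_freePart_of_detecting (fun η hη => (he ⟨η, hη⟩).imp fun j hj => by rw [hj])
      (Set.mem_iInter.1 hz)
  let fZ : (⋂ J, D J : Set (Shift Γ 2)) → Fin k := fun z => f ⟨z, hDfree z z.2⟩
  have hfZ : Continuous fZ := hf.comp (continuous_subtype_val.subtype_mk _)
  have hclosed : IsClosed (⋂ J, D J) := isClosed_iInter Shift.isClosed_detecting
  have : CompactSpace (⋂ J, D J : Set (Shift Γ 2)) := isCompact_iff_compactSpace.1 hclosed.isCompact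
  have hind : Topology.IsInducing fun (z : (⋂ J, D J : Set (Shift Γ 2))) (i : Γ) => z.1 i := ⟨rfl⟩
  -- The coloring of the compact intersection reads finitely many coordinates, so it extends to a
  -- continuous `φ` on the whole shift; unseen tuples get the color `0`.
  obtain ⟨I, hI⟩ := exists_finset_determining hind hfZ
  let F : (I → Fin 2) → Fin k := fun u =>
    if h : ∃ z : (⋂ J, D J : Set (Shift Γ 2)), ∀ i : I, z.1 i = u i then fZ h.choose else ⟨0, hk⟩
  let φ : Shift Γ 2 → Fin k := fun z => F fun i => z i
  have hF : Continuous F := continuous_of_discreteTopology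
  have hφ : Continuous φ := hF.comp
    (continuous_pi fun i : I => Shift.continuous_eval (i : Γ))
  have hφZ : ∀ z (hz : z ∈ ⋂ J, D J), φ z = fZ ⟨z, hz⟩ := by
    intro z hz
    have hex : ∃ z' : (⋂ J, D J : Set (Shift Γ 2)), ∀ i : I, z'.1 i = z i := ⟨⟨z, hz⟩, fun _ => rfl⟩
    refine (dif_pos hex).trans (hI _ _ fun i hi => ?_)
    exact hex.choose_spec ⟨i, hi⟩
  -- The points where `φ` fails form a closed set that misses the intersection of all `D J`, hence
  -- misses a single `D J`.
  let E : Set (Shift Γ 2) := ⋃ p ∈ P, ⋂ γ : p.dom, {z | φ ((γ : Γ) • z) = p.val γ}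
  have hE : IsClosed E := hP.isClosed_biUnion fun p _ => isClosed_iInter fun γ =>
    isClosed_eq (hφ.comp (continuous_const_smul _)) continuous_const
  have hED : E ∩ ⋂ J, D J = ∅ := by
    rw [Set.eq_empty_iff_forall_notMem]
    rintro z ⟨hzE, hz⟩
    obtain ⟨p, hp, hzp⟩ := Set.mem_iUnion₂.1 hzE
    refine hfP p hp ⟨⟨z, hDfree z hz⟩, fun γ => ?_⟩
    rw [← show φ ((γ : Γ) • z) = p.val γ from Set.mem_iInter.1 hzp γ]
    exact (hφZ _ (Set.mem_iInter.2 fun J =>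
      Shift.smul_mem_detecting (Set.mem_iInter.1 hz J) (γ : Γ))).symm
  obtain ⟨J, hJ⟩ := hE.isCompact.elim_directed_family_closed D
    Shift.isClosed_detecting hED Shift.detecting_antitone.directed_ge
  obtain ⟨g, hg, hgd⟩ := exists_continuous_detecting hX hfree hL (fun j => (e j).2) J
  let π : X → Shift Γ 2 := fun x δ => g (δ • x)
  have hπ : Continuous π := continuous_pi fun δ => hg.comp (continuous_const_smul δ)
  have hπs : ∀ (γ : Γ) (x : X), π (γ • x) = γ • π x := fun γ x => funext fun δ => by
    change g (δ • γ • x) = g ((δ * γ) • x)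
    rw [mul_smul]
  refine ⟨φ ∘ π, hφ.comp hπ, ?_⟩
  rintro p hp ⟨x, hx⟩
  have hxE : π x ∈ E := Set.mem_iUnion₂.2 ⟨p, hp, Set.mem_iInter.2 fun γ => by
    rw [Set.mem_ofPred_eq, ← hπs]
    exact hx γ⟩
  have hxD : π x ∈ D J := by
    intro j hj δ
    obtain ⟨w, hw, hne⟩ := hgd j hj (δ • x)
    exact ⟨w, hw, by rwa [smul_smul, smul_smul] at hne⟩
  exact (Set.eq_empty_iff_forall_notMem.1 hJ _ ⟨hxE, hxD⟩).elim

theorem ncard_pow_sq_le {Γ : Type u} [Group Γ] {B : Set Γ} (hB : B.Finite) {l m : ℕ}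
    (h : B.ncard ^ (2 * l) ≤ m) : (B ^ l).ncard ^ 2 ≤ m := by
  classical
  refine le_trans ?_ h
  rw [mul_comm, pow_mul]
  refine Nat.pow_le_pow_left ?_ 2
  lift B to Finset Γ using hB
  rw [← Finset.coe_pow, Set.ncard_coe_finset, Set.ncard_coe_finset]
  exact Finset.card_pow_le

/-- Continuous colorings of the color space yield local algorithms. -/
theorem exists_localAlgorithm_of_colorSpace {Γ : Type u} [Group Γ] [Countable Γ] {k : ℕ} (hk : 1 ≤ k)
    {S : Set Γ} (hS : S.Finite) {P : Set (Pattern Γ k)} (hP : P.Finite)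
    (hconn : ∀ p ∈ P, p.IsConnected S) (h : HasContinuousAvoidingColoring P (ColorSpace Γ)) :
    ∃ (A : LocalAlgorithm Γ k) (T : ℕ → ℕ),
      (fun n => (T n : ℝ)) =O[Filter.atTop] (fun n => (logStar n : ℝ)) ∧ A.Solves S P T := by
  obtain ⟨D, hD, f, hf⟩ := exists_tileGraph_of_colorSpace hS hP hconn h
  exact exists_localAlgorithm_of_tileGraph hk hD hf

end ContinuousLocal

/-! ### Assembly of the equivalences -/

open ContinuousLocal in
theorem theorem1p10 {Γ : Type u} [Group Γ] [Countable Γ] [Infinite Γ]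
    (k : ℕ) (hk : 1 ≤ k) (S : Set Γ) (hS : S.Finite)
    (P : Set (Pattern Γ k)) (hP : P.Finite) (hconn : ∀ p ∈ P, p.IsConnected S) :
    List.TFAE
      [ -- the free part of the Bernoulli shift `2^Γ`
        HasContinuousAvoidingColoring P (freePart Γ (Shift Γ 2)),
        -- all free zero-dimensional Polish `Γ`-spaces (`Γ` is discrete)
        ∀ (X : Type u) [TopologicalSpace X] [PolishSpace X] [MulAction Γ X]
          [ContinuousConstSMul Γ X], IsZeroDimensional X → IsFreeAction Γ X →
            HasContinuousAvoidingColoring P X,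
        -- deterministic `LOCAL` algorithms with `O(log* n)` rounds
        ∃ (A : LocalAlgorithm Γ k) (T : ℕ → ℕ),
          (fun n => (T n : ℝ)) =O[Filter.atTop] (fun n => (logStar n : ℝ)) ∧ A.Solves S P T ] ∧
    -- the two conditions on the family of finite graphs `H_{D i, m i}` with `D i = F i ^ log* (m i)`
    ∀ (F : ℕ → Set Γ) (m : ℕ → ℕ), (∀ i, (F i).Finite) → Monotone F → ⋃ i, F i = Set.univ →
      (∀ i, S ∪ S⁻¹ ∪ {1} ⊆ F i) → (∀ i, (F i).ncard ^ (2 * logStar (m i)) ≤ m i) →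
      ∀ hD : ∀ i, S ∪ S⁻¹ ∪ {1} ⊆ F i ^ logStar (m i),
        List.TFAE
          [ ∃ (A : LocalAlgorithm Γ k) (T : ℕ → ℕ),
              (fun n => (T n : ℝ)) =O[Filter.atTop] (fun n => (logStar n : ℝ)) ∧ A.Solves S P T,
            ∃ i, ∃ f, AvoidsOnGraph P (tileGraph S (F i ^ logStar (m i)) (hD i) (m i)) f,
            {i | ¬ ∃ f, AvoidsOnGraph P
              (tileGraph S (F i ^ logStar (m i)) (hD i) (m i)) f}.Finite ] := by
  constructor
  · tfae_have 1 → 2 := fun h X _ _ _ _ hX hfree =>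
      hasContinuousAvoidingColoring_of_freePart hk hP h X hX hfree
    tfae_have 2 → 3 := fun h => exists_localAlgorithm_of_colorSpace hk hS hP hconn
      (h (ColorSpace Γ) ColorSpace.isZeroDimensional ColorSpace.isFreeAction)
    tfae_have 3 → 1 := by
      rintro ⟨A, T, hT, hA⟩
      obtain ⟨D, hD, n, hfin, hn, f, hf⟩ := exists_tileGraph_of_solves hS hP hconn hT hA
      exact hasContinuousAvoidingColoring_of_tileGraph hfin hD hn hf _
        isZeroDimensional_freePart (isFreeAction_freePart _)
    tfae_finish
  · intro F m hFfin hF hFu _ hm hD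
    tfae_have 1 → 3 := by
      rintro ⟨A, T, hT, hA⟩
      exact finite_not_tileGraph_of_solves hS hP hconn hT hA hFfin hF hFu hm hD
    tfae_have 3 → 2 := fun h => by
      obtain ⟨i, hi⟩ := h.exists_notMem
      exact ⟨i, not_not.1 hi⟩
    -- The number `m i` may be too small for color reduction within windows `D i`. A detour through
    -- the color space, which needs only `|D i|² ≤ m i`, provides another graph with enough colors.
    tfae_have 2 → 1 := by
      rintro ⟨i, f, hf⟩
      exact exists_localAlgorithm_of_colorSpace hk hS hP hconn
        (hasContinuousAvoidingColoring_of_tileGraph (finite_set_pow (hFfin i) _) (hD i)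
          (ncard_pow_sq_le (hFfin i) (hm i)) hf _ ColorSpace.isZeroDimensional
          ColorSpace.isFreeAction)
    tfae_finish
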